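/- **Definitions.** Let $\Delta_+$ be the category of the finite ordinals $[n]=\{0<\dots<n\}$, $n\ge 0$, and strictly increasing maps. A *marked semisimplicial set* is a presheaf of sets on $\Delta_+$ together with a subset of its $1$-simplices, called marked edges; maps are the maps of presheaves that preserve marked edges. Write $\Delta^n$ for the presheaf represented by $[n]$, $\Lambda^n_k\subseteq\Delta^n$ for the $k$-th horn, $S^\sharp$ for $S$ with all edges marked. *Fibrations* are the maps with the right lifting property against the following maps: - for $n\ge 1$ and $0\le k\le n$, the marked horn inclusion $\Lambda^n_k\to\Delta^n$, where no edge is marked if $0<k<n$, exactly the edge $0\to 1$ is marked if $k=0$, and exactly the edge $(n-1)\to n$ is marked if $k=n$ (in $\Lambda^n_k$ the edge is marked if it belongs to $\Lambda^n_k$, that is, if $n\ge 2$); - the marking saturation inclusion $(\Delta^3,\{02,13\})\to(\Delta^3)^\sharp$. A marked semisimplicial set $X$ is *fibrant* if the map from $X$ to the terminal marked semisimplicial set is a fibration. The *geometric product* $A\otimes B$ has as $n$-simplices the tuples $(p,q,x,y)$ of monotone surjections $p\colon[n]\to[a]$ and $q\colon[n]\to[b]$ that are jointly injective, and simplices $x\in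 A_a$, $y\in B_b$; a strictly increasing map $f$ acts by factoring $pf$ and $qf$ as a surjection followed by an injection and restricting $x$ and $y$ along the injections. An edge of $A\otimes B$ is marked if each of its components $x,y$ that is an edge (rather than a vertex) is marked. Let $I=(\Delta^1)^\sharp$. A *homotopy* $f_0\sim f_1$ between maps $f_0,f_1\colon X\to Y$ is a map $I\otimes X\to Y$ that restricts to $f_0$ and $f_1$ on $\{0\}\otimes X\cong X$ and $\{1\}\otimes X\cong X$. A map $f\colon A\to B$ is a *homotopy equivalence* if there are a map $g\colon B\to A$ and homotopies $gf\sim\mathrm{id}_A$ and $fg\sim\mathrm{id}_B$. A *fibration category* is a category with two subcategories, of weak equivalences and of fibrations, each containing all isomorphisms, such that: (1) there is a terminal object and every map to a terminal object is a fibration; (2) pullbacks along fibrations exist and fibrations are stable under pullback; (3) maps that are both fibrations and weak equivalences are stable under pullback; (4) every map factors as a weak equivalence followed by a fibration; (5) weak equivalences satisfy 2-out-of-6: if $gf$ and $hg$ are weak equivalences, so are $f$, $g$, $h$ and $hgf$. **Theorem.** The full subcategory of fibrant marked semisimplicial sets, with the homotopy equivalences as weak equivalences and the fibrations as fibrations,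 is a fibration category. -/

import Mathlib

open CategoryTheory CategoryTheory.Limits Opposite
open SemiSimplexCategory (homEquiv)

universe u v w

/-! ## Fibration categories -/

/-- A fibration category: a category `C` with two subcategories `W` (weak equivalences) and
`F` (fibrations), each containing all isomorphisms, such that: there is a terminal object and every
object is fibrant; pullbacks along fibrations exist, and fibrations as well as trivial fibrations
are stable under pullback; every map factors as a weak equivalence followed by a fibration; weak
equivalences satisfy 2-out-of-6. -/
structure IsFibrationCategory {C : Type v} [Category.{w} C] (W F : MorphismProperty C) : Prop where
  weq_multiplicative : W.IsMultiplicative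
  weq_of_isIso : ∀ {X Y : C} (f : X ⟶ Y), IsIso f → W f
  fib_multiplicative : F.IsMultiplicative
  fib_of_isIso : ∀ {X Y : C} (f : X ⟶ Y), IsIso f → F f
  hasTerminal : HasTerminal C
  fibrant : ∀ {X T : C}, IsTerminal T → ∀ f : X ⟶ T, F f
  hasPullbacks : F.HasPullbacks
  fib_baseChange : F.IsStableUnderBaseChange
  trivFib_baseChange : (F ⊓ W).IsStableUnderBaseChange
  factorization : ∀ {X Y : C} (f : X ⟶ Y),
    ∃ (Z : C) (i : X ⟶ Z) (p : Z ⟶ Y), W i ∧ F p ∧ i ≫ p = f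
  two_out_of_six : ∀ {X Y Z T : C} (f : X ⟶ Y) (g : Y ⟶ Z) (h : Z ⟶ T),
    W (f ≫ g) → W (g ≫ h) → W f ∧ W g ∧ W h ∧ W (f ≫ g ≫ h)

/-! ## Marked semisimplicial sets -/

/-- The object `[n]` of the semisimplex category. -/
abbrev MSSet.ord (n : ℕ) : SemiSimplexCategory := SemiSimplexCategory.mk n

/-- Semisimplicial sets: presheaves on the category of finite ordinals `[n] = {0 < ... < n}` and
strictly increasing maps. -/
abbrev SemiSSet : Type (u + 1) := SemiSimplexCategoryᵒᵖ ⥤ Type u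

/-- A marked semisimplicial set: a semisimplicial set with a subset of its edges. -/
structure MSSet : Type (u + 1) where
  /-- the underlying semisimplicial set -/
  toSemiSSet : SemiSSet.{u}
  /-- the set of marked edges -/
  marked : Set (toSemiSSet.obj (op (MSSet.ord 1)))

namespace MSSet

/-- Maps of marked semisimplicial sets: natural transformations sending marked edges to marked
edges. -/
@[ext]
structure Hom (X Y : MSSet.{u}) where
  /-- the underlying map of semisimplicial sets -/
  map : X.toSemiSSet ⟶ Y.toSemiSSet
  map_marked : ∀ e ∈ X.marked, map.app (op (ord 1)) e ∈ Y.marked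

instance : Category MSSet.{u} where
  Hom := Hom
  id X := ⟨𝟙 _, fun e he => by simpa using he⟩
  comp f g := ⟨f.map ≫ g.map, fun e he => by
    simpa using g.map_marked _ (f.map_marked e he)⟩

@[ext]
theorem hom_ext {X Y : MSSet.{u}} {f g : X ⟶ Y} (h : f.map = g.map) : f = g :=
  Hom.ext h

@[simp]
theorem id_map (X : MSSet.{u}) : Hom.map (𝟙 X) = 𝟙 X.toSemiSSet := rfl

@[simp]
theorem comp_map {X Y Z : MSSet.{u}} (f : X ⟶ Y) (g : Y ⟶ Z) :
    (f ≫ g).map = f.map ≫ g.map := rfl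

/-! ## Fibrations -/

/-- The semisimplicial set represented by `[n]`; its `m`-simplices are the strictly increasing maps
`[m] → [n]`. -/
abbrev simplex (n : ℕ) : SemiSSet.{u} := uliftYoneda.{u}.obj (ord n)

/-- The strictly increasing map underlying a simplex of the standard simplex. -/
def simplexFun {n : ℕ} {m : SemiSimplexCategoryᵒᵖ} (s : (simplex.{u} n).obj m) :
    Fin (m.unop.len + 1) ↪o Fin (n + 1) :=
  homEquiv s.down

theorem simplexFun_map {n : ℕ} {m m' : SemiSimplexCategoryᵒᵖ} (f : m ⟶ m')
    (s : (simplex.{u} n).obj m) (i : Fin (m'.unop.len + 1)) :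
    simplexFun ((simplex.{u} n).map f s) i =
      simplexFun s (homEquiv f.unop i) := by
  have h : (simplex.{u} n).map f s = ULift.up (f.unop ≫ ULift.down s) := by simp
  rw [h]
  change homEquiv (f.unop ≫ ULift.down s) i = homEquiv (ULift.down s) (homEquiv f.unop i)
  rw [SemiSimplexCategory.homEquiv_comp, RelEmbedding.trans_apply]

/-- The horn `Λ[n, k]`: simplices of the `n`-simplex missing some vertex different from `k`. -/
def horn (n : ℕ) (k : Fin (n + 1)) : Subfunctor (simplex.{u} n) where
  obj m := {s | ∃ j : Fin (n + 1), j ≠ k ∧ j ∉ Set.range (simplexFun s)}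
  map := by
    rintro m m' f s ⟨j, hj, hjs⟩
    refine ⟨j, hj, ?_⟩
    rintro ⟨i, hi⟩
    exact hjs ⟨homEquiv f.unop i, (simplexFun_map f s i).symm.trans hi⟩

/-- The `n`-simplex with a prescribed set of marked edges; the set is given as a relation on the
vertices, an edge `i < j` being marked if `M i j` holds. -/
def markedSimplex (n : ℕ) (M : Fin (n + 1) → Fin (n + 1) → Prop) : MSSet.{u} where
  toSemiSSet := simplex n
  marked := {e | M (simplexFun e 0) (simplexFun e 1)}

/-- The horn with the marking restricted from `markedSimplex n M`. -/
def markedHorn (n : ℕ) (k : Fin (n + 1)) (M : Fin (n + 1) → Fin (n + 1) → Prop) :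
    MSSet.{u} where
  toSemiSSet := (horn n k).toFunctor
  marked := {e | M (simplexFun e.1 0) (simplexFun e.1 1)}

/-- The inclusion of a horn into the simplex, with the same set of marked edges. -/
def markedHornInclusion (n : ℕ) (k : Fin (n + 1)) (M : Fin (n + 1) → Fin (n + 1) → Prop) :
    markedHorn.{u} n k M ⟶ markedSimplex.{u} n M where
  map := (horn n k).ι
  map_marked _ he := he

/-- `IsCriticalEdge n k i j`: the edge `i → j` is the critical edge of the horn `Λ[n, k]`; this is
`0 → 1` if `k = 0`, and `n - 1 → n` if `k = n`; there is none if `0 < k < n`. -/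
def IsCriticalEdge (n : ℕ) (k i j : Fin (n + 1)) : Prop :=
  ((k : ℕ) = 0 ∧ (i : ℕ) = 0 ∧ (j : ℕ) = 1) ∨ ((k : ℕ) = n ∧ (i : ℕ) + 1 = n ∧ (j : ℕ) = n)

/-- The marking saturation inclusion `(Δ³, {02, 13}) ⟶ (Δ³)♯`, where all edges are marked in the
target. -/
def saturationInclusion :
    markedSimplex.{u} 3 (fun i j => (i = 0 ∧ j = 2) ∨ (i = 1 ∧ j = 3)) ⟶
      markedSimplex.{u} 3 (fun _ _ => True) where
  map := 𝟙 _
  map_marked _ _ := trivial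

/-- The generators: the marked horn inclusions (`n ≥ 1`; inner horns are minimally marked, in outer
horns just the critical edge is marked) and the marking saturation inclusion. -/
inductive anodyneGenerators : MorphismProperty MSSet.{u} where
  | horn (n : ℕ) (hn : 1 ≤ n) (k : Fin (n + 1)) :
      anodyneGenerators (markedHornInclusion.{u} n k (IsCriticalEdge n k))
  | saturation : anodyneGenerators saturationInclusion.{u}

/-- Fibrations: maps with the right lifting property against the generators. -/
def fibrations : MorphismProperty MSSet.{u} := anodyneGenerators.{u}.rlp

/-- The terminal marked semisimplicial set: one simplex in each dimension, its edge marked. -/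
def point : MSSet.{u} where
  toSemiSSet := (Functor.const _).obj PUnit
  marked := Set.univ

/-- The unique map to the terminal object. -/
def toPoint (X : MSSet.{u}) : X ⟶ point.{u} where
  map := { app := fun _ => TypeCat.ofHom fun _ => PUnit.unit }
  map_marked _ _ := trivial

/-- `point` is indeed terminal. -/
def isTerminalPoint : IsTerminal point.{u} :=
  IsTerminal.ofUniqueHom toPoint (fun _ _ => by ext; rfl)

/-- Fibrant objects: the map to the terminal object is a fibration. -/
def IsFibrant : ObjectProperty MSSet.{u} := fun X => fibrations (toPoint X)

/-! ## The geometric product -/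

/-- An `n`-simplex of the free simplicial set on `A`: a surjective monotone map `[n] → [a]` and an
`a`-simplex of `A`. -/
structure FreeSimplex (A : SemiSSet.{u}) (n : ℕ) : Type u where
  /-- the dimension `a` -/
  len : ℕ
  /-- the degeneracy operator `[n] → [a]` -/
  deg : Fin (n + 1) →o Fin (len + 1)
  surj : Function.Surjective deg
  /-- the simplex of `A` -/
  simplex : A.obj (op (ord len))

namespace FreeSimplex

variable {A : SemiSSet.{u}}

/-- `t` is the restriction of `s` along `θ`: there is a strictly increasing `d` such that
`s.deg ∘ θ = d ∘ t.deg` is the factorization into a surjection followed by an injection, and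
`t.simplex` is the restriction of `s.simplex` along `d`. -/
def IsRestriction {n m : ℕ} (s : FreeSimplex A n) (θ : Fin (m + 1) →o Fin (n + 1))
    (t : FreeSimplex A m) : Prop :=
  ∃ d : ord t.len ⟶ ord s.len,
    (∀ i, homEquiv d (t.deg i) = s.deg (θ i)) ∧
      A.map d.op s.simplex = t.simplex

theorem exists_isRestriction {n m : ℕ} (s : FreeSimplex A n) (θ : Fin (m + 1) →o Fin (n + 1)) :
    ∃ t, IsRestriction s θ t := by
  classical
  let S : Finset (Fin (s.len + 1)) := Finset.univ.image (fun i => s.deg (θ i))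
  have hS : S.card = (S.card - 1) + 1 := by
    have : 0 < S.card := Finset.card_pos.2 ⟨s.deg (θ 0), by simp [S]⟩
    omega
  let e := S.orderIsoOfFin hS
  have hmem : ∀ i, s.deg (θ i) ∈ S := fun i => by simp [S]
  let d : ord (S.card - 1) ⟶ ord s.len := homEquiv.symm (S.orderEmbOfFin hS)
  refine ⟨⟨S.card - 1,
    ⟨fun i => e.symm ⟨s.deg (θ i), hmem i⟩, fun i j hij => ?_⟩, ?_, A.map d.op s.simplex⟩,
    d, fun i => ?_, rfl⟩
  · exact e.symm.monotone (s.deg.monotone (θ.monotone hij))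
  · intro j
    obtain ⟨i, -, hi⟩ := Finset.mem_image.1 (e j).2
    refine ⟨i, ?_⟩
    change e.symm _ = j
    rw [OrderIso.symm_apply_eq]
    exact Subtype.ext hi
  · change S.orderEmbOfFin hS (e.symm ⟨s.deg (θ i), hmem i⟩) = _
    rw [← Finset.coe_orderIsoOfFin_apply]
    change ((e (e.symm _) : S) : Fin (s.len + 1)) = _
    rw [OrderIso.apply_symm_apply]

theorem IsRestriction.unique {n m : ℕ} {s : FreeSimplex A n} {θ : Fin (m + 1) →o Fin (n + 1)}
    {t t' : FreeSimplex A m} (h : IsRestriction s θ t) (h' : IsRestriction s θ t') : t = t' := by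
  obtain ⟨k, e, he, x⟩ := t
  obtain ⟨k', e', he', x'⟩ := t'
  obtain ⟨d, hd, hx⟩ := h
  obtain ⟨d', hd', hx'⟩ := h'
  dsimp only at *
  have hr : Set.range (homEquiv d) =
      Set.range (homEquiv d') := by
    ext y
    constructor
    · rintro ⟨j, rfl⟩
      obtain ⟨i, rfl⟩ := he j
      exact ⟨e' i, (hd' i).trans (hd i).symm⟩
    · rintro ⟨j, rfl⟩
      obtain ⟨i, rfl⟩ := he' j
      exact ⟨e i, (hd i).trans (hd' i).symm⟩
  obtain rfl : k = k' := by
    have h1 := Set.ncard_range_of_injective (homEquiv d).injective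
    have h2 := Set.ncard_range_of_injective (homEquiv d').injective
    rw [hr, h2] at h1
    simpa using h1.symm
  obtain rfl : d = d' := SemiSimplexCategory.hom_ext (OrderEmbedding.range_inj.1 hr)
  obtain rfl : e = e' := by
    ext1
    funext i
    exact (homEquiv d).injective ((hd i).trans (hd' i).symm)
  obtain rfl : x = x' := hx.symm.trans hx'
  rfl

/-- The restriction of a simplex of the free simplicial set along a monotone map. -/
noncomputable def restrict {n m : ℕ} (s : FreeSimplex A n) (θ : Fin (m + 1) →o Fin (n + 1)) :
    FreeSimplex A m :=
  (exists_isRestriction s θ).choose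

theorem isRestriction_restrict {n m : ℕ} (s : FreeSimplex A n) (θ : Fin (m + 1) →o Fin (n + 1)) :
    IsRestriction s θ (s.restrict θ) :=
  (exists_isRestriction s θ).choose_spec

theorem IsRestriction.restrict_eq {n m : ℕ} {s : FreeSimplex A n}
    {θ : Fin (m + 1) →o Fin (n + 1)} {t : FreeSimplex A m} (h : IsRestriction s θ t) :
    s.restrict θ = t :=
  (isRestriction_restrict s θ).unique h

theorem restrict_id {n : ℕ} (s : FreeSimplex A n) : s.restrict OrderHom.id = s :=
  IsRestriction.restrict_eq ⟨𝟙 _, fun _ => rfl, by simp⟩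

theorem restrict_restrict {n m k : ℕ} (s : FreeSimplex A n) (θ : Fin (m + 1) →o Fin (n + 1))
    (ψ : Fin (k + 1) →o Fin (m + 1)) :
    (s.restrict θ).restrict ψ = s.restrict (θ.comp ψ) := by
  obtain ⟨d, hd, hx⟩ := isRestriction_restrict s θ
  obtain ⟨d', hd', hx'⟩ := isRestriction_restrict (s.restrict θ) ψ
  refine (IsRestriction.restrict_eq ⟨d' ≫ d, fun i => ?_, ?_⟩).symm
  · simp only [SemiSimplexCategory.homEquiv_comp, RelEmbedding.trans_apply, hd', hd]
    rfl
  · rw [op_comp, Functor.map_comp, ← hx', ← hx]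
    rfl

theorem restrict_deg_eq_iff {n m : ℕ} (s : FreeSimplex A n) (θ : Fin (m + 1) →o Fin (n + 1))
    (i j : Fin (m + 1)) :
    (s.restrict θ).deg i = (s.restrict θ).deg j ↔ s.deg (θ i) = s.deg (θ j) := by
  obtain ⟨d, hd, -⟩ := isRestriction_restrict s θ
  rw [← hd, ← hd]
  exact (homEquiv d).injective.eq_iff.symm

/-- The simplex of the free simplicial set given by a simplex of `A`. -/
def ofSimplex {n : ℕ} (x : A.obj (op (ord n))) : FreeSimplex A n where
  len := n
  deg := OrderHom.id
  surj := Function.surjective_id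
  simplex := x

/-- The totally degenerate simplex on a vertex of `A`. -/
def ofVertex (a : A.obj (op (ord 0))) (n : ℕ) : FreeSimplex A n where
  len := 0
  deg := ⟨fun _ => 0, fun _ _ _ => le_rfl⟩
  surj := fun j => ⟨0, (Fin.fin_one_eq_zero j).symm⟩
  simplex := a

/-- An edge of the free simplicial set is marked, relative to a set `W` of marked edges of `A`, if
it is degenerate or an element of `W`. -/
def IsMarked (W : Set (A.obj (op (ord 1)))) (s : FreeSimplex A 1) : Prop :=
  ∀ x : A.obj (op (ord 1)), s = ofSimplex x → x ∈ W

theorem restrict_ofSimplex {n m : ℕ} (x : A.obj (op (ord n))) (f : ord m ⟶ ord n) :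
    (ofSimplex x).restrict (homEquiv f).toOrderHom =
      ofSimplex (A.map f.op x) :=
  IsRestriction.restrict_eq ⟨f, fun _ => rfl, rfl⟩

theorem restrict_ofVertex {n m : ℕ} (a : A.obj (op (ord 0))) (θ : Fin (m + 1) →o Fin (n + 1)) :
    (ofVertex a n).restrict θ = ofVertex a m :=
  IsRestriction.restrict_eq ⟨𝟙 (ord 0), fun _ => rfl, by
    change A.map (𝟙 (op (ord 0))) a = a
    simp⟩

theorem isMarked_ofSimplex {W : Set (A.obj (op (ord 1)))} {x : A.obj (op (ord 1))} :
    IsMarked W (ofSimplex x) ↔ x ∈ W := by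
  refine ⟨fun h => h x rfl, fun h y hy => ?_⟩
  cases hy
  exact h

theorem isMarked_ofVertex {W : Set (A.obj (op (ord 1)))} (a : A.obj (op (ord 0))) :
    IsMarked W (ofVertex a 1) := fun _ hx =>
  absurd (congrArg FreeSimplex.len hx) (by simp [ofVertex, ofSimplex])

end FreeSimplex

/-- The geometric product of semisimplicial sets: an `n`-simplex consists of surjective monotone
maps `[n] → [a]` and `[n] → [b]`, jointly injective, with an `a`-simplex of `A` and a `b`-simplex
of `B`. -/
noncomputable def semiTensor (A B : SemiSSet.{u}) : SemiSSet.{u} where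
  obj n := {st : FreeSimplex A n.unop.len × FreeSimplex B n.unop.len //
    ∀ i j, st.1.deg i = st.1.deg j → st.2.deg i = st.2.deg j → i = j}
  map {n m} f := TypeCat.ofHom fun st =>
    ⟨(st.1.1.restrict (homEquiv f.unop).toOrderHom,
      st.1.2.restrict (homEquiv f.unop).toOrderHom), fun i j h₁ h₂ =>
      (homEquiv f.unop).injective
        (st.2 _ _ ((FreeSimplex.restrict_deg_eq_iff _ _ _ _).1 h₁)
          ((FreeSimplex.restrict_deg_eq_iff _ _ _ _).1 h₂))⟩
  map_id n := by
    refine ConcreteCategory.hom_ext _ _ fun st => ?_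
    exact Subtype.ext (Prod.ext (FreeSimplex.restrict_id _) (FreeSimplex.restrict_id _))
  map_comp f g := by
    refine ConcreteCategory.hom_ext _ _ fun st => ?_
    exact Subtype.ext (Prod.ext
      (FreeSimplex.restrict_restrict st.1.1 (homEquiv f.unop).toOrderHom
        (homEquiv g.unop).toOrderHom).symm
      (FreeSimplex.restrict_restrict st.1.2 (homEquiv f.unop).toOrderHom
        (homEquiv g.unop).toOrderHom).symm)

/-- The geometric product of marked semisimplicial sets: an edge is marked if each of its two
components that is an edge (and not a vertex) is marked. -/
noncomputable def tensor (A B : MSSet.{u}) : MSSet.{u} where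
  toSemiSSet := semiTensor A.toSemiSSet B.toSemiSSet
  marked := {st | st.1.1.IsMarked A.marked ∧ st.1.2.IsMarked B.marked}

/-- The map `X ≅ Δ⁰ ⊗ X ⟶ A ⊗ X` induced by a vertex `a : Δ⁰ ⟶ A`. -/
noncomputable def vertexTensor {A : MSSet.{u}} (a : A.toSemiSSet.obj (op (ord 0)))
    (X : MSSet.{u}) : X ⟶ tensor A X where
  map :=
    { app := fun n => TypeCat.ofHom fun x =>
        ⟨(FreeSimplex.ofVertex a n.unop.len, FreeSimplex.ofSimplex x), fun _ _ _ h => h⟩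
      naturality := by
        intro n m f
        refine ConcreteCategory.hom_ext _ _ fun x => ?_
        exact Subtype.ext (Prod.ext (FreeSimplex.restrict_ofVertex _ _).symm
          (FreeSimplex.restrict_ofSimplex x f.unop).symm) }
  map_marked _ he := ⟨FreeSimplex.isMarked_ofVertex a, FreeSimplex.isMarked_ofSimplex.2 he⟩

/-! ## Homotopies -/

/-- The interval `(Δ¹)♯`. -/
def interval : MSSet.{u} := markedSimplex 1 (fun _ _ => True)

/-- The two vertices of the interval. -/
def intervalVertex (ε : Fin 2) : interval.{u}.toSemiSSet.obj (op (ord 0)) :=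
  ULift.up (homEquiv.symm
    (OrderEmbedding.ofStrictMono (fun _ => ε) (fun _ _ h => by omega) :
      Fin (0 + 1) ↪o Fin (1 + 1)))

/-- A homotopy from `f₀` to `f₁`: a map `I ⊗ X ⟶ Y` restricting to `f₀` and `f₁` on the two
endpoints of the interval `I`. -/
structure Homotopy {X Y : MSSet.{u}} (f₀ f₁ : X ⟶ Y) where
  /-- the underlying map out of the cylinder -/
  map : tensor interval.{u} X ⟶ Y
  map_zero : vertexTensor (intervalVertex 0) X ≫ map = f₀
  map_one : vertexTensor (intervalVertex 1) X ≫ map = f₁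

/-- Homotopy equivalences: maps `f : A ⟶ B` such that there are `g : B ⟶ A` and homotopies
`g ∘ f ∼ id` and `f ∘ g ∼ id`. -/
def homotopyEquivalences : MorphismProperty MSSet.{u} := fun A B f =>
  ∃ g : B ⟶ A, Nonempty (Homotopy (f ≫ g) (𝟙 A)) ∧ Nonempty (Homotopy (g ≫ f) (𝟙 B))

end MSSet

/-! Semisimplicial sets have no degeneracies, hence no identity edges and no constant homotopies.
Fillers of one-dimensional horns, which give a marked edge out of and into every vertex, serve as a
substitute.

Lifting problems are solved on cylinders `cyl X`. A simplex of the cylinder is either `tau j x`,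
which lies injectively over `x`, or `sigma j x`, in which the vertex `j` of `x` is doubled into a
vertical edge. A `HornPairing` matches the simplices outside a domain into fillers and missing
faces, in a well-founded order, and `PartialLift.exists_lift` extends a partial lift by filling
these horns one after another. New marked edges are controlled by 2-out-of-3 for marked edges, which
saturation implies for fibrant objects (`markedTwoOutOfThree_of_isFibrant`).

Two pairings are needed. `prismPairing` matches each `sigma j x` with one of its two `tau` faces; by
it, fibrations with fibrant source lift against the pushout product of an end of the interval with
any injective map (`exists_cylinder_lift`). `hornPrismPairing` treats the product of a horn
inclusion with both ends at once (`exists_prism_lift`).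

The first lifting result makes homotopy of maps into a fibrant object an equivalence relation:
diagonals of squares give transitivity, and reflexivity and symmetry follow by completing squares.
2-out-of-6 is then formal. The same result identifies the fibrations between fibrant objects that
are homotopy equivalences with the maps lifting against all injections: such a fibration has a
strict section, the homotopy from the identity to the section can be moved over a homotopy from the
identity of the base to itself, and pushing a lift along it solves every lifting problem. Being
defined by a lifting property, these maps are stable under pullback.

Factorizations are mapping path spaces. A simplex of the path object is a map out of the cylinder on
an unmarked simplex. Each evaluation is a trivial fibration by the first pairing, and both
evaluations together lift against the generators by the second. -/

namespace MSSet

/-! ## Elementwise interface -/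

/-- The `n`-simplices of a marked semisimplicial set. -/
abbrev cells (X : MSSet.{u}) (n : ℕ) : Type u := X.toSemiSSet.obj (op (ord n))

/-- The restriction of a simplex along a strictly increasing map. -/
def res {X : MSSet.{u}} {m n : ℕ} (θ : Fin (m + 1) ↪o Fin (n + 1)) (x : X.cells n) : X.cells m :=
  X.toSemiSSet.map (homEquiv (n := ord m) (m := ord n).symm θ).op x

/-- The action of a map on simplices. -/
def ap {X Y : MSSet.{u}} (f : X ⟶ Y) {n : ℕ} (x : X.cells n) : Y.cells n :=
  f.map.app (op (ord n)) x

theorem res_refl {X : MSSet.{u}} {n : ℕ} (x : X.cells n) : res (RelEmbedding.refl _) x = x := by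
  change X.toSemiSSet.map (𝟙 (op (ord n))) x = x
  simp

theorem res_res {X : MSSet.{u}} {l m n : ℕ} (θ : Fin (m + 1) ↪o Fin (n + 1))
    (ψ : Fin (l + 1) ↪o Fin (m + 1)) (x : X.cells n) :
    res ψ (res θ x) = res (ψ.trans θ) x := by
  change X.toSemiSSet.map _ (X.toSemiSSet.map _ x) = X.toSemiSSet.map _ x
  rw [← Functor.map_comp_apply, ← op_comp]
  congr 4
  exact homEquiv.injective (by rw [SemiSimplexCategory.homEquiv_comp]; simp)

theorem ap_res {X Y : MSSet.{u}} (f : X ⟶ Y) {m n : ℕ} (θ : Fin (m + 1) ↪o Fin (n + 1))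
    (x : X.cells n) : ap f (res θ x) = res θ (ap f x) :=
  NatTrans.naturality_apply f.map _ x

@[simp]
theorem ap_comp {X Y Z : MSSet.{u}} (f : X ⟶ Y) (g : Y ⟶ Z) {n : ℕ} (x : X.cells n) :
    ap (f ≫ g) x = ap g (ap f x) := rfl

theorem ap_mem {X Y : MSSet.{u}} (f : X ⟶ Y) {e : X.cells 1} (he : e ∈ X.marked) :
    ap f e ∈ Y.marked := f.map_marked e he

theorem hom_ext_ap {X Y : MSSet.{u}} {f g : X ⟶ Y} (h : ∀ n (x : X.cells n), ap f x = ap g x) :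
    f = g := by
  ext n x
  exact h n.unop.len x

theorem hom_congr {X Y : MSSet.{u}} {f g : X ⟶ Y} (h : f = g) {n : ℕ} (x : X.cells n) :
    ap f x = ap g x := by rw [h]

/-- A map of marked semisimplicial sets from its action on simplices. -/
def homMk {X Y : MSSet.{u}} (F : ∀ n, X.cells n → Y.cells n)
    (hF : ∀ {m n : ℕ} (θ : Fin (m + 1) ↪o Fin (n + 1)) (x : X.cells n),
      F m (res θ x) = res θ (F n x))
    (hm : ∀ e ∈ X.marked, F 1 e ∈ Y.marked) : X ⟶ Y where
  map :=
    { app := fun n => TypeCat.ofHom (F n.unop.len)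
      naturality := fun n m f => by
        refine ConcreteCategory.hom_ext _ _ fun x => ?_
        exact hF (homEquiv f.unop) x }
  map_marked := hm

/-- A marked semisimplicial set from its simplices and their restrictions. -/
def ofCells (K : ℕ → Type u) (r : ∀ {m n : ℕ}, (Fin (m + 1) ↪o Fin (n + 1)) → K n → K m)
    (r_refl : ∀ {n : ℕ} (x : K n), r (RelEmbedding.refl _) x = x)
    (r_trans : ∀ {l m n : ℕ} (θ : Fin (m + 1) ↪o Fin (n + 1)) (ψ : Fin (l + 1) ↪o Fin (m + 1))
      (x : K n), r ψ (r θ x) = r (ψ.trans θ) x)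
    (M : Set (K 1)) : MSSet.{u} where
  toSemiSSet :=
    { obj := fun n => K n.unop.len
      map := fun f => TypeCat.ofHom (r (homEquiv f.unop))
      map_id := fun n => by
        refine ConcreteCategory.hom_ext _ _ fun x => ?_
        exact r_refl x
      map_comp := fun f g => by
        refine ConcreteCategory.hom_ext _ _ fun x => ?_
        change r (homEquiv (g.unop ≫ f.unop)) x = r (homEquiv g.unop) (r (homEquiv f.unop) x)
        rw [r_trans, SemiSimplexCategory.homEquiv_comp] }
  marked := M

/-! ## Simplices of the standard simplices -/

/-- The simplex of the standard simplex given by a strictly increasing map. -/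
def mkSimplex {n : ℕ} (M : Fin (n + 1) → Fin (n + 1) → Prop) {m : ℕ}
    (θ : Fin (m + 1) ↪o Fin (n + 1)) : (markedSimplex.{u} n M).cells m :=
  ULift.up (homEquiv.symm θ)

/-- The strictly increasing map that is a simplex of the standard simplex. -/
def toEmb {n : ℕ} {M : Fin (n + 1) → Fin (n + 1) → Prop} {m : ℕ}
    (s : (markedSimplex.{u} n M).cells m) : Fin (m + 1) ↪o Fin (n + 1) := simplexFun s

section

variable {n : ℕ} {M : Fin (n + 1) → Fin (n + 1) → Prop}

@[simp]
theorem toEmb_mkSimplex {m : ℕ} (θ : Fin (m + 1) ↪o Fin (n + 1)) :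
    toEmb (mkSimplex.{u} M θ) = θ := rfl

@[simp]
theorem mkSimplex_toEmb {m : ℕ} (s : (markedSimplex.{u} n M).cells m) :
    mkSimplex M (toEmb s) = s := rfl

theorem toEmb_injective {m : ℕ} :
    Function.Injective (toEmb : (markedSimplex.{u} n M).cells m → _) :=
  fun s t h => by rw [← mkSimplex_toEmb s, h, mkSimplex_toEmb]

theorem toEmb_res {l m : ℕ} (ψ : Fin (l + 1) ↪o Fin (m + 1))
    (s : (markedSimplex.{u} n M).cells m) : toEmb (res ψ s) = ψ.trans (toEmb s) := by
  refine RelEmbedding.ext fun i => ?_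
  exact simplexFun_map (m := op (ord m)) (m' := op (ord l))
    (homEquiv (n := ord l) (m := ord m).symm ψ).op s i

theorem res_mkSimplex {l m : ℕ} (θ : Fin (m + 1) ↪o Fin (n + 1)) (ψ : Fin (l + 1) ↪o Fin (m + 1)) :
    res ψ (mkSimplex.{u} M θ) = mkSimplex M (ψ.trans θ) :=
  toEmb_injective (toEmb_res _ _)

theorem mem_marked_markedSimplex {e : (markedSimplex.{u} n M).cells 1} :
    e ∈ (markedSimplex n M).marked ↔ M (toEmb e 0) (toEmb e 1) := Iff.rfl

/-- The map out of a marked simplex that corresponds to a simplex. -/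
def ofCell {X : MSSet.{u}} (M : Fin (n + 1) → Fin (n + 1) → Prop) (x : X.cells n)
    (hM : ∀ θ : Fin (1 + 1) ↪o Fin (n + 1), M (θ 0) (θ 1) → res θ x ∈ X.marked) :
    markedSimplex.{u} n M ⟶ X :=
  homMk (fun _ s => res (toEmb s) x)
    (fun {m l} θ s => by rw [res_res, toEmb_res])
    (fun e he => hM _ he)

theorem ap_ofCell {X : MSSet.{u}} {m : ℕ} {x : X.cells n} (hM)
    (s : (markedSimplex.{u} n M).cells m) : ap (ofCell M x hM) s = res (toEmb s) x := rfl

theorem markedSimplex_hom_ext {X : MSSet.{u}} {f g : markedSimplex.{u} n M ⟶ X}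
    (h : ap f (mkSimplex M (RelEmbedding.refl _)) = ap g (mkSimplex M (RelEmbedding.refl _))) :
    f = g := by
  refine hom_ext_ap fun m s => ?_
  have : s = res (toEmb s) (mkSimplex M (RelEmbedding.refl _)) := by
    rw [res_mkSimplex]
    exact toEmb_injective (RelEmbedding.ext fun _ => rfl)
  rw [this, ap_res, ap_res, h]

variable {k : Fin (n + 1)}

/-- The strictly increasing map that is a simplex of a horn. -/
def hornEmb {m : ℕ} (s : (markedHorn.{u} n k M).cells m) : Fin (m + 1) ↪o Fin (n + 1) :=
  simplexFun s.1

theorem hornEmb_spec {m : ℕ} (s : (markedHorn.{u} n k M).cells m) :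
    ∃ j, j ≠ k ∧ j ∉ Set.range (hornEmb s) := s.2

/-- The simplex of a horn given by a strictly increasing map. -/
def mkHorn (k : Fin (n + 1)) (M : Fin (n + 1) → Fin (n + 1) → Prop) {m : ℕ}
    (θ : Fin (m + 1) ↪o Fin (n + 1)) (hθ : ∃ j, j ≠ k ∧ j ∉ Set.range θ) :
    (markedHorn.{u} n k M).cells m := ⟨mkSimplex M θ, hθ⟩

@[simp]
theorem mkHorn_hornEmb {m : ℕ} (s : (markedHorn.{u} n k M).cells m) :
    mkHorn k M (hornEmb s) (hornEmb_spec s) = s := rfl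

theorem hornEmb_injective {m : ℕ} :
    Function.Injective (hornEmb : (markedHorn.{u} n k M).cells m → _) := fun s t h => by
  rw [← mkHorn_hornEmb s, ← mkHorn_hornEmb t]
  congr 1

theorem hornEmb_res {l m : ℕ} (ψ : Fin (l + 1) ↪o Fin (m + 1))
    (s : (markedHorn.{u} n k M).cells m) : hornEmb (res ψ s) = ψ.trans (hornEmb s) := by
  refine RelEmbedding.ext fun i => ?_
  exact simplexFun_map (m := op (ord m)) (m' := op (ord l))
    (homEquiv (n := ord l) (m := ord m).symm ψ).op s.1 i

end

/-- The horn filling property of fibrations in terms of elements. -/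
theorem exists_filler {E B : MSSet.{u}} {p : E ⟶ B} (hp : fibrations p) {n : ℕ}
    (k : Fin (n + 1 + 1))
    (h : ∀ {m : ℕ} (θ : Fin (m + 1) ↪o Fin (n + 1 + 1)), (∃ j, j ≠ k ∧ j ∉ Set.range θ) →
      E.cells m)
    (h_res : ∀ {l m : ℕ} (θ : Fin (m + 1) ↪o Fin (n + 1 + 1)) (ψ : Fin (l + 1) ↪o Fin (m + 1))
      (hθ) (hψ), h (ψ.trans θ) hψ = res ψ (h θ hθ))
    (h_mem : ∀ (θ : Fin (1 + 1) ↪o Fin (n + 1 + 1)) (hθ),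
      IsCriticalEdge (n + 1) k (θ 0) (θ 1) → h θ hθ ∈ E.marked)
    (b : B.cells (n + 1))
    (hb : ∀ {m : ℕ} (θ : Fin (m + 1) ↪o Fin (n + 1 + 1)) (hθ), ap p (h θ hθ) = res θ b)
    (b_mem : ∀ θ : Fin (1 + 1) ↪o Fin (n + 1 + 1),
      IsCriticalEdge (n + 1) k (θ 0) (θ 1) → res θ b ∈ B.marked) :
    ∃ w : E.cells (n + 1), ap p w = b ∧
      (∀ {m : ℕ} (θ : Fin (m + 1) ↪o Fin (n + 1 + 1)) (hθ), res θ w = h θ hθ) ∧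
      ∀ θ : Fin (1 + 1) ↪o Fin (n + 1 + 1), IsCriticalEdge (n + 1) k (θ 0) (θ 1) →
        res θ w ∈ E.marked := by
  let H : markedHorn.{u} (n + 1) k (IsCriticalEdge (n + 1) k) ⟶ E :=
    homMk (fun m s => h (hornEmb s) (hornEmb_spec s))
      (fun {l m} θ s => by
        have e := hornEmb_res θ s
        rw [← h_res _ θ _ (e ▸ hornEmb_spec (res θ s))]
        congr 1)
      (fun e he => h_mem _ _ he)
  have sq : CommSq H (markedHornInclusion.{u} (n + 1) k (IsCriticalEdge (n + 1) k)) p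
      (ofCell _ b b_mem) := ⟨hom_ext_ap fun m s => hb (hornEmb s) (hornEmb_spec s)⟩
  have := hp _ (anodyneGenerators.horn (n + 1) (by omega) k)
  obtain ⟨⟨l, hl, hr⟩⟩ := (this.sq_hasLift sq).exists_lift
  refine ⟨ap l (mkSimplex _ (RelEmbedding.refl _)), ?_, fun θ hθ => ?_, fun θ hθ => ?_⟩
  · rw [← ap_comp, hr, ap_ofCell, toEmb_mkSimplex, res_refl]
  · rw [← ap_res, res_mkSimplex]
    exact hom_congr hl (mkHorn k _ θ hθ)
  · rw [← ap_res, res_mkSimplex]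
    exact ap_mem l hθ

end MSSet

namespace MSSet

/-! ## Extending partial lifts along horns -/

/-- The `i`-th coface map. -/
abbrev coface {n : ℕ} (i : Fin (n + 1 + 1)) : Fin (n + 1) ↪o Fin (n + 1 + 1) :=
  Fin.succAboveOrderEmb i

/-- The `i`-th face of a simplex. -/
def face {X : MSSet.{u}} {n : ℕ} (i : Fin (n + 1 + 1)) (x : X.cells (n + 1)) : X.cells n :=
  res (coface i) x

theorem ap_face {X Y : MSSet.{u}} (f : X ⟶ Y) {n : ℕ} (i : Fin (n + 1 + 1)) (x : X.cells (n + 1)) :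
    ap f (face i x) = face i (ap f x) := ap_res f _ _

/-- A simplex that misses the vertex `i` lies in the face opposite to `i`. -/
theorem exists_eq_trans_coface {m n : ℕ} (θ : Fin (m + 1) ↪o Fin (n + 1 + 1)) {i : Fin (n + 1 + 1)}
    (hi : i ∉ Set.range θ) : ∃ ψ : Fin (m + 1) ↪o Fin (n + 1), θ = ψ.trans (coface i) := by
  have h : ∀ j, ∃ l, i.succAbove l = θ j := fun j =>
    Fin.exists_succAbove_eq fun e => hi ⟨j, e⟩
  choose g hg using h
  refine ⟨OrderEmbedding.ofStrictMono g fun a b hab => ?_, ?_⟩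
  · rw [← (Fin.strictMono_succAbove i).lt_iff_lt, hg, hg]
    exact θ.strictMono hab
  · ext j
    exact congrArg Fin.val (hg j).symm

theorem coface_mem_horn_iff {n : ℕ} {k i : Fin (n + 1 + 1)} :
    (∃ j, j ≠ k ∧ j ∉ Set.range (coface i)) ↔ i ≠ k := by
  simp [coface]

/-- When all vertices other than `k` are hit, the dimension alone decides whether `k` is hit too,
and a strictly increasing map is determined by its range. -/
theorem emb_eq_of_range_subset {m n : ℕ} {k : Fin (n + 1)} {θ θ' : Fin (m + 1) ↪o Fin (n + 1)}
    (h : ∀ j, j ≠ k → j ∈ Set.range θ) (h' : ∀ j, j ≠ k → j ∈ Set.range θ') : θ = θ' := by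
  classical
  have key : ∀ θ : Fin (m + 1) ↪o Fin (n + 1), (∀ j, j ≠ k → j ∈ Set.range θ) →
      (k ∈ Set.range θ ↔ m = n) := by
    intro θ h
    have hc : Fintype.card (Set.range θ) = m + 1 := by
      rw [Set.card_range_of_injective θ.injective, Fintype.card_fin]
    constructor
    · intro hk
      have : Set.range θ = Set.univ := Set.eq_univ_of_forall fun j => by
        by_cases hj : j = k
        · exact hj ▸ hk
        · exact h j hj
      have h2 : Function.Bijective θ := ⟨θ.injective, Set.range_eq_univ.1 this⟩
      simpa using Fintype.card_of_bijective h2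
    · rintro rfl
      exact (Finite.injective_iff_surjective.1 θ.injective) k
  apply OrderEmbedding.range_inj.1
  ext j
  by_cases hj : j = k
  · rw [hj, key θ h, key θ' h']
  · exact iff_of_true (h j hj) (h' j hj)

theorem eq_coface_of_range {n : ℕ} {k : Fin (n + 1 + 1)} {θ : Fin (n + 1) ↪o Fin (n + 1 + 1)}
    (h : ∀ j, j ≠ k → j ∈ Set.range θ) : θ = coface k :=
  emb_eq_of_range_subset h fun j hj => by simpa [coface, Fin.range_succAbove] using hj

/-- Exactly two simplices are absent from a horn: the top one and the missing face. The dimension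
`m` is not fixed, so the alternative is stated in a sigma type. -/
theorem eq_refl_or_eq_coface {m n : ℕ} {k : Fin (n + 1 + 1)} {θ : Fin (m + 1) ↪o Fin (n + 1 + 1)}
    (h : ∀ j, j ≠ k → j ∈ Set.range θ) :
    (⟨m, θ⟩ : Σ m, Fin (m + 1) ↪o Fin (n + 1 + 1)) = ⟨n + 1, RelEmbedding.refl _⟩ ∨
      (⟨m, θ⟩ : Σ m, Fin (m + 1) ↪o Fin (n + 1 + 1)) = ⟨n, coface k⟩ := by
  by_cases hk : k ∈ Set.range θ
  · have hs : Function.Surjective θ := fun j => by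
      by_cases hj : j = k
      · exact hj ▸ hk
      · exact h j hj
    obtain rfl : m = n + 1 := by
      simpa using Fintype.card_of_bijective (f := θ) ⟨θ.injective, hs⟩
    left
    rw [emb_eq_of_range_subset (k := k) h (θ' := RelEmbedding.refl _) fun j _ => ⟨j, rfl⟩]
  · obtain ⟨ψ, rfl⟩ := exists_eq_trans_coface θ hk
    have hs : Function.Surjective ψ := fun j => by
      obtain ⟨i, hi⟩ := h (coface k j) (Fin.succAbove_ne k j)
      exact ⟨i, (coface k).injective hi⟩
    obtain rfl : m = n := by
      simpa using Fintype.card_of_bijective (f := ψ) ⟨ψ.injective, hs⟩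
    right
    rw [eq_coface_of_range h]

/-- The simplices `y` and `x` satisfy `Restricts x y` if `y` is a restriction of `x`. -/
def Restricts {X : MSSet.{u}} {m n : ℕ} (x : X.cells n) (y : X.cells m) : Prop :=
  ∃ θ : Fin (m + 1) ↪o Fin (n + 1), res θ x = y

/-- Marked edges satisfy 2-out-of-3: if two edges of a triangle are marked, then so is the third. -/
def MarkedTwoOutOfThree (X : MSSet.{u}) : Prop :=
  ∀ (k : Fin 3) (x : X.cells 2), (∀ i, i ≠ k → face i x ∈ X.marked) → face k x ∈ X.marked

/-- A partially defined lift of `b : Z ⟶ B` along `p : E ⟶ B`, given by its graph. -/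
structure PartialLift {E B Z : MSSet.{u}} (p : E ⟶ B) (b : Z ⟶ B) where
  /-- the graph -/
  rel : ∀ {n : ℕ}, Z.cells n → E.cells n → Prop
  rel_res : ∀ {m n : ℕ} (θ : Fin (m + 1) ↪o Fin (n + 1)) {z : Z.cells n} {e : E.cells n},
    rel z e → rel (res θ z) (res θ e)
  eq_of_rel : ∀ {n : ℕ} {z : Z.cells n} {e e' : E.cells n}, rel z e → rel z e' → e = e'
  comm : ∀ {n : ℕ} {z : Z.cells n} {e : E.cells n}, rel z e → ap p e = ap b z
  marked : ∀ {z : Z.cells 1} {e : E.cells 1}, rel z e → z ∈ Z.marked → e ∈ E.marked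

namespace PartialLift

variable {E B Z : MSSet.{u}} {p : E ⟶ B} {b : Z ⟶ B}

/-- The domain of a partial lift. -/
def Dom (G : PartialLift p b) {n : ℕ} (z : Z.cells n) : Prop := ∃ e, G.rel z e

theorem Dom.res {G : PartialLift p b} {m n : ℕ} {z : Z.cells n} (h : G.Dom z)
    (θ : Fin (m + 1) ↪o Fin (n + 1)) : G.Dom (MSSet.res θ z) := by
  obtain ⟨e, he⟩ := h
  exact ⟨_, G.rel_res θ he⟩

theorem Dom.of_restricts {G : PartialLift p b} {m n : ℕ} {z : Z.cells n} {y : Z.cells m}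
    (h : G.Dom z) (hy : Restricts z y) : G.Dom y := by
  obtain ⟨θ, rfl⟩ := hy
  exact h.res θ

instance : Preorder (PartialLift p b) where
  le G G' := ∀ (n : ℕ) (z : Z.cells n) (e : E.cells n), G.rel z e → G'.rel z e
  le_refl _ _ _ _ h := h
  le_trans _ _ _ h h' n z e he := h' n z e (h n z e he)

theorem Dom.mono {G G' : PartialLift p b} (h : G ≤ G') {n : ℕ} {z : Z.cells n} (hz : G.Dom z) :
    G'.Dom z :=
  Exists.imp (fun _ he => h _ _ _ he) hz

/-- The union of a chain of partial lifts. -/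
def sUnion (c : Set (PartialLift p b)) (hc : IsChain (· ≤ ·) c) : PartialLift p b where
  rel z e := ∃ G ∈ c, G.rel z e
  rel_res θ _ _ := fun ⟨G, hG, h⟩ => ⟨G, hG, G.rel_res θ h⟩
  eq_of_rel := by
    rintro n z e e' ⟨G, hG, h⟩ ⟨G', hG', h'⟩
    rcases hc.total hG hG' with hle | hle
    · exact G'.eq_of_rel (hle _ _ _ h) h'
    · exact G.eq_of_rel h (hle _ _ _ h')
  comm := fun ⟨G, _, h⟩ => G.comm h
  marked := fun ⟨G, _, h⟩ => G.marked h

/-- A partial lift defined everywhere is a lift. -/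
theorem exists_hom (G : PartialLift p b) (hG : ∀ (n : ℕ) (z : Z.cells n), G.Dom z) :
    ∃ H : Z ⟶ E, H ≫ p = b ∧ ∀ (n : ℕ) (z : Z.cells n), G.rel z (ap H z) := by
  choose F hF using hG
  refine ⟨homMk F (fun θ x => G.eq_of_rel (hF _ _) (G.rel_res θ (hF _ _)))
    (fun e he => G.marked (hF _ _) he), hom_ext_ap fun n x => G.comm (hF n x), hF⟩

/-- The partial lift given by a compatible family of lifts. -/
def ofFamily {ι : Type w} {W : ι → MSSet.{u}} (j : ∀ α, W α ⟶ Z) (h : ∀ α, W α ⟶ E)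
    (compat : ∀ (α β : ι) (n : ℕ) (x : (W α).cells n) (y : (W β).cells n),
      ap (j α) x = ap (j β) y → ap (h α) x = ap (h β) y)
    (comm : ∀ α, h α ≫ p = j α ≫ b)
    (marked : ∀ (α : ι) (x : (W α).cells 1), ap (j α) x ∈ Z.marked → ap (h α) x ∈ E.marked) :
    PartialLift p b where
  rel z e := ∃ (α : ι) (x : (W α).cells _), ap (j α) x = z ∧ ap (h α) x = e
  rel_res := by
    rintro m n θ _ _ ⟨α, x, rfl, rfl⟩
    exact ⟨α, res θ x, ap_res _ _ _, ap_res _ _ _⟩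
  eq_of_rel := by
    rintro n _ _ _ ⟨α, x, rfl, rfl⟩ ⟨β, y, h, rfl⟩
    exact compat _ _ _ _ _ h.symm
  comm := by
    rintro n _ _ ⟨α, x, rfl, rfl⟩
    exact hom_congr (comm α) x
  marked := by
    rintro _ _ ⟨α, x, rfl, rfl⟩
    exact marked α x

/-- Extension of a partial lift by a simplex whose intersection with the domain is a horn. -/
theorem exists_extension (hp : fibrations p) (hE : MarkedTwoOutOfThree E) (G : PartialLift p b)
    {n : ℕ} (z : Z.cells (n + 1)) (k : Fin (n + 1 + 1))
    (hface : ∀ i, i ≠ k → G.Dom (face i z)) (hk : ¬ G.Dom (face k z))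
    (hcrit : ∀ θ : Fin (1 + 1) ↪o Fin (n + 1 + 1), IsCriticalEdge (n + 1) k (θ 0) (θ 1) →
      res θ z ∈ Z.marked)
    (hmark : ∀ θ : Fin (1 + 1) ↪o Fin (n + 1 + 1), n = 1 → k ∉ Set.range θ → res θ z ∈ Z.marked →
      ∀ θ' : Fin (1 + 1) ↪o Fin (n + 1 + 1), res θ' z ∈ Z.marked) :
    ∃ G' : PartialLift p b, G ≤ G' ∧
      ∀ (m : ℕ) (y : Z.cells m), G'.Dom y ↔ G.Dom y ∨ Restricts z y := by
  -- The preimage of the domain under `z` is precisely the horn at `k`.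
  have hdom : ∀ {m : ℕ} (θ : Fin (m + 1) ↪o Fin (n + 1 + 1)),
      G.Dom (res θ z) ↔ ∃ j, j ≠ k ∧ j ∉ Set.range θ := by
    intro m θ
    constructor
    · intro h
      by_contra! hθ
      obtain h' | h' := eq_refl_or_eq_coface hθ <;> cases h'
      · rw [res_refl] at h
        exact hk (h.res _)
      · exact hk h
    · rintro ⟨j, hj, hjθ⟩
      obtain ⟨ψ, rfl⟩ := exists_eq_trans_coface θ hjθ
      rw [← res_res]
      exact (hface j hj).res ψ
  obtain ⟨w, hw, hwh, hwc⟩ := exists_filler hp k (fun θ hθ => ((hdom θ).2 hθ).choose)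
    (fun θ ψ hθ hψ => by
      refine G.eq_of_rel ((hdom _).2 hψ).choose_spec ?_
      rw [← res_res]
      exact G.rel_res ψ ((hdom _).2 hθ).choose_spec)
    (fun θ hθ hc => G.marked ((hdom _).2 hθ).choose_spec (hcrit θ hc))
    (ap b z)
    (fun θ hθ => by rw [G.comm ((hdom _).2 hθ).choose_spec, ap_res])
    (fun θ hc => by
      rw [← ap_res]
      exact ap_mem _ (hcrit θ hc))
  have hw' : ∀ {m : ℕ} (θ : Fin (m + 1) ↪o Fin (n + 1 + 1)), G.Dom (res θ z) →
      G.rel (res θ z) (res θ w) := fun θ hθ => by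
    rw [hwh θ ((hdom θ).1 hθ)]
    exact hθ.choose_spec
  refine ⟨{
    rel := fun {m} y e => G.rel y e ∨
      ∃ θ : Fin (m + 1) ↪o Fin (n + 1 + 1), res θ z = y ∧ res θ w = e
    rel_res := ?_
    eq_of_rel := ?_
    comm := ?_
    marked := ?_ }, fun _ _ _ h => Or.inl h, fun m y => ?_⟩
  · rintro l m ψ _ _ (h | ⟨θ, rfl, rfl⟩)
    · exact Or.inl (G.rel_res ψ h)
    · exact Or.inr ⟨ψ.trans θ, (res_res _ _ _).symm, (res_res _ _ _).symm⟩
  · rintro m _ _ _ (h | ⟨θ, rfl, rfl⟩) (h' | ⟨θ', hθ, rfl⟩)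
    · exact G.eq_of_rel h h'
    · subst hθ
      exact G.eq_of_rel h (hw' θ' ⟨_, h⟩)
    · exact G.eq_of_rel (hw' θ ⟨_, h'⟩) h'
    -- Different `θ` and `θ'` may restrict `z` to the same simplex. Inside the domain the value is
    -- fixed by `G`; outside, both maps contain all vertices but possibly `k` and have equal
    -- dimension, so they agree.
    · by_cases hd : G.Dom (res θ z)
      · exact G.eq_of_rel (hw' θ hd) (hθ ▸ hw' θ' (hθ ▸ hd))
      · have h1 := (hdom θ).not.1 hd
        have h2 := (hdom θ').not.1 (hθ ▸ hd)
        push Not at h1 h2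
        rw [emb_eq_of_range_subset h1 h2]
  · rintro m _ _ (h | ⟨θ, rfl, rfl⟩)
    · exact G.comm h
    · rw [ap_res, hw, ap_res]
  · rintro _ _ (h | ⟨θ, rfl, rfl⟩) hm
    · exact G.marked h hm
    · by_cases hd : G.Dom (res θ z)
      · exact G.marked (hw' θ hd) hm
      have h1 := (hdom θ).not.1 hd
      push Not at h1
      -- A new edge is either `z` itself, which is then the critical edge of a one-dimensional horn
      -- and has a marked filler, or the missing face of a triangle, where 2-out-of-3 in `E` applies
      -- to the other two edges.
      obtain h' | h' := eq_refl_or_eq_coface h1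
      · obtain rfl : 0 = n := by
          have := congrArg Sigma.fst h'
          simp only at this
          omega
        refine hwc θ ?_
        have := θ.strictMono (show (0 : Fin 2) < 1 by decide)
        unfold IsCriticalEdge
        omega
      · cases h'
        refine hE k w fun i hi => ?_
        exact G.marked (hw' (coface i) (hface i hi)) (hmark _ rfl (by simp) hm _)
  · constructor
    · rintro ⟨e, h | ⟨θ, h, -⟩⟩
      · exact Or.inl ⟨e, h⟩
      · exact Or.inr ⟨θ, h⟩
    · rintro (⟨e, h⟩ | ⟨θ, rfl⟩)
      · exact ⟨e, Or.inl h⟩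
      · exact ⟨_, Or.inr ⟨θ, rfl, rfl⟩⟩

end PartialLift

/-! ### Horn pairings -/

/-- A presentation of the simplices outside `D` by successive horn fillings: the simplex `cell j`
is added by filling the horn at the vertex `idx j`, in the order given by `rank`. -/
structure HornPairing (Z : MSSet.{u}) (D : ∀ {n : ℕ}, Z.cells n → Prop) where
  /-- the type of fillers -/
  ι : Type w
  /-- the dimension of the horn's missing face -/
  dim : ι → ℕ
  /-- the filler -/
  cell : ∀ j, Z.cells (dim j + 1)
  /-- the vertex opposite to the horn's missing face -/
  idx : ∀ j, Fin (dim j + 1 + 1)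
  /-- the order of attachment -/
  rank : ι → ℕ ×ₗ ℕ
  exists_restricts : ∀ {n : ℕ} (z : Z.cells n), ¬ D z → ∃ j, Restricts (cell j) z
  face_idx : ∀ j, ¬ D (face (idx j) (cell j))
  face_of_ne : ∀ (j) (i), i ≠ idx j → D (face i (cell j)) ∨
    ∃ j', rank j' < rank j ∧ Restricts (cell j') (face i (cell j))
  -- Together with `ne`: a missing face belongs to only one filler and is not itself a filler, so
  -- filling one horn never uses up the missing face of another.
  inj : ∀ j j', (⟨_, face (idx j) (cell j)⟩ : Σ n, Z.cells n) = ⟨_, face (idx j') (cell j')⟩ →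
    j = j'
  ne : ∀ j j', (⟨_, cell j⟩ : Σ n, Z.cells n) ≠ ⟨_, face (idx j') (cell j')⟩
  critical : ∀ (j) (θ : Fin (1 + 1) ↪o Fin (dim j + 1 + 1)),
    IsCriticalEdge (dim j + 1) (idx j) (θ 0) (θ 1) → res θ (cell j) ∈ Z.marked
  -- For a triangle whose new edge is marked, the two old edges must be marked as well, so that
  -- 2-out-of-3 marks the image of the new one.
  marked : ∀ (j) (θ : Fin (1 + 1) ↪o Fin (dim j + 1 + 1)), dim j = 1 → idx j ∉ Set.range θ →
    res θ (cell j) ∈ Z.marked →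
      ∀ θ' : Fin (1 + 1) ↪o Fin (dim j + 1 + 1), res θ' (cell j) ∈ Z.marked

/-- A restriction of a simplex is the simplex itself, a given face, or a restriction of another
face. -/
theorem Restricts.cases {X : MSSet.{u}} {m n : ℕ} {x : X.cells (n + 1)} {y : X.cells m}
    (h : Restricts x y) (k : Fin (n + 1 + 1)) : (⟨_, y⟩ : Σ n, X.cells n) = ⟨_, x⟩ ∨
      (⟨_, y⟩ : Σ n, X.cells n) = ⟨_, face k x⟩ ∨ ∃ i, i ≠ k ∧ Restricts (face i x) y := by
  obtain ⟨θ, rfl⟩ := h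
  by_cases hs : ∀ j, j ≠ k → j ∈ Set.range θ
  · obtain h' | h' := eq_refl_or_eq_coface hs <;> cases h'
    · exact Or.inl (by rw [res_refl])
    · exact Or.inr (Or.inl rfl)
  · push Not at hs
    obtain ⟨i, hik, hi⟩ := hs
    obtain ⟨ψ, rfl⟩ := exists_eq_trans_coface θ hi
    exact Or.inr (Or.inr ⟨i, hik, ψ, res_res _ _ _⟩)

/-- A partial lift extends to a lift if its domain has a horn pairing. -/
theorem PartialLift.exists_lift {E B Z : MSSet.{u}} {p : E ⟶ B} {b : Z ⟶ B} (hp : fibrations p)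
    (hE : MarkedTwoOutOfThree E) (G : PartialLift p b)
    (P : HornPairing.{u, w} Z (fun {_} z => G.Dom z)) :
    ∃ H : Z ⟶ E, H ≫ p = b ∧ ∀ (n : ℕ) (z : Z.cells n) (e : E.cells n), G.rel z e → ap H z = e := by
  -- The invariant for Zorn's lemma: a missing face is never defined before its filler. Thus a
  -- filler that is still undefined meets the domain in no more than its horn.
  let S : Set (PartialLift p b) := {G' | G ≤ G' ∧
    ∀ j, G'.Dom (face (P.idx j) (P.cell j)) → G'.Dom (P.cell j)}
  have hGS : G ∈ S := ⟨le_rfl, fun j h => absurd h (P.face_idx j)⟩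
  obtain ⟨G', -, hmax⟩ : ∃ G', G ≤ G' ∧ Maximal (· ∈ S) G' := by
    refine zorn_le_nonempty₀ S (fun c hcS hc y hy => ?_) G hGS
    refine ⟨sUnion c hc, ⟨fun n z e h => ⟨y, hy, (hcS hy).1 n z e h⟩, ?_⟩,
      fun G₁ h₁ n z e h => ⟨G₁, h₁, h⟩⟩
    rintro j ⟨e, G₁, h₁, h⟩
    obtain ⟨e', h'⟩ := (hcS h₁).2 j ⟨e, h⟩
    exact ⟨e', G₁, h₁, h'⟩
  have hS := hmax.prop
  have hall : ∀ j, G'.Dom (P.cell j) := by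
    by_contra! hne
    -- At an undefined filler of least rank, all faces except the missing one lie in the original
    -- domain or in fillers that are already defined.
    obtain ⟨j, hj, hmin⟩ : ∃ j, ¬ G'.Dom (P.cell j) ∧
        ∀ j', P.rank j' < P.rank j → G'.Dom (P.cell j') := by
      obtain ⟨j, hj, h⟩ := (InvImage.wf P.rank (wellFounded_lt (α := ℕ ×ₗ ℕ))).has_min
        {j | ¬ G'.Dom (P.cell j)} hne
      exact ⟨j, hj, fun j' hj' => by_contra fun h' => h j' h' hj'⟩
    have hfc : ∀ i, i ≠ P.idx j → G'.Dom (face i (P.cell j)) := fun i hi => by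
      obtain h | ⟨j', hlt, h⟩ := P.face_of_ne j i hi
      · exact h.mono hS.1
      · exact (hmin j' hlt).of_restricts h
    obtain ⟨G'', hle, hdom⟩ := G'.exists_extension hp hE (P.cell j) (P.idx j) hfc
      (fun h => hj (hS.2 j h)) (P.critical j) (P.marked j)
    -- The extension adds only the filler and its missing face. If either is the missing face of
    -- `j'`, then `ne` excludes the first possibility and `inj` gives `j = j'` in the second.
    have hG'' : G'' ∈ S := by
      refine ⟨hS.1.trans hle, fun j' hj' => ?_⟩
      rw [hdom] at hj' ⊢
      by_cases hd : G'.Dom (face (P.idx j') (P.cell j'))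
      · exact Or.inl (hS.2 j' hd)
      right
      obtain h | h | ⟨i, hi, h⟩ := (hj'.resolve_left hd).cases (P.idx j)
      · exact absurd h.symm (P.ne j j')
      · obtain rfl := P.inj _ _ h
        exact ⟨_, res_refl _⟩
      · exact absurd ((hfc i hi).of_restricts h) hd
    exact hj (((hdom _ _).2 (Or.inr ⟨_, res_refl _⟩)).mono (hmax.le_of_ge hG'' hle))
  obtain ⟨H, hH, hrel⟩ := G'.exists_hom fun n z => by
    by_contra hz
    obtain ⟨j, hj⟩ := P.exists_restricts z fun h => hz (h.mono hS.1)
    exact hz ((hall j).of_restricts hj)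
  exact ⟨H, hH, fun n z e he => G'.eq_of_rel (hrel n z) (hS.1 n z e he)⟩

end MSSet

namespace MSSet

/-! ## Marked edges of fibrant objects -/

theorem coface_trans_coface {n : ℕ} {i j : Fin (n + 1 + 1)} (h : i ≤ j) :
    (coface j).trans (coface i.castSucc) = (coface i).trans (coface j.succ) := by
  ext l
  simp only [RelEmbedding.trans_apply, Fin.succAboveOrderEmb_apply, Fin.succAbove, Fin.lt_def,
    Fin.le_def] at h ⊢
  split_ifs <;> simp_all <;> omega

theorem face_face {X : MSSet.{u}} {n : ℕ} {i j : Fin (n + 1 + 1)} (h : i ≤ j)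
    (x : X.cells (n + 1 + 1)) : face i (face j.succ x) = face j (face i.castSucc x) := by
  simp only [face, res_res, coface_trans_coface h]

/-- A horn is the union of its faces, so the faces glue once they agree on common restrictions. The
marking of the critical edge is retained, since it matters for one-dimensional horns, which impose
no marking on the faces. -/
theorem exists_filler_of_faces' {X : MSSet.{u}} (hX : IsFibrant X) {n : ℕ} (k : Fin (n + 1 + 1))
    (y : Fin (n + 1 + 1) → X.cells n)
    (compat : ∀ i j, i ≠ k → j ≠ k → ∀ (m : ℕ) (ψ ψ' : Fin (m + 1) ↪o Fin (n + 1)),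
      ψ.trans (coface i) = ψ'.trans (coface j) → res ψ (y i) = res ψ' (y j))
    (crit : ∀ i, i ≠ k → ∀ ψ : Fin (1 + 1) ↪o Fin (n + 1),
      IsCriticalEdge (n + 1) k (coface i (ψ 0)) (coface i (ψ 1)) → res ψ (y i) ∈ X.marked) :
    ∃ w : X.cells (n + 1), (∀ i, i ≠ k → face i w = y i) ∧
      ∀ θ : Fin (1 + 1) ↪o Fin (n + 1 + 1), IsCriticalEdge (n + 1) k (θ 0) (θ 1) →
        res θ w ∈ X.marked := by
  have key : ∀ (m : ℕ) (θ : Fin (m + 1) ↪o Fin (n + 1 + 1)), (∃ j, j ≠ k ∧ j ∉ Set.range θ) →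
      ∃ e : X.cells m, ∀ i, i ≠ k → ∀ ψ : Fin (m + 1) ↪o Fin (n + 1), θ = ψ.trans (coface i) →
        e = res ψ (y i) := by
    rintro m θ ⟨j, hj, hjθ⟩
    obtain ⟨ψ, rfl⟩ := exists_eq_trans_coface θ hjθ
    exact ⟨res ψ (y j), fun i hi ψ' h => compat _ _ hj hi _ _ _ h⟩
  choose e he using key
  obtain ⟨w, -, hw, hc⟩ := exists_filler (p := toPoint X) hX k (fun θ hθ => e _ θ hθ)
    (fun θ ψ hθ hψ => by
      obtain ⟨j, hj, hjθ⟩ := id hθ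
      obtain ⟨χ, rfl⟩ := exists_eq_trans_coface θ hjθ
      rw [he _ _ hθ j hj χ rfl, he _ _ hψ j hj (ψ.trans χ) rfl, res_res])
    (fun θ hθ hcr => by
      obtain ⟨j, hj, hjθ⟩ := id hθ
      obtain ⟨χ, rfl⟩ := exists_eq_trans_coface θ hjθ
      rw [he _ _ hθ j hj χ rfl]
      exact crit j hj χ hcr)
    PUnit.unit (fun _ _ => rfl) (fun _ _ => trivial)
  refine ⟨w, fun i hi => ?_, hc⟩
  exact (hw (coface i) (coface_mem_horn_iff.2 hi)).trans
    ((he _ _ _ i hi (RelEmbedding.refl _) (RelEmbedding.ext fun _ => rfl)).trans (res_refl _))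

/-- Horn filling in terms of compatible families of faces. -/
theorem exists_filler_of_faces {X : MSSet.{u}} (hX : IsFibrant X) {n : ℕ}
    (k : Fin (n + 1 + 1 + 1)) (y : Fin (n + 1 + 1 + 1) → X.cells (n + 1))
    (compat : ∀ i j : Fin (n + 1 + 1), i ≤ j → i.castSucc ≠ k → j.succ ≠ k →
      face i (y j.succ) = face j (y i.castSucc))
    (crit : ∀ i, i ≠ k → ∀ ψ : Fin (1 + 1) ↪o Fin (n + 1 + 1),
      IsCriticalEdge (n + 1 + 1) k (coface i (ψ 0)) (coface i (ψ 1)) → res ψ (y i) ∈ X.marked) :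
    ∃ w : X.cells (n + 1 + 1), ∀ i, i ≠ k → face i w = y i := by
  -- A simplex common to the faces `i < j` lies in their intersection, which is a face of
  -- codimension two; agreement there is the hypothesis `compat`.
  have key : ∀ i j : Fin (n + 1 + 1 + 1), i < j → i ≠ k → j ≠ k →
      ∀ (m : ℕ) (ψ ψ' : Fin (m + 1) ↪o Fin (n + 1 + 1)),
      ψ.trans (coface i) = ψ'.trans (coface j) → res ψ (y i) = res ψ' (y j) := by
    intro i j hij hi hj m ψ ψ' h
    obtain ⟨i, rfl⟩ := Fin.exists_castSucc_eq.2 (Fin.ne_last_of_lt hij)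
    obtain ⟨j, rfl⟩ := Fin.exists_succ_eq.2 (Fin.ne_zero_of_lt hij)
    have hle : i ≤ j := by simp only [Fin.lt_def, Fin.le_def] at hij ⊢; simp at hij; omega
    obtain ⟨χ, rfl⟩ := exists_eq_trans_coface (i := j) ψ (by
      rintro ⟨l, hl⟩
      have := DFunLike.congr_fun h l
      simp only [RelEmbedding.trans_apply, hl] at this
      refine Fin.succAbove_ne j.succ (ψ' l) (this.symm.trans ?_)
      exact Fin.succAbove_of_le_castSucc _ _ (Fin.castSucc_le_castSucc_iff.2 hle))
    obtain ⟨χ', rfl⟩ := exists_eq_trans_coface (i := i) ψ' (by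
      rintro ⟨l, hl⟩
      have := DFunLike.congr_fun h l
      simp only [RelEmbedding.trans_apply, hl] at this
      refine Fin.succAbove_ne i.castSucc _ (this.trans ?_)
      exact Fin.succAbove_of_castSucc_lt _ _ (Fin.castSucc_lt_succ_iff.2 hle))
    have hχ : χ = χ' := by
      refine RelEmbedding.ext fun l => ((coface i).trans (coface j.succ)).injective ?_
      have := DFunLike.congr_fun h l
      rw [← coface_trans_coface hle]
      refine this.trans ?_
      rw [coface_trans_coface hle]
      rfl
    subst hχ
    have := compat i j hle hi hj
    rw [← res_res, ← res_res]
    exact congrArg (res χ) this.symm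
  obtain ⟨w, hw, -⟩ := exists_filler_of_faces' hX k y (fun i j hi hj m ψ ψ' h => by
    rcases lt_trichotomy i j with hij | rfl | hij
    · exact key i j hij hi hj m ψ ψ' h
    · congr 1
      exact RelEmbedding.ext fun l => (coface i).injective (DFunLike.congr_fun h l)
    · exact (key j i hij hj hi m ψ' ψ h.symm).symm) crit
  exact ⟨w, hw⟩

/-- Filling a one-dimensional horn replaces the missing identity edge: the edge starts at `x` for `k
= 0` and ends at `x` for `k = 1`, but its other vertex is not under control. -/
theorem exists_marked_edge {X : MSSet.{u}} (hX : IsFibrant X) (k : Fin 2) (x : X.cells 0) :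
    ∃ e : X.cells 1, e ∈ X.marked ∧ ∀ i, i ≠ k → face i e = x := by
  obtain ⟨w, hw, hc⟩ := exists_filler_of_faces' hX (n := 0) k (fun _ => x)
    (fun i j hi hj m ψ ψ' h => by
      obtain rfl : i = j := by omega
      congr 1
      exact RelEmbedding.ext fun l => (coface i).injective (DFunLike.congr_fun h l))
    (fun i hi ψ => absurd (Fintype.card_le_of_embedding ψ.toEmbedding) (by simp))
  refine ⟨w, ?_, hw⟩
  have := hc (RelEmbedding.refl _) (by
    unfold IsCriticalEdge
    fin_cases k <;> simp)
  rwa [res_refl] at this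

/-- A `3`-simplex of a fibrant object has all edges marked if the edges `02` and `13` are. -/
theorem marked_of_saturation {X : MSSet.{u}} (hX : IsFibrant X) (w : X.cells 3)
    (h₁ : face (n := 1) 1 (face (n := 2) 3 w) ∈ X.marked)
    (h₂ : face (n := 1) 1 (face (n := 2) 0 w) ∈ X.marked) (θ : Fin (1 + 1) ↪o Fin (3 + 1)) :
    res θ w ∈ X.marked := by
  have sq : CommSq (ofCell (fun i j => (i = 0 ∧ j = 2) ∨ (i = 1 ∧ j = 3)) w (fun ψ hψ => by
      rcases hψ with ⟨h0, h1⟩ | ⟨h0, h1⟩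
      · convert h₁ using 1
        simp only [face, res_res]
        congr 1
        ext i
        fin_cases i
        · exact congrArg Fin.val h0
        · exact congrArg Fin.val h1
      · convert h₂ using 1
        simp only [face, res_res]
        congr 1
        ext i
        fin_cases i
        · exact congrArg Fin.val h0
        · exact congrArg Fin.val h1)) saturationInclusion.{u} (toPoint X) (toPoint _) :=
    ⟨isTerminalPoint.hom_ext _ _⟩
  have := hX _ anodyneGenerators.saturation
  obtain ⟨⟨l, hl, -⟩⟩ := (this.sq_hasLift sq).exists_lift
  have h := hom_congr hl (mkSimplex _ θ)
  rw [ap_ofCell, toEmb_mkSimplex] at h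
  rw [← h]
  exact ap_mem l (e := mkSimplex _ θ) trivial

/-- In a triangle the faces `0`, `1`, `2` are the edges 12, 02, 01. Hence the critical edge is face
`2` for `k = 0` and face `0` for `k = 2`. -/
theorem exists_triangle {X : MSSet.{u}} (hX : IsFibrant X) (k : Fin 3) (y : Fin 3 → X.cells 1)
    (compat : ∀ i j : Fin 2, i ≤ j → i.castSucc ≠ k → j.succ ≠ k →
      face (n := 0) i (y j.succ) = face (n := 0) j (y i.castSucc))
    (crit : k = 0 → y 2 ∈ X.marked) (crit' : k = 2 → y 0 ∈ X.marked) :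
    ∃ w : X.cells 2, ∀ i, i ≠ k → face (n := 1) i w = y i := by
  refine exists_filler_of_faces hX (n := 0) k y compat fun i hi ψ hψ => ?_
  have hψ' : ψ = RelEmbedding.refl _ :=
    emb_eq_of_range_subset (k := 0) (fun j _ => Finite.injective_iff_surjective.1 ψ.injective j)
      fun j _ => ⟨j, rfl⟩
  subst hψ'
  rw [res_refl]
  unfold IsCriticalEdge at hψ
  fin_cases k <;> fin_cases i <;> simp at hi hψ crit crit' ⊢ <;> assumption

theorem exists_triangle_zero {X : MSSet.{u}} (hX : IsFibrant X) {f c : X.cells 1}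
    (hf : f ∈ X.marked) (h : face (n := 0) 1 f = face (n := 0) 1 c) :
    ∃ w : X.cells 2, face (n := 1) 2 w = f ∧ face (n := 1) 1 w = c := by
  obtain ⟨w, hw⟩ := exists_triangle hX 0 ![c, c, f] (fun i j hij hi hj => by
    fin_cases i <;> fin_cases j <;>
      first | exact absurd hij (by decide) | exact absurd rfl hi | exact absurd rfl hj | exact h)
    (fun _ => hf) (fun h => absurd h (by decide))
  exact ⟨w, hw 2 (by decide), hw 1 (by decide)⟩

theorem exists_triangle_one {X : MSSet.{u}} (hX : IsFibrant X) {f g : X.cells 1}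
    (h : face (n := 0) 0 f = face (n := 0) 1 g) :
    ∃ w : X.cells 2, face (n := 1) 2 w = f ∧ face (n := 1) 0 w = g := by
  obtain ⟨w, hw⟩ := exists_triangle hX 1 ![g, g, f] (fun i j hij hi hj => by
    fin_cases i <;> fin_cases j <;>
      first | exact absurd hij (by decide) | exact absurd rfl hi | exact absurd rfl hj | exact h)
    (fun h => absurd h (by decide)) (fun h => absurd h (by decide))
  exact ⟨w, hw 2 (by decide), hw 0 (by decide)⟩

theorem exists_triangle_two {X : MSSet.{u}} (hX : IsFibrant X) {g c : X.cells 1}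
    (hg : g ∈ X.marked) (h : face (n := 0) 0 c = face (n := 0) 0 g) :
    ∃ w : X.cells 2, face (n := 1) 0 w = g ∧ face (n := 1) 1 w = c := by
  obtain ⟨w, hw⟩ := exists_triangle hX 2 ![g, c, c] (fun i j hij hi hj => by
    fin_cases i <;> fin_cases j <;>
      first | exact absurd hij (by decide) | exact absurd rfl hi | exact absurd rfl hj | exact h)
    (fun h => absurd h (by decide)) (fun _ => hg)
  exact ⟨w, hw 0 (by decide), hw 1 (by decide)⟩

/-- The triangle is made a face of a 3-simplex whose edges 02 and 13 are marked; saturation then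
marks all edges. One of these two edges is a given one, the other is a marked edge `m` from a
one-dimensional horn. -/
theorem markedTwoOutOfThree_of_isFibrant {X : MSSet.{u}} (hX : IsFibrant X) :
    MarkedTwoOutOfThree X := by
  intro k σ hσ
  have v1 : face (n := 0) 1 (face (n := 1) 2 σ) = face (n := 0) 1 (face (n := 1) 1 σ) :=
    face_face (n := 0) (i := 1) (j := 1) le_rfl σ
  have v2 : face (n := 0) 0 (face (n := 1) 2 σ) = face (n := 0) 1 (face (n := 1) 0 σ) :=
    face_face (n := 0) (i := 0) (j := 1) (by decide) σ
  have v3 : face (n := 0) 0 (face (n := 1) 1 σ) = face (n := 0) 0 (face (n := 1) 0 σ) :=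
    face_face (n := 0) (i := 0) (j := 0) (by decide) σ
  fin_cases k
  -- Write `σ = xyz`. With a marked `m : v → y`, the 3-simplex has vertices `v, x, y, z`: the edge
  -- 02 is `m`, the edge 13 is `xz`, and 23 is the wanted edge `yz`.
  · have hf := hσ 2 (by decide)
    have hc := hσ 1 (by decide)
    obtain ⟨m, hm, hm'⟩ := exists_marked_edge hX 1 (face (n := 0) 0 (face (n := 1) 2 σ))
    obtain ⟨α, hα0, hα1⟩ := exists_triangle_two hX (c := m) hf (hm' 0 (by decide))
    obtain ⟨β, hβ2, hβ0⟩ := exists_triangle_one hX (f := m) (g := face 0 σ)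
      ((hm' 0 (by decide)).trans v2)
    obtain ⟨w, hw⟩ := exists_filler_of_faces hX (n := 1) 2 ![σ, β, σ, α]
      (fun i j hij hi hj => by
        fin_cases i <;> fin_cases j <;>
          first | exact absurd hij (by decide) | exact absurd rfl hi | exact absurd rfl hj
                | exact hβ0 | exact hα0 | exact hα1.trans hβ2.symm)
      (fun i hi ψ hψ => by unfold IsCriticalEdge at hψ; simp at hψ)
    have h0 := hw 0 (by decide)
    have h3 := hw 3 (by decide)
    have := marked_of_saturation hX w (by rw [h3]; exact hα1 ▸ hm) (by rw [h0]; exact hc)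
      ((coface 0).trans (coface 0))
    have h0' : res (coface 0) w = σ := h0
    rw [← res_res] at this
    exact h0' ▸ this
  -- With a marked `m : x → v`, the vertices are `x, y, v, z`: the edge 02 is `m`, 13 is `yz`, and
  -- 03 is the wanted edge `xz`. The horn at `0` is outer, with critical edge the marked `xy`.
  · have hf := hσ 2 (by decide)
    have hg := hσ 0 (by decide)
    obtain ⟨m, hm, hm'⟩ := exists_marked_edge hX 0 (face (n := 0) 1 (face (n := 1) 2 σ))
    replace hm' := hm' 1 (by decide)
    obtain ⟨α, hα2, hα1⟩ := exists_triangle_zero hX (c := m) hf hm'.symm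
    obtain ⟨β, hβ2, hβ1⟩ := exists_triangle_zero hX (f := m) (c := face 1 σ) hm
      (hm'.trans v1)
    obtain ⟨w, hw⟩ := exists_filler_of_faces hX (n := 1) 0 ![σ, β, σ, α]
      (fun i j hij hi hj => by
        fin_cases i <;> fin_cases j <;>
          first | exact absurd hij (by decide) | exact absurd rfl hi | exact absurd rfl hj
                | exact hβ1.symm | exact hα2 | exact hα1.trans hβ2.symm)
      (fun i hi ψ hψ => by
        have h1' : i ≠ 1 := by
          rintro rfl
          rcases hψ with ⟨-, -, h⟩ | ⟨h, -⟩
          · exact Fin.succAbove_ne 1 (ψ 1) (Fin.ext h)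
          · exact absurd h (by decide)
        have hψ' : ψ = coface 2 := eq_coface_of_range fun j hj => by
          rcases hψ with ⟨-, h0, h1⟩ | ⟨h, -⟩
          · have hc : ∀ i : Fin 4, i ≠ 0 → i ≠ 1 →
                i.succAbove (0 : Fin 3) = 0 ∧ i.succAbove (1 : Fin 3) = 1 := by decide
            obtain ⟨c0, c1⟩ := hc i hi h1'
            have e0 : ψ 0 = 0 := (coface i).injective ((Fin.ext h0).trans c0.symm)
            have e1 : ψ 1 = 1 := (coface i).injective ((Fin.ext h1).trans c1.symm)
            fin_cases j
            · exact ⟨0, e0⟩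
            · exact ⟨1, e1⟩
            · exact absurd rfl hj
          · exact absurd h (by decide)
        subst hψ'
        fin_cases i
        · exact absurd rfl hi
        · exact absurd rfl h1'
        · exact hf
        · have : res (coface 2) α = face 2 σ := hα2
          exact this ▸ hf)
    have h2 := hw 2 (by decide)
    have h3 := hw 3 (by decide)
    have h02 := face_face (i := 0) (j := 1) (by decide) w
    have := marked_of_saturation hX w (by rw [h3]; exact hα1 ▸ hm)
      (by
        have e : face (n := 1) 1 (face (n := 2) 0 w) = face 0 σ :=
          h02.symm.trans (congrArg (face 0) h2)
        rw [e]; exact hg)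
      ((coface 1).trans (coface 2))
    have h2' : res (coface 2) w = σ := h2
    rw [← res_res] at this
    exact h2' ▸ this
  -- With a marked `m : y → v`, the vertices are `x, y, z, v`: the edge 02 is `xz`, 13 is `m`, and
  -- 01 is the wanted edge `xy`. The triangle `γ` also occupies the unused slot of the horn at `1`.
  · have hg := hσ 0 (by decide)
    have hc := hσ 1 (by decide)
    obtain ⟨m, hm, hm'⟩ := exists_marked_edge hX 0 (face (n := 0) 1 (face (n := 1) 0 σ))
    replace hm' := hm' 1 (by decide)
    obtain ⟨β, hβ2, hβ1⟩ := exists_triangle_zero hX (c := m) hg hm'.symm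
    obtain ⟨γ, hγ2, hγ0⟩ := exists_triangle_one hX (f := face 2 σ) (g := m) (v2.trans hm'.symm)
    obtain ⟨w, hw⟩ := exists_filler_of_faces hX (n := 1) 1 ![β, γ, γ, σ]
      (fun i j hij hi hj => by
        fin_cases i <;> fin_cases j <;>
          first | exact absurd hij (by decide) | exact absurd rfl hi | exact absurd rfl hj
                | exact hβ2.symm | exact hγ2.symm | exact hγ0.trans hβ1.symm)
      (fun i hi ψ hψ => by unfold IsCriticalEdge at hψ; simp at hψ)
    have h0 := hw 0 (by decide)
    have h3 := hw 3 (by decide)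
    have := marked_of_saturation hX w (by rw [h3]; exact hc) (by rw [h0]; exact hβ1 ▸ hm)
      ((coface 2).trans (coface 3))
    have h3' : res (coface 3) w = σ := h3
    rw [← res_res] at this
    exact h3' ▸ this

end MSSet

namespace MSSet

/-! ## The cylinder -/

namespace FreeSimplex

variable {A : MSSet.{u}}

theorem isRestriction_of_emb {n m : ℕ} {s : FreeSimplex A.toSemiSSet n}
    {θ : Fin (m + 1) →o Fin (n + 1)} {t : FreeSimplex A.toSemiSSet m}
    (d : Fin (t.len + 1) ↪o Fin (s.len + 1)) (hd : ∀ i, d (t.deg i) = s.deg (θ i))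
    (h : res (X := A) d s.simplex = t.simplex) : IsRestriction s θ t :=
  ⟨homEquiv (n := ord t.len) (m := ord s.len).symm d, hd, h⟩

theorem exists_emb_restrict {n m : ℕ} (s : FreeSimplex A.toSemiSSet n)
    (θ : Fin (m + 1) →o Fin (n + 1)) :
    ∃ d : Fin ((s.restrict θ).len + 1) ↪o Fin (s.len + 1),
      (∀ i, d ((s.restrict θ).deg i) = s.deg (θ i)) ∧
        res (X := A) d s.simplex = (s.restrict θ).simplex := by
  obtain ⟨d, hd, h⟩ := isRestriction_restrict s θ
  exact ⟨homEquiv d, hd, h⟩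

theorem exists_eq_ofSimplex {n : ℕ} (s : FreeSimplex A.toSemiSSet n)
    (hs : Function.Injective s.deg) : ∃ x : A.cells n, s = ofSimplex x := by
  obtain ⟨l, deg, surj, x⟩ := s
  obtain rfl : n = l := by
    simpa using Fintype.card_of_bijective (f := deg) ⟨hs, surj⟩
  refine ⟨x, ?_⟩
  have : deg = OrderHom.id := by
    have e : OrderEmbedding.ofStrictMono deg (deg.monotone.strictMono_of_injective hs) =
      RelEmbedding.refl _ := emb_eq_of_range_subset (k := 0) (fun j _ => surj j) fun j _ => ⟨j, rfl⟩
    ext i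
    exact congrArg Fin.val (DFunLike.congr_fun e i)
  subst this
  rfl

theorem ofSimplex_injective {n : ℕ} :
    Function.Injective (ofSimplex : A.cells n → FreeSimplex A.toSemiSSet n) := fun x y h => by
  cases h
  rfl

/-- The action of a map on simplices of the free simplicial set. -/
def map {A B : MSSet.{u}} (f : A ⟶ B) {n : ℕ} (s : FreeSimplex A.toSemiSSet n) :
    FreeSimplex B.toSemiSSet n where
  len := s.len
  deg := s.deg
  surj := s.surj
  simplex := ap f s.simplex

theorem map_restrict {A B : MSSet.{u}} (f : A ⟶ B) {n m : ℕ} (s : FreeSimplex A.toSemiSSet n)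
    (θ : Fin (m + 1) →o Fin (n + 1)) : (s.map f).restrict θ = (s.restrict θ).map f := by
  obtain ⟨d, hd, h⟩ := exists_emb_restrict s θ
  refine IsRestriction.restrict_eq (isRestriction_of_emb d hd ?_)
  exact (ap_res f d s.simplex).symm.trans (congrArg (ap f) h)

theorem isMarked_map {A B : MSSet.{u}} (f : A ⟶ B) {s : FreeSimplex A.toSemiSSet 1}
    (hs : s.IsMarked A.marked) : (s.map f).IsMarked B.marked := by
  intro x hx
  obtain ⟨l, deg, surj, y⟩ := s
  cases hx
  exact ap_mem f (hs y rfl)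

/-- The degeneracy of a simplex in the free simplicial set. -/
def degen {n : ℕ} (j : Fin (n + 1)) (x : A.cells n) : FreeSimplex A.toSemiSSet (n + 1) where
  len := n
  deg := ⟨j.predAbove, Fin.predAbove_right_monotone j⟩
  surj := Fin.predAbove_surjective j
  simplex := x

end FreeSimplex

open FreeSimplex

section Tensor

variable {A B : MSSet.{u}}

/-- The first component of a simplex of the geometric product. -/
def tfst {n : ℕ} (z : (tensor A B).cells n) : FreeSimplex A.toSemiSSet n := z.1.1

/-- The second component of a simplex of the geometric product. -/
def tsnd {n : ℕ} (z : (tensor A B).cells n) : FreeSimplex B.toSemiSSet n := z.1.2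

/-- A simplex of the geometric product from its two components. -/
def tmk {n : ℕ} (s : FreeSimplex A.toSemiSSet n) (t : FreeSimplex B.toSemiSSet n)
    (h : ∀ i j, s.deg i = s.deg j → t.deg i = t.deg j → i = j) : (tensor A B).cells n :=
  ⟨(s, t), h⟩

theorem tensor_inj {n : ℕ} (z : (tensor A B).cells n) (i j : Fin (n + 1))
    (h : (tfst z).deg i = (tfst z).deg j) (h' : (tsnd z).deg i = (tsnd z).deg j) : i = j :=
  z.2 i j h h'

theorem tensor_ext {n : ℕ} {z z' : (tensor A B).cells n} (h : tfst z = tfst z')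
    (h' : tsnd z = tsnd z') : z = z' :=
  Subtype.ext (Prod.ext h h')

theorem tfst_res {m n : ℕ} (θ : Fin (m + 1) ↪o Fin (n + 1)) (z : (tensor A B).cells n) :
    tfst (res θ z) = (tfst z).restrict θ.toOrderHom := rfl

theorem tsnd_res {m n : ℕ} (θ : Fin (m + 1) ↪o Fin (n + 1)) (z : (tensor A B).cells n) :
    tsnd (res θ z) = (tsnd z).restrict θ.toOrderHom := rfl

/-- Functoriality of the geometric product in the second variable. -/
noncomputable def tensorMap (A : MSSet.{u}) {X Y : MSSet.{u}} (f : X ⟶ Y) :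
    tensor A X ⟶ tensor A Y :=
  homMk (fun _ z => tmk (tfst z) ((tsnd z).map f) (tensor_inj z))
    (fun θ z => tensor_ext rfl (map_restrict f (tsnd z) θ.toOrderHom).symm)
    (fun _ he => ⟨he.1, isMarked_map f he.2⟩)

@[simp]
theorem tfst_tensorMap {X Y : MSSet.{u}} (f : X ⟶ Y) {n : ℕ} (z : (tensor A X).cells n) :
    tfst (ap (tensorMap A f) z) = tfst z := rfl

theorem tensorMap_id (X : MSSet.{u}) : tensorMap A (𝟙 X) = 𝟙 _ :=
  hom_ext_ap fun _ _ => rfl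

theorem tensorMap_comp {X Y Z : MSSet.{u}} (f : X ⟶ Y) (g : Y ⟶ Z) :
    tensorMap A (f ≫ g) = tensorMap A f ≫ tensorMap A g :=
  hom_ext_ap fun _ _ => rfl

theorem vertexTensor_naturality (a : A.toSemiSSet.obj (op (ord 0))) {X Y : MSSet.{u}}
    (f : X ⟶ Y) : vertexTensor a X ≫ tensorMap A f = f ≫ vertexTensor a Y :=
  hom_ext_ap fun _ _ => rfl

end Tensor

/-- The strictly increasing map that is a simplex of the interval. -/
def intervalEmb {m : ℕ} (s : interval.{u}.cells m) : Fin (m + 1) ↪o Fin 2 := simplexFun s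

theorem res_intervalEmb {m : ℕ} (s : interval.{u}.cells m) :
    res (intervalEmb s) (mkSimplex (fun _ _ => True) (RelEmbedding.refl _) : interval.cells 1) =
      s :=
  toEmb_injective (M := fun _ _ => True) ((toEmb_res _ _).trans (RelEmbedding.ext fun _ => rfl))

theorem intervalEmb_res {l m : ℕ} (ψ : Fin (l + 1) ↪o Fin (m + 1)) (s : interval.{u}.cells m) :
    intervalEmb (res ψ s) = ψ.trans (intervalEmb s) :=
  toEmb_res (M := fun _ _ => True) ψ s

/-- The monotone map that a simplex of the free simplicial set on the interval amounts to. -/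
def coord {n : ℕ} (s : FreeSimplex interval.{u}.toSemiSSet n) : Fin (n + 1) →o Fin 2 :=
  (intervalEmb s.simplex).toOrderHom.comp s.deg

/-- Every simplex is the restriction of the generic edge along its coordinate map, and restrictions
are unique. -/
theorem coord_injective {n : ℕ} :
    Function.Injective (coord : FreeSimplex interval.{u}.toSemiSSet n → _) := by
  have key : ∀ s : FreeSimplex interval.{u}.toSemiSSet n, IsRestriction
      (ofSimplex (mkSimplex (fun _ _ => True) (RelEmbedding.refl _) : interval.{u}.cells 1))
      (coord s) s := fun s =>
    isRestriction_of_emb (intervalEmb s.simplex) (fun _ => rfl) (res_intervalEmb _)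
  intro s t h
  exact (key s).unique (h ▸ key t)

@[simp]
theorem coord_restrict {m n : ℕ} (s : FreeSimplex interval.{u}.toSemiSSet n)
    (θ : Fin (m + 1) →o Fin (n + 1)) : coord (s.restrict θ) = (coord s).comp θ := by
  obtain ⟨d, hd, h⟩ := exists_emb_restrict s θ
  ext i
  change (intervalEmb (s.restrict θ).simplex ((s.restrict θ).deg i)).val = _
  rw [← h, intervalEmb_res]
  change (intervalEmb s.simplex (d _)).val = _
  rw [hd]
  rfl

/-- The simplex of the free simplicial set on the interval given by a monotone map. -/
noncomputable def ofCoord {n : ℕ} (φ : Fin (n + 1) →o Fin 2) :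
    FreeSimplex interval.{u}.toSemiSSet n :=
  (ofSimplex (mkSimplex (fun _ _ => True) (RelEmbedding.refl _) : interval.{u}.cells 1)).restrict φ

@[simp]
theorem coord_ofCoord {n : ℕ} (φ : Fin (n + 1) →o Fin 2) : coord (ofCoord.{u} φ) = φ :=
  (coord_restrict _ _).trans rfl

@[simp]
theorem coord_ofVertex (ε : Fin 2) (n : ℕ) (i : Fin (n + 1)) :
    coord (ofVertex (intervalVertex.{u} ε) n) i = ε := rfl

theorem coord_eq_iff {n : ℕ} (s : FreeSimplex interval.{u}.toSemiSSet n) (i j : Fin (n + 1)) :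
    coord s i = coord s j ↔ s.deg i = s.deg j :=
  (intervalEmb s.simplex).injective.eq_iff

theorem isMarked_interval (s : FreeSimplex interval.{u}.toSemiSSet 1) :
    s.IsMarked interval.marked := fun _ _ => trivial

/-- The cylinder on `X`. -/
noncomputable abbrev cyl (X : MSSet.{u}) : MSSet.{u} := tensor interval X

/-- The map of cylinders induced by a map. -/
noncomputable abbrev cylMap {X Y : MSSet.{u}} (f : X ⟶ Y) : cyl X ⟶ cyl Y := tensorMap interval f

/-- The inclusion of an end of the cylinder. -/
noncomputable abbrev cylEnd (ε : Fin 2) (X : MSSet.{u}) : X ⟶ cyl X :=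
  vertexTensor (intervalVertex ε) X

section Cylinder

variable {X Y : MSSet.{u}}

theorem cyl_ext {n : ℕ} {z z' : (cyl X).cells n} (h : ∀ i, coord (tfst z) i = coord (tfst z') i)
    (h' : tsnd z = tsnd z') : z = z' :=
  tensor_ext (coord_injective (OrderHom.ext _ _ (funext h))) h'

/-- The monotone map with values `0` below `j` and `1` from `j` on. -/
def thr (n j : ℕ) : Fin (n + 1) →o Fin 2 where
  toFun i := if i.val < j then 0 else 1
  monotone' a b hab := by
    dsimp only
    have : a.val ≤ b.val := hab
    split_ifs with h1 h2
    · exact le_rfl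
    · exact Fin.zero_le _
    · omega
    · exact le_rfl

theorem thr_apply (n j : ℕ) (i : Fin (n + 1)) : thr n j i = if i.val < j then 0 else 1 := rfl

theorem exists_eq_thr {n : ℕ} (φ : Fin (n + 1) →o Fin 2) : ∃ j ≤ n + 1, φ = thr n j := by
  classical
  by_cases h : ∃ i, φ i = 1
  · obtain ⟨i, hi, hmin⟩ := (wellFounded_lt (α := Fin (n + 1))).has_min {i | φ i = 1} h
    refine ⟨i, by omega, OrderHom.ext _ _ (funext fun l => ?_)⟩
    rw [thr_apply]
    split_ifs with hl
    · have : φ l ≠ 1 := fun h => hmin l h hl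
      omega
    · have h1 : φ i ≤ φ l := φ.monotone (Fin.le_def.2 (not_lt.1 hl))
      have h2 : φ i = 1 := hi
      omega
  · push Not at h
    refine ⟨n + 1, le_rfl, OrderHom.ext _ _ (funext fun l => ?_)⟩
    rw [thr_apply, if_pos l.isLt]
    have := h l
    omega

/-- The simplex of the cylinder that lies over a simplex `x` and changes from the end `0` to the end
`1` before the vertex `j`. -/
noncomputable def tau {n : ℕ} (j : ℕ) (x : X.cells n) : (cyl X).cells n :=
  tmk (ofCoord (thr n j)) (ofSimplex x) (fun _ _ _ h => h)

/-- The simplex of the cylinder that lies over a simplex `x` and changes from the end `0` to the end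
`1` at the vertex `j`. -/
noncomputable def sigma {n : ℕ} (j : Fin (n + 1)) (x : X.cells n) : (cyl X).cells (n + 1) :=
  tmk (ofCoord (thr (n + 1) (j + 1))) (degen j x) (fun a b h h' => by
    rw [← coord_eq_iff, coord_ofCoord, thr_apply, thr_apply] at h
    change j.predAbove a = j.predAbove b at h'
    simp only [Fin.predAbove, Fin.lt_def, Fin.val_castSucc] at h'
    split_ifs at h h' <;> simp [Fin.ext_iff] at h h' ⊢ <;> omega)

@[simp]
theorem coord_tau {n : ℕ} (j : ℕ) (x : X.cells n) : coord (tfst (tau j x)) = thr n j :=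
  coord_ofCoord _

@[simp]
theorem tsnd_tau {n : ℕ} (j : ℕ) (x : X.cells n) : tsnd (tau j x) = ofSimplex x := rfl

@[simp]
theorem coord_sigma {n : ℕ} (j : Fin (n + 1)) (x : X.cells n) :
    coord (tfst (sigma j x)) = thr (n + 1) (j + 1) :=
  coord_ofCoord _

@[simp]
theorem tsnd_sigma {n : ℕ} (j : Fin (n + 1)) (x : X.cells n) :
    tsnd (sigma j x) = degen j x := rfl

theorem cylMap_tau (f : X ⟶ Y) {n : ℕ} (j : ℕ) (x : X.cells n) :
    ap (cylMap f) (tau j x) = tau j (ap f x) := rfl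

theorem cylMap_sigma (f : X ⟶ Y) {n : ℕ} (j : Fin (n + 1)) (x : X.cells n) :
    ap (cylMap f) (sigma j x) = sigma j (ap f x) := rfl

theorem cylEnd_one {n : ℕ} (x : X.cells n) : ap (cylEnd 1 X) x = tau 0 x :=
  cyl_ext (fun i => by rw [coord_tau, thr_apply, if_neg (by simp)]; rfl) rfl

theorem cylEnd_zero {n : ℕ} (x : X.cells n) : ap (cylEnd 0 X) x = tau (n + 1) x :=
  cyl_ext (fun i => by rw [coord_tau, thr_apply, if_pos i.isLt]; rfl) rfl

/-- If the interval coordinate is constant, joint injectivity leaves no room for a degeneracy in the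
other component. -/
theorem eq_cylEnd {X : MSSet.{u}} {n : ℕ} {z : (cyl X).cells n} {ε : Fin 2}
    (h : ∀ i, coord (tfst z) i = ε) :
    ∃ x, tsnd z = ofSimplex x ∧ z = ap (cylEnd ε X) x := by
  obtain ⟨x, hx⟩ := (tsnd z).exists_eq_ofSimplex fun i j hij =>
    tensor_inj z i j ((coord_eq_iff _ _ _).1 ((h i).trans (h j).symm)) hij
  exact ⟨x, hx, cyl_ext (fun i => (h i).trans (coord_ofVertex.{u} ε n i).symm) hx⟩

/-- The simplices of the cylinder. -/
theorem cyl_cases {n : ℕ} (z : (cyl X).cells n) :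
    (∃ j ≤ n + 1, ∃ x, z = tau j x) ∨
      ∃ (m : ℕ) (j : Fin (m + 1)) (x : X.cells m),
        (⟨n, z⟩ : Σ n, (cyl X).cells n) = ⟨m + 1, sigma j x⟩ := by
  by_cases hinj : Function.Injective (tsnd z).deg
  · obtain ⟨x, hx⟩ := (tsnd z).exists_eq_ofSimplex hinj
    obtain ⟨j, hj, h⟩ := exists_eq_thr (coord (tfst z))
    exact Or.inl ⟨j, hj, x, cyl_ext (fun i => by rw [h, coord_tau]) hx⟩
  right
  obtain ⟨c, hc, hφ⟩ := exists_eq_thr (coord (tfst z))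
  have hz : ∀ i j, (tsnd z).deg i = (tsnd z).deg j → (i.val < c ↔ j.val < c) → i = j := by
    intro i j h h'
    refine tensor_inj z i j ?_ h
    rw [← coord_eq_iff, hφ, thr_apply, thr_apply]
    simp only [h']
  -- The second component can identify two vertices only where the interval coordinate tells them
  -- apart. By monotonicity these are the last vertex at the end `0` and the first at the end `1`.
  have key : ∀ a b, a < b → (tsnd z).deg a = (tsnd z).deg b → a.val + 1 = c ∧ b.val = c := by
    intro a b hab hq
    have hab' : a.val < b.val := hab
    have hmid : ∀ l : Fin (n + 1), a.val ≤ l.val → l.val ≤ b.val →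
        (tsnd z).deg l = (tsnd z).deg a := fun l h1 h2 =>
      le_antisymm (hq ▸ (tsnd z).deg.monotone h2) ((tsnd z).deg.monotone h1)
    have hac : a.val < c := by
      by_contra h
      exact hab.ne (hz a b hq (by omega))
    have hcb : c ≤ b.val := by
      by_contra h
      exact hab.ne (hz a b hq (by omega))
    constructor
    · have h : (⟨c - 1, by omega⟩ : Fin (n + 1)) = a :=
        hz _ a (hmid _ (by dsimp only; omega) (by dsimp only; omega)) (by dsimp only; omega)
      have := congrArg Fin.val h
      dsimp only at this
      omega
    · have h : (⟨c, by omega⟩ : Fin (n + 1)) = b :=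
        hz _ b ((hmid _ (by dsimp only; omega) (by dsimp only; omega)).trans hq)
          (by dsimp only; omega)
      exact (congrArg Fin.val h).symm
  obtain ⟨a, b, hab, hq⟩ : ∃ a b, a < b ∧ (tsnd z).deg a = (tsnd z).deg b := by
    simp only [Function.Injective, not_forall] at hinj
    obtain ⟨a, b, h, hne⟩ := hinj
    rcases lt_or_gt_of_ne hne with h' | h'
    · exact ⟨a, b, h', h⟩
    · exact ⟨b, a, h', h.symm⟩
  obtain ⟨hac, hcb⟩ := key a b hab hq
  obtain ⟨m, rfl⟩ : ∃ m, n = m + 1 := ⟨n - 1, by omega⟩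
  have hinj' : Function.Injective ((tsnd z).restrict (coface b).toOrderHom).deg := by
    intro i j h
    rw [restrict_deg_eq_iff] at h
    by_contra hne
    rcases lt_or_gt_of_ne hne with h' | h'
    · exact Fin.succAbove_ne b j
        (Fin.ext ((key _ _ ((coface b).strictMono h') h).2.trans hcb.symm))
    · exact Fin.succAbove_ne b i
        (Fin.ext ((key _ _ ((coface b).strictMono h') h.symm).2.trans hcb.symm))
  obtain ⟨x, hx⟩ := exists_eq_ofSimplex _ hinj'
  let j : Fin (m + 1) := ⟨a, by omega⟩
  -- Omitting `b` and then doubling `a` sends `b` to `a` and fixes everything else. The second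
  -- component is invariant under this, hence it is the degeneracy of its face opposite to `b`.
  have hdeg : ((coface b).toOrderHom.comp
      ⟨j.predAbove, Fin.predAbove_right_monotone j⟩ : Fin (m + 1 + 1) →o _) =
      ⟨fun i => if i = b then a else i, fun i l h => by
        have : i.val ≤ l.val := h
        dsimp only
        split_ifs with h1 h2 h2
        · exact le_rfl
        · subst h1
          exact (show a.val ≤ l.val by omega)
        · subst h2
          exact (show i.val ≤ a.val by have := Fin.val_ne_of_ne h1; omega)
        · exact h⟩ := by
    refine OrderHom.ext _ _ (funext fun i => ?_)
    change b.succAbove (j.predAbove i) = if i = b then a else i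
    have hb : b = j.succ := Fin.ext (by simp [j]; omega)
    split_ifs with h
    · rw [h, hb, Fin.predAbove_succ_self, Fin.succAbove_succ_self]
      rfl
    · rw [hb] at h ⊢
      exact Fin.succ_succAbove_predAbove h
  have hs : tsnd z = degen j x := by
    have h1 : IsRestriction (tsnd z) ((coface b).toOrderHom.comp
        ⟨j.predAbove, Fin.predAbove_right_monotone j⟩) (tsnd z) := by
      refine isRestriction_of_emb (RelEmbedding.refl _) (fun i => ?_) (res_refl _)
      rw [hdeg]
      change (tsnd z).deg i = (tsnd z).deg (if i = b then a else i)
      split_ifs with h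
      · rw [h, hq]
      · rfl
    rw [← h1.restrict_eq, ← restrict_restrict, hx]
    exact IsRestriction.restrict_eq
      (isRestriction_of_emb (RelEmbedding.refl _) (fun i => rfl) (res_refl _))
  refine ⟨m, j, x, ?_⟩
  congr 1
  exact cyl_ext (fun i => by rw [hφ, coord_sigma]; simp only [j, hac]) hs

/-! ### Faces -/

theorem val_succAbove {n : ℕ} (i : Fin (n + 1)) (l : Fin n) :
    (i.succAbove l).val = if l.val < i.val then l.val else l.val + 1 := by
  simp only [Fin.succAbove, Fin.lt_def, Fin.val_castSucc]
  split_ifs <;> simp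

theorem val_predAbove {n : ℕ} (j : Fin n) (l : Fin (n + 1)) :
    (j.predAbove l).val = if j.val < l.val then l.val - 1 else l.val := by
  simp only [Fin.predAbove, Fin.lt_def, Fin.val_castSucc]
  split_ifs <;> simp

theorem tsnd_face {n : ℕ} (i : Fin (n + 1 + 1)) (z : (cyl X).cells (n + 1)) :
    tsnd (face i z) = (tsnd z).restrict (coface i).toOrderHom := rfl

theorem coord_face {n : ℕ} (i : Fin (n + 1 + 1)) (z : (cyl X).cells (n + 1)) (l : Fin (n + 1)) :
    coord (tfst (face i z)) l = coord (tfst z) (i.succAbove l) := by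
  change coord ((tfst z).restrict _) l = _
  rw [coord_restrict]
  rfl

theorem face_tau {n : ℕ} (i : Fin (n + 1 + 1)) (j : ℕ) (x : X.cells (n + 1)) :
    face i (tau j x) = tau (if i.val < j then j - 1 else j) (face i x) := by
  refine cyl_ext (fun l => ?_) ?_
  · rw [coord_face, coord_tau, coord_tau, thr_apply, thr_apply]
    congr 1
    simp only [val_succAbove, eq_iff_iff]
    split_ifs <;> omega
  · rw [tsnd_face]
    exact restrict_ofSimplex (A := X.toSemiSSet) x (homEquiv.symm (coface i))

/-- Deleting the lower vertex of the vertical edge moves the vertex `j` to the end `1`; deleting the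
upper one, as in `face_sigma_succ`, leaves it at the end `0`. -/
theorem face_sigma_castSucc {n : ℕ} (j : Fin (n + 1)) (x : X.cells n) :
    face j.castSucc (sigma j x) = tau j x := by
  refine cyl_ext (fun l => ?_) ?_
  · rw [coord_face, coord_sigma, coord_tau, thr_apply, thr_apply]
    congr 1
    simp only [val_succAbove, Fin.val_castSucc, eq_iff_iff]
    split_ifs <;> omega
  · rw [tsnd_face]
    refine IsRestriction.restrict_eq (isRestriction_of_emb (RelEmbedding.refl _) (fun i => ?_)
      (res_refl _))
    change i = j.predAbove (j.castSucc.succAbove i)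
    apply Fin.ext
    simp only [val_succAbove, val_predAbove, Fin.val_castSucc]
    split_ifs <;> omega

theorem face_sigma_succ {n : ℕ} (j : Fin (n + 1)) (x : X.cells n) :
    face j.succ (sigma j x) = tau (j + 1) x := by
  refine cyl_ext (fun l => ?_) ?_
  · rw [coord_face, coord_sigma, coord_tau, thr_apply, thr_apply]
    congr 1
    simp only [val_succAbove, Fin.val_succ, eq_iff_iff]
    split_ifs <;> omega
  · rw [tsnd_face]
    refine IsRestriction.restrict_eq (isRestriction_of_emb (RelEmbedding.refl _) (fun i => ?_)
      (res_refl _))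
    change i = j.predAbove (j.succ.succAbove i)
    apply Fin.ext
    simp only [val_succAbove, val_predAbove, Fin.val_succ]
    split_ifs <;> omega

theorem face_sigma_of_le {n : ℕ} {i : Fin (n + 1 + 1)} {j : Fin (n + 1)} (h : i ≤ j.castSucc)
    (x : X.cells (n + 1)) : face i.castSucc (sigma j.succ x) = sigma j (face i x) := by
  have h' : i.val ≤ j.val := h
  refine cyl_ext (fun l => ?_) ?_
  · rw [coord_face, coord_sigma, coord_sigma, thr_apply, thr_apply]
    congr 1
    simp only [val_succAbove, Fin.val_castSucc, Fin.val_succ, eq_iff_iff]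
    split_ifs <;> omega
  · rw [tsnd_face]
    refine IsRestriction.restrict_eq (isRestriction_of_emb (coface i) (fun l => ?_) rfl)
    change i.succAbove (j.predAbove l) = j.succ.predAbove (i.castSucc.succAbove l)
    apply Fin.ext
    simp only [val_succAbove, val_predAbove, Fin.val_castSucc, Fin.val_succ]
    split_ifs <;> omega

theorem face_sigma_of_lt {n : ℕ} {i : Fin (n + 1 + 1)} {j : Fin (n + 1)} (h : j.castSucc < i)
    (x : X.cells (n + 1)) : face i.succ (sigma j.castSucc x) = sigma j (face i x) := by
  have h' : j.val < i.val := h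
  refine cyl_ext (fun l => ?_) ?_
  · rw [coord_face, coord_sigma, coord_sigma, thr_apply, thr_apply]
    congr 1
    simp only [val_succAbove, Fin.val_castSucc, Fin.val_succ, eq_iff_iff]
    split_ifs <;> omega
  · rw [tsnd_face]
    refine IsRestriction.restrict_eq (isRestriction_of_emb (coface i) (fun l => ?_) rfl)
    change i.succAbove (j.predAbove l) = j.castSucc.predAbove (i.succ.succAbove l)
    apply Fin.ext
    simp only [val_succAbove, val_predAbove, Fin.val_castSucc, Fin.val_succ]
    split_ifs <;> omega

/-! ### Marked edges -/

theorem mem_marked_cyl {e : (cyl X).cells 1} :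
    e ∈ (cyl X).marked ↔ (tsnd e).IsMarked X.marked :=
  and_iff_right (isMarked_interval _)

theorem tau_mem_marked {j : ℕ} {x : X.cells 1} : tau j x ∈ (cyl X).marked ↔ x ∈ X.marked :=
  mem_marked_cyl.trans isMarked_ofSimplex

theorem sigma_mem_marked (j : Fin (0 + 1)) (x : X.cells 0) : sigma j x ∈ (cyl X).marked :=
  mem_marked_cyl.2 fun _ hx => absurd (congrArg FreeSimplex.len hx) (by simp [degen, ofSimplex])

/-- Only the component in `X` matters. If it is degenerate on the edge, no strictly increasing `d`
exists and the criterion holds vacuously. -/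
theorem res_mem_marked_cyl {n : ℕ} {z : (cyl X).cells n} {θ : Fin (1 + 1) ↪o Fin (n + 1)} :
    res θ z ∈ (cyl X).marked ↔ ∀ d : Fin (1 + 1) ↪o Fin ((tsnd z).len + 1),
      d 0 = (tsnd z).deg (θ 0) → d 1 = (tsnd z).deg (θ 1) →
        res (X := X) d (tsnd z).simplex ∈ X.marked := by
  rw [mem_marked_cyl, tsnd_res]
  constructor
  · intro h d h0 h1
    refine h _ (IsRestriction.restrict_eq (isRestriction_of_emb d (fun i => ?_) rfl))
    fin_cases i
    · exact h0
    · exact h1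
  · intro h x hx
    have h' : IsRestriction (tsnd z) θ.toOrderHom (ofSimplex x) := by
      rw [← hx]
      exact isRestriction_restrict _ _
    obtain ⟨d, hd, h''⟩ := h'
    have := h (homEquiv d) (hd 0) (hd 1)
    change X.toSemiSSet.map d.op _ ∈ _ at this
    rwa [h''] at this

end Cylinder

end MSSet

namespace MSSet

open FreeSimplex

/-! ## Partial lifts on cylinders -/

theorem edge_mem_of_two {E : MSSet.{u}} (hE : MarkedTwoOutOfThree E) {x : E.cells 2}
    {i j k : Fin 3} (hij : i ≠ j) (hjk : j ≠ k) (hik : i ≠ k) (hi : face (n := 1) i x ∈ E.marked)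
    (hj : face (n := 1) j x ∈ E.marked) : face (n := 1) k x ∈ E.marked := by
  refine hE k x fun l hl => ?_
  obtain rfl | rfl : l = i ∨ l = j := by omega
  · exact hi
  · exact hj

/-- A map out of the cylinder that sends one end of an edge to a marked edge sends all edges over
that edge to marked edges. -/
theorem ap_tau_mem_marked {E X : MSSet.{u}} (hE : MarkedTwoOutOfThree E) (f : cyl X ⟶ E)
    (x : X.cells 1) {ε : Fin 2} (h : ap f (ap (cylEnd ε X) x) ∈ E.marked) {j : ℕ} (hj : j ≤ 2) :
    ap f (tau j x) ∈ E.marked := by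
  -- The square over `x` consists of the triangles `sigma 0 x` and `sigma 1 x`, which share the
  -- diagonal `tau 1 x`. Each has a marked vertical edge, so 2-out-of-3 passes between `tau 0 x`
  -- (end `1`), the diagonal, and `tau 2 x` (end `0`).
  have h01 : ap f (tau 0 x) ∈ E.marked ↔ ap f (tau 1 x) ∈ E.marked := by
    have e0 : face (n := 1) 0 (ap f (sigma 0 x)) = ap f (tau 0 x) := by
      refine Eq.trans ?_ (congrArg (ap f) (face_sigma_castSucc 0 x))
      exact (ap_face _ _ _).symm
    have e1 : face (n := 1) 1 (ap f (sigma 0 x)) = ap f (tau 1 x) := by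
      refine Eq.trans ?_ (congrArg (ap f) (face_sigma_succ 0 x))
      exact (ap_face _ _ _).symm
    have e2 : face (n := 1) 2 (ap f (sigma 0 x)) ∈ E.marked := by
      have := ap_mem f (sigma_mem_marked 0 (face (n := 0) 1 x))
      rw [← face_sigma_of_lt (i := 1) (j := 0) (by decide)] at this
      rw [ap_face] at this
      exact this
    constructor <;> intro h
    · exact e1 ▸ edge_mem_of_two hE (i := 0) (j := 2) (by decide) (by decide) (by decide)
        (e0.symm ▸ h) e2
    · exact e0 ▸ edge_mem_of_two hE (i := 1) (j := 2) (by decide) (by decide) (by decide)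
        (e1.symm ▸ h) e2
  have h12 : ap f (tau 1 x) ∈ E.marked ↔ ap f (tau 2 x) ∈ E.marked := by
    have e1 : face (n := 1) 1 (ap f (sigma 1 x)) = ap f (tau 1 x) := by
      refine Eq.trans ?_ (congrArg (ap f) (face_sigma_castSucc 1 x))
      exact (ap_face _ _ _).symm
    have e2 : face (n := 1) 2 (ap f (sigma 1 x)) = ap f (tau 2 x) := by
      refine Eq.trans ?_ (congrArg (ap f) (face_sigma_succ 1 x))
      exact (ap_face _ _ _).symm
    have e0 : face (n := 1) 0 (ap f (sigma 1 x)) ∈ E.marked := by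
      have := ap_mem f (sigma_mem_marked 0 (face (n := 0) 0 x))
      rw [← face_sigma_of_le (i := 0) (j := 0) (by decide)] at this
      rw [ap_face] at this
      exact this
    constructor <;> intro h
    · exact e2 ▸ edge_mem_of_two hE (i := 1) (j := 0) (by decide) (by decide) (by decide)
        (e1.symm ▸ h) e0
    · exact e1 ▸ edge_mem_of_two hE (i := 2) (j := 0) (by decide) (by decide) (by decide)
        (e2.symm ▸ h) e0
  have h1 : ap f (tau 1 x) ∈ E.marked := by
    obtain rfl | rfl : ε = 0 ∨ ε = 1 := by omega
    · rw [cylEnd_zero] at h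
      exact h12.2 h
    · rw [cylEnd_one] at h
      exact h01.1 h
  obtain rfl | rfl | rfl : j = 0 ∨ j = 1 ∨ j = 2 := by omega
  · exact h01.2 h1
  · exact h1
  · exact h12.1 h1

/-- The edges of the cylinder. -/
theorem cyl_edge_cases {X : MSSet.{u}} (z : (cyl X).cells 1) :
    (∃ j ≤ 2, ∃ x, z = tau j x) ∨ ∃ (j : Fin (0 + 1)) (x : X.cells 0), z = sigma j x := by
  obtain h | ⟨m, j, x, h⟩ := cyl_cases z
  · exact Or.inl h
  · right
    obtain rfl : 0 = m := by
      have := congrArg Sigma.fst h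
      simp only at this
      omega
    exact ⟨j, x, eq_of_heq (Sigma.mk.inj h).2⟩

/-- A partial lift on a cylinder given by lifts on cylinders of a jointly injective family and on
some ends of the cylinder. -/
theorem exists_cylinder_partialLift {E B X : MSSet.{u}} (p : E ⟶ B) (hE : MarkedTwoOutOfThree E)
    (b : cyl X ⟶ B) {ι κ : Type} [Nonempty κ] {A : ι → MSSet.{u}} (i : ∀ α, A α ⟶ X)
    (hi : ∀ (α β : ι) (n : ℕ) (x : (A α).cells n) (y : (A β).cells n), ap (i α) x = ap (i β) y →
      (⟨α, x⟩ : Σ α, (A α).cells n) = ⟨β, y⟩)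
    (e : κ → Fin 2) (he : Function.Injective e) (f : ∀ α, cyl (A α) ⟶ E) (g : κ → (X ⟶ E))
    (hfg : ∀ α κ, cylEnd (e κ) (A α) ≫ f α = i α ≫ g κ)
    (hf : ∀ α, f α ≫ p = cylMap (i α) ≫ b) (hg : ∀ κ, g κ ≫ p = cylEnd (e κ) X ≫ b) :
    ∃ G : PartialLift p b,
      (∀ (n : ℕ) (z : (cyl X).cells n), G.Dom z ↔
        (∃ α a, ap (i α) a = (tsnd z).simplex) ∨ ∃ κ, ∀ l, coord (tfst z) l = e κ) ∧
      (∀ α (n : ℕ) (z : (cyl (A α)).cells n), G.rel (ap (cylMap (i α)) z) (ap (f α) z)) ∧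
      ∀ κ (n : ℕ) (x : X.cells n), G.rel (ap (cylEnd (e κ) X) x) (ap (g κ) x) := by
  -- Where the cylinder on `A α` meets an end of the cylinder on `X`, the simplex already lies in
  -- the same end of the cylinder on `A α`, so `hfg` applies.
  have hmix : ∀ α κ (n : ℕ) (x : (cyl (A α)).cells n) (y : X.cells n),
      ap (cylMap (i α)) x = ap (cylEnd (e κ) X) y → ap (f α) x = ap (g κ) y := by
    intro α κ n x y h
    obtain ⟨x', -, rfl⟩ := eq_cylEnd (z := x) (ε := e κ) fun l => by
      rw [← tfst_tensorMap (i α) x, h]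
      rfl
    obtain rfl : ap (i α) x' = y := ofSimplex_injective (congrArg tsnd h)
    exact hom_congr (hfg α κ) x'
  have hinl : ∀ α β (n : ℕ) (t : FreeSimplex (A α).toSemiSSet n)
      (t' : FreeSimplex (A β).toSemiSSet n), t.map (i α) = t'.map (i β) →
      (⟨α, t⟩ : Σ α, FreeSimplex (A α).toSemiSSet n) = ⟨β, t'⟩ := by
    rintro α β n ⟨l, deg, surj, a⟩ ⟨l', deg', surj', a'⟩ h
    simp only [FreeSimplex.map, FreeSimplex.mk.injEq] at h
    obtain ⟨rfl, h1, h2⟩ := h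
    cases hi α β _ a a' (eq_of_heq h2)
    cases h1
    rfl
  refine ⟨PartialLift.ofFamily (ι := ι ⊕ κ) (W := Sum.elim (fun α => cyl (A α)) (fun _ => X))
    (fun | .inl α => cylMap (i α) | .inr κ => cylEnd (e κ) X)
    (fun | .inl α => f α | .inr κ => g κ) ?_ ?_ ?_, ?_, ?_, ?_⟩
  · rintro (α | κ) (β | κ') n x y h
    · have h1 := congrArg tfst h
      have h2 := hinl α β n _ _ (congrArg tsnd h)
      obtain rfl : α = β := congrArg Sigma.fst h2
      have h3 : x = y := tensor_ext h1 (eq_of_heq (Sigma.mk.inj h2).2)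
      rw [h3]
    · exact hmix α κ' n x y h
    · exact (hmix β κ n y x h.symm).symm
    · have h1 := congrArg (fun z => coord (tfst z) 0) h
      obtain rfl : κ = κ' := he h1
      have h3 : x = y := ofSimplex_injective (congrArg tsnd h)
      rw [h3]
  · rintro (α | κ)
    · exact hf α
    · exact hg κ
  · rintro (α | κ) x hx
    -- An edge may be marked in `X` without being marked in `A α`. Its value at an end is computed
    -- by `g κ` and so is marked; 2-out-of-3 carries this to all edges over it.
    · obtain ⟨j, hj, x, rfl⟩ | ⟨j, x, rfl⟩ := cyl_edge_cases (X := A α) x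
      · obtain ⟨κ⟩ := ‹Nonempty κ›
        refine ap_tau_mem_marked hE (f α) x (ε := e κ) ?_ hj
        have := hom_congr (hfg α κ) x
        rw [ap_comp] at this
        rw [this]
        exact ap_mem (g κ) (tau_mem_marked.1 hx)
      · exact ap_mem (f α) (sigma_mem_marked j x)
    · exact ap_mem (g κ) (isMarked_ofSimplex.1 hx.2)
  · intro n z
    constructor
    · rintro ⟨_, (α | κ), x, rfl, -⟩
      · exact Or.inl ⟨α, (tsnd (B := A α) x).simplex, rfl⟩
      · exact Or.inr ⟨κ, fun l => coord_ofVertex.{u} (e κ) n l⟩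
    · rintro (⟨α, a, ha⟩ | ⟨κ, hκ⟩)
      · let a' : (cyl (A α)).cells n :=
          tmk (tfst z) ⟨(tsnd z).len, (tsnd z).deg, (tsnd z).surj, a⟩ (tensor_inj z)
        refine ⟨_, Sum.inl α, a', tensor_ext rfl ?_, rfl⟩
        change FreeSimplex.mk _ _ _ (ap (i α) a) = _
        rw [ha]
        rfl
      · obtain ⟨x, -, rfl⟩ := eq_cylEnd hκ
        exact ⟨_, Sum.inr κ, x, rfl, rfl⟩
  · exact fun α n z => ⟨Sum.inl α, z, rfl, rfl⟩
  · exact fun κ n x => ⟨Sum.inr κ, x, rfl, rfl⟩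

end MSSet

namespace MSSet

open FreeSimplex

/-! ### The prism relative to one end -/

section Prism

variable {X : MSSet.{u}}

theorem thr_eq_zero_iff {n j : ℕ} : (∀ l, thr n j l = 0) ↔ n + 1 ≤ j := by
  constructor
  · intro h
    have := h (Fin.last n)
    rw [thr_apply] at this
    split_ifs at this with h'
    · exact h'
    · exact absurd this (by decide)
  · intro h l
    rw [thr_apply, if_pos (by omega)]

theorem thr_eq_one_iff {n j : ℕ} : (∀ l, thr n j l = 1) ↔ j = 0 := by
  constructor
  · intro h
    have := h 0
    rw [thr_apply] at this
    split_ifs at this with h'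
    · exact absurd this (by decide)
    · exact Nat.eq_zero_of_not_pos h'
  · rintro rfl l
    rw [thr_apply, if_neg (by omega)]

theorem coord_sigma_not_const {n : ℕ} (j : Fin (n + 1)) (x : X.cells n) (ε : Fin 2) :
    ¬ ∀ l, coord (tfst (sigma j x)) l = ε := by
  intro h
  have h0 := h 0
  have h1 := h (Fin.last _)
  rw [coord_sigma, thr_apply] at h0 h1
  rw [if_pos (by simp)] at h0
  rw [if_neg (by simp; omega)] at h1
  omega

theorem thr_injective {n j j' : ℕ} (hj : j ≤ n + 1) (hj' : j' ≤ n + 1) (h : thr n j = thr n j') :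
    j = j' := by
  rcases lt_trichotomy j j' with hlt | rfl | hlt
  · have := DFunLike.congr_fun h ⟨j, by omega⟩
    rw [thr_apply, thr_apply, if_neg (by simp), if_pos hlt] at this
    exact absurd this (by decide)
  · rfl
  · have := DFunLike.congr_fun h ⟨j', by omega⟩
    rw [thr_apply, thr_apply, if_pos hlt, if_neg (by simp)] at this
    exact absurd this (by decide)

theorem tau_injective {n n' j j' : ℕ} {x : X.cells n} {x' : X.cells n'} (hj : j ≤ n + 1)
    (hj' : j' ≤ n' + 1)
    (h : (⟨n, tau j x⟩ : Σ n, (cyl X).cells n) = ⟨n', tau j' x'⟩) :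
    (⟨n, x⟩ : Σ n, X.cells n) = ⟨n', x'⟩ ∧ j = j' := by
  obtain rfl : n = n' := congrArg Sigma.fst h
  have h' := eq_of_heq (Sigma.mk.inj h).2
  refine ⟨?_, ?_⟩
  · rw [ofSimplex_injective (congrArg tsnd h')]
  · have := congrArg (fun z => coord (tfst z)) h'
    simp only [coord_tau] at this
    exact thr_injective hj hj' this

theorem sigma_injective {n n' : ℕ} {j : Fin (n + 1)} {j' : Fin (n' + 1)} {x : X.cells n}
    {x' : X.cells n'}
    (h : (⟨n + 1, sigma j x⟩ : Σ n, (cyl X).cells n) = ⟨n' + 1, sigma j' x'⟩) :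
    (⟨n, j, x⟩ : Σ n, Fin (n + 1) × X.cells n) = ⟨n', j', x'⟩ := by
  obtain rfl : n = n' := by
    have := congrArg Sigma.fst h
    simpa using this
  have h' := eq_of_heq (Sigma.mk.inj h).2
  have h1 : x = x' := by
    have := congrArg tsnd h'
    simp only [tsnd_sigma, degen, FreeSimplex.mk.injEq] at this
    exact eq_of_heq this.2.2
  have h2 : j = j' := by
    have := congrArg (fun z => coord (tfst z)) h'
    simp only [coord_sigma] at this
    have := thr_injective (by omega) (by omega) this
    exact Fin.ext (by omega)
  rw [h1, h2]

theorem tau_ne_sigma {n n' j : ℕ} {j' : Fin (n' + 1)} {x : X.cells n} {x' : X.cells n'} :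
    (⟨n' + 1, sigma j' x'⟩ : Σ n, (cyl X).cells n) ≠ ⟨n, tau j x⟩ := by
  intro h
  have h1 := congrArg Sigma.fst h
  have h2 := congrArg (fun z : Σ n, (cyl X).cells n => (tsnd z.2).len) h
  simp only [tsnd_sigma, tsnd_tau, degen, ofSimplex] at h1 h2
  omega

/-- The faces of the prism simplices. -/
theorem face_sigma_cases {n : ℕ} (i : Fin (n + 1 + 1)) (j : Fin (n + 1)) (x : X.cells n) :
    i = j.castSucc ∨ i = j.succ ∨ ∃ (m : ℕ) (h : n = m + 1) (i' : Fin (m + 1 + 1))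
      (j' : Fin (m + 1)),
        face i (sigma j x) = h ▸ sigma j' (face i' (h ▸ x)) ∧
        ((i.val < j.val ∧ i'.val = i.val ∧ j'.val + 1 = j.val) ∨
          (j.val + 1 < i.val ∧ i'.val + 1 = i.val ∧ j'.val = j.val)) := by
  rcases lt_trichotomy i.val j.val with h | h | h
  · right; right
    obtain ⟨m, rfl⟩ : ∃ m, n = m + 1 := ⟨n - 1, by omega⟩
    refine ⟨m, rfl, ⟨i, by omega⟩, ⟨j - 1, by omega⟩, ?_, Or.inl ⟨h, rfl, by dsimp only; omega⟩⟩
    have e := face_sigma_of_le (i := ⟨i, by omega⟩) (j := ⟨j - 1, by omega⟩)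
      (by simp only [Fin.le_def, Fin.val_castSucc]; omega) x
    have e1 : (⟨i, by omega⟩ : Fin (m + 1 + 1)).castSucc = i := rfl
    have e2 : (⟨j - 1, by omega⟩ : Fin (m + 1)).succ = j := Fin.ext (by simp; omega)
    rw [e1, e2] at e
    exact e
  · exact Or.inl (Fin.ext h)
  · by_cases h' : i.val = j.val + 1
    · exact Or.inr (Or.inl (Fin.ext h'))
    right; right
    obtain ⟨m, rfl⟩ : ∃ m, n = m + 1 := ⟨n - 1, by omega⟩
    refine ⟨m, rfl, ⟨i - 1, by omega⟩, ⟨j, by omega⟩, ?_,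
      Or.inr ⟨by omega, by dsimp only; omega, rfl⟩⟩
    have e := face_sigma_of_lt (i := ⟨i - 1, by omega⟩) (j := ⟨j, by omega⟩)
      (by simp only [Fin.lt_def, Fin.val_castSucc]; omega) x
    have e1 : (⟨i - 1, by omega⟩ : Fin (m + 1 + 1)).succ = i := Fin.ext (by simp; omega)
    have e2 : (⟨j, by omega⟩ : Fin (m + 1)).castSucc = j := rfl
    rw [e1, e2] at e
    exact e

/-- The face of a prism simplex opposite to the vertex at the end `ε` of its vertical edge. -/
theorem face_sigma_idx {n : ℕ} (ε : Fin 2) (j : Fin (n + 1)) (x : X.cells n) :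
    face ⟨j + ε, by omega⟩ (sigma j x) = tau (j + ε) x := by
  obtain rfl | rfl : ε = 0 ∨ ε = 1 := by omega
  · exact face_sigma_castSucc j x
  · exact face_sigma_succ j x

/-- The horn pairing of a prism relative to one end and the prisms over a family of simplices. -/
noncomputable def prismPairing (D : ∀ {n : ℕ}, (cyl X).cells n → Prop) (ε : Fin 2)
    (S : ∀ {n : ℕ}, X.cells n → Prop)
    (hD : ∀ {n : ℕ} (z : (cyl X).cells n),
      D z ↔ S (tsnd z).simplex ∨ ∀ l, coord (tfst z) l = ε) :
    HornPairing (cyl X) (fun {_} z => D z) where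
  ι := {q : Σ n, Fin (n + 1) × X.cells n // ¬ S q.2.2}
  dim q := q.1.1
  cell q := sigma q.1.2.1 q.1.2.2
  -- The missing face is the `tau` face farther from the given end: `tau j` for `ε = 0` and `tau (j
  -- + 1)` for `ε = 1`.
  idx q := ⟨q.1.2.1 + ε, by omega⟩
  -- Prisms over lower-dimensional simplices come first. Within one prism the filling starts at the
  -- given end: decreasing `j` for `ε = 0`, increasing `j` for `ε = 1`.
  rank q := toLex (q.1.1, if ε = 0 then q.1.1 - q.1.2.1 else q.1.2.1)
  exists_restricts {n} z hz := by
    rw [hD, not_or] at hz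
    obtain ⟨j, hj, x, rfl⟩ | ⟨m, j, x, h⟩ := cyl_cases z
    · rw [coord_tau] at hz
      obtain rfl | rfl : ε = 0 ∨ ε = 1 := by omega
      · rw [thr_eq_zero_iff] at hz
        exact ⟨⟨⟨n, ⟨j, by omega⟩, x⟩, hz.1⟩, _, face_sigma_castSucc ⟨j, by omega⟩ x⟩
      · rw [thr_eq_one_iff] at hz
        refine ⟨⟨⟨n, ⟨j - 1, by omega⟩, x⟩, hz.1⟩, _,
          (face_sigma_succ ⟨j - 1, by omega⟩ x).trans ?_⟩
        congr 1
        dsimp only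
        omega
    · obtain rfl : n = m + 1 := congrArg Sigma.fst h
      obtain rfl : z = sigma j x := eq_of_heq (Sigma.mk.inj h).2
      exact ⟨⟨⟨m, j, x⟩, hz.1⟩, _, res_refl _⟩
  face_idx := by
    rintro ⟨⟨n, j, x⟩, hx⟩
    dsimp only
    rw [face_sigma_idx, hD, not_or, coord_tau]
    refine ⟨hx, ?_⟩
    obtain rfl | rfl : ε = 0 ∨ ε = 1 := by omega
    · rw [thr_eq_zero_iff]
      simp
      omega
    · rw [thr_eq_one_iff]
      simp
  face_of_ne := by
    rintro ⟨⟨n, j, x⟩, hx⟩ i hi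
    dsimp only at hi hx i ⊢
    obtain rfl | rfl | ⟨m, rfl, i', j', he, h⟩ := face_sigma_cases i j x
    · obtain rfl : ε = 1 := by
        have := Fin.val_ne_of_ne hi
        simp at this
        omega
      rw [face_sigma_castSucc]
      by_cases hj : j.val = 0
      · left
        rw [hD, coord_tau, thr_eq_one_iff]
        exact Or.inr hj
      · right
        refine ⟨⟨⟨n, ⟨j - 1, by omega⟩, x⟩, hx⟩, ?_, _,
          (face_sigma_succ ⟨j - 1, by omega⟩ x).trans ?_⟩
        · rw [Prod.Lex.toLex_lt_toLex]
          right
          simp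
          exact Fin.pos_of_ne_zero fun h => hj (congrArg Fin.val h)
        · congr 1
          dsimp only
          omega
    · obtain rfl : ε = 0 := by
        have := Fin.val_ne_of_ne hi
        simp at this
        omega
      rw [face_sigma_succ]
      by_cases hj : j.val = n
      · left
        rw [hD, coord_tau, thr_eq_zero_iff]
        exact Or.inr (by omega)
      · right
        refine ⟨⟨⟨n, ⟨j + 1, by omega⟩, x⟩, hx⟩, ?_, _, face_sigma_castSucc ⟨j + 1, by omega⟩ x⟩
        rw [Prod.Lex.toLex_lt_toLex]
        right
        simp
        omega
    · rw [he]
      by_cases hS : S (face i' x)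
      · exact Or.inl ((hD _).2 (Or.inl hS))
      · right
        refine ⟨⟨⟨m, j', face i' x⟩, hS⟩, ?_, _, res_refl _⟩
        rw [Prod.Lex.toLex_lt_toLex]
        left
        simp
  inj := by
    rintro ⟨⟨n, j, x⟩, hx⟩ ⟨⟨n', j', x'⟩, hx'⟩ h
    dsimp only at h
    rw [face_sigma_idx, face_sigma_idx] at h
    obtain ⟨h1, h2⟩ := tau_injective (by omega) (by omega) h
    cases h1
    obtain rfl : j = j' := Fin.ext (by omega)
    rfl
  ne := by
    rintro ⟨⟨n, j, x⟩, hx⟩ ⟨⟨n', j', x'⟩, hx'⟩ h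
    dsimp only at h
    rw [face_sigma_idx] at h
    exact tau_ne_sigma h
  critical := by
    rintro ⟨⟨n, j, x⟩, hx⟩ θ hθ
    dsimp only at hθ θ ⊢
    -- The horn is outer only for `j = 0`, `ε = 0` or `j = n`, `ε = 1`. In both cases the critical
    -- edge is the vertical one, which is degenerate over `X` and therefore marked.
    rw [res_mem_marked_cyl]
    intro d h0 h1
    have h0' : (d 0).val = (j.predAbove (θ 0)).val := congrArg Fin.val h0
    have h1' : (d 1).val = (j.predAbove (θ 1)).val := congrArg Fin.val h1
    have hlt : (d 0).val < (d 1).val := d.strictMono (show (0 : Fin 2) < 1 by decide)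
    rw [val_predAbove] at h0' h1'
    have : (⟨j + ε, by omega⟩ : Fin (n + 1 + 1)).val = j + ε := rfl
    unfold IsCriticalEdge at hθ
    split_ifs at h0' h1' <;> omega
  marked := by
    rintro ⟨⟨n, j, x⟩, hx⟩ θ hn hθ hm θ'
    dsimp only at hn
    subst hn
    dsimp only at hθ θ θ' hm ⊢
    -- The missing edge is a `tau` over the edge `x`. If it is marked, then so is `x`, and with it
    -- every edge of the triangle over `x`.
    have e : θ = coface ⟨j + ε, by omega⟩ := by
      obtain ⟨ψ, rfl⟩ := exists_eq_trans_coface θ hθ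
      have : ψ = RelEmbedding.refl _ :=
        emb_eq_of_range_subset (k := 0) (fun j _ => Finite.injective_iff_surjective.1 ψ.injective j)
          fun j _ => ⟨j, rfl⟩
      rw [this]
      exact RelEmbedding.ext fun _ => rfl
    rw [e] at hm
    change face _ _ ∈ _ at hm
    rw [face_sigma_idx, tau_mem_marked] at hm
    rw [res_mem_marked_cyl]
    intro d _ _
    have : d = RelEmbedding.refl _ :=
      emb_eq_of_range_subset (k := 0) (fun j _ => Finite.injective_iff_surjective.1 d.injective j)
        fun j _ => ⟨j, rfl⟩
    rw [this]
    exact (res_refl x).symm ▸ hm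

end Prism

/-- Fibrations lift against the pushout product of the inclusion of an end of the interval and a
jointly injective family. -/
theorem exists_cylinder_lift {E B X : MSSet.{u}} {p : E ⟶ B} (hp : fibrations p) (hE : IsFibrant E)
    (b : cyl X ⟶ B) {ι : Type} {A : ι → MSSet.{u}} (i : ∀ α, A α ⟶ X)
    (hi : ∀ (α β : ι) (n : ℕ) (x : (A α).cells n) (y : (A β).cells n), ap (i α) x = ap (i β) y →
      (⟨α, x⟩ : Σ α, (A α).cells n) = ⟨β, y⟩)
    (ε : Fin 2) (f : ∀ α, cyl (A α) ⟶ E) (g : X ⟶ E)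
    (hfg : ∀ α, cylEnd ε (A α) ≫ f α = i α ≫ g)
    (hf : ∀ α, f α ≫ p = cylMap (i α) ≫ b) (hg : g ≫ p = cylEnd ε X ≫ b) :
    ∃ H : cyl X ⟶ E, H ≫ p = b ∧ (∀ α, cylMap (i α) ≫ H = f α) ∧ cylEnd ε X ≫ H = g := by
  have hE' := markedTwoOutOfThree_of_isFibrant hE
  obtain ⟨G, hdom, h1, h2⟩ := exists_cylinder_partialLift (κ := Unit) p hE' b i hi (fun _ => ε)
    (fun _ _ _ => rfl) f (fun _ => g) (fun α _ => hfg α) hf (fun _ => hg)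
  -- The simplices of `X` excluded from the pairing are those in the union of the images of the `A
  -- α`.
  obtain ⟨H, hH, hrel⟩ := G.exists_lift hp hE'
    (prismPairing (fun {_} z => G.Dom z) ε (fun {n} x => ∃ α a, ap (i α) a = x) (fun {n} z => by
      rw [hdom]
      simp))
  exact ⟨H, hH, fun α => hom_ext_ap fun n x => hrel _ _ _ (h1 α n x),
    hom_ext_ap fun n x => hrel _ _ _ (h2 () n x)⟩

end MSSet

namespace MSSet

open FreeSimplex

/-! ### The prism relative to a horn and both ends -/

section HornPrism

variable {N : ℕ} {k : Fin (N + 1 + 1)}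

/-- The simplex of dimension `n` of the standard simplex. -/
abbrev topCell {n : ℕ} (M : Fin (n + 1) → Fin (n + 1) → Prop) : (markedSimplex.{u} n M).cells n :=
  mkSimplex M (RelEmbedding.refl _)

theorem res_topCell {m n : ℕ} (M : Fin (n + 1) → Fin (n + 1) → Prop)
    (θ : Fin (m + 1) ↪o Fin (n + 1)) : res θ (topCell.{u} M) = mkSimplex M θ := by
  rw [res_mkSimplex]
  exact congrArg (mkSimplex M) (RelEmbedding.ext fun _ => rfl)

theorem res_topCell_mem_marked {n : ℕ} {M : Fin (n + 1) → Fin (n + 1) → Prop}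
    {θ : Fin (1 + 1) ↪o Fin (n + 1)} :
    res θ (topCell.{u} M) ∈ (markedSimplex.{u} n M).marked ↔ M (θ 0) (θ 1) := by
  have h : toEmb (res θ (topCell.{u} M)) = θ := by rw [res_topCell, toEmb_mkSimplex]
  rw [mem_marked_markedSimplex, h]

theorem res_sigma_topCell_mem_marked {n : ℕ} {M : Fin (n + 1) → Fin (n + 1) → Prop}
    {θ : Fin (1 + 1) ↪o Fin (n + 1 + 1)} {j : Fin (n + 1)} :
    res θ (sigma j (topCell.{u} M)) ∈ (cyl (markedSimplex.{u} n M)).marked ↔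
      ∀ d : Fin (1 + 1) ↪o Fin (n + 1), d 0 = j.predAbove (θ 0) → d 1 = j.predAbove (θ 1) →
        M (d 0) (d 1) :=
  res_mem_marked_cyl.trans <| forall_congr' fun d => imp_congr_right fun _ =>
    imp_congr_right fun _ => res_topCell_mem_marked (θ := d)

theorem res_tau_topCell_mem_marked {n : ℕ} {M : Fin (n + 1) → Fin (n + 1) → Prop}
    {θ : Fin (1 + 1) ↪o Fin (n + 1)} {j : ℕ} :
    res θ (tau j (topCell.{u} M)) ∈ (cyl (markedSimplex.{u} n M)).marked ↔ M (θ 0) (θ 1) := by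
  have key : res θ (tau j (topCell.{u} M)) ∈ (cyl (markedSimplex.{u} n M)).marked ↔
      ∀ d : Fin (1 + 1) ↪o Fin (n + 1), d 0 = θ 0 → d 1 = θ 1 → M (d 0) (d 1) :=
    res_mem_marked_cyl.trans <| forall_congr' fun d => imp_congr_right fun _ =>
      imp_congr_right fun _ => res_topCell_mem_marked (θ := d)
  refine key.trans ⟨fun h => h θ rfl rfl, fun h d h0 h1 => ?_⟩
  rwa [h0, h1]

/-- The simplices of the horn. -/
def InHorn (k : Fin (N + 1 + 1)) {M : Fin (N + 1 + 1) → Fin (N + 1 + 1) → Prop} {m : ℕ}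
    (s : (markedSimplex.{u} (N + 1) M).cells m) : Prop :=
  ∃ j, j ≠ k ∧ j ∉ Set.range (toEmb s)

variable {M : Fin (N + 1 + 1) → Fin (N + 1 + 1) → Prop}

theorem not_inHorn_cases {m : ℕ} {s : (markedSimplex.{u} (N + 1) M).cells m}
    (h : ¬ InHorn k s) :
    (⟨m, s⟩ : Σ m, (markedSimplex.{u} (N + 1) M).cells m) = ⟨N + 1, topCell M⟩ ∨
      (⟨m, s⟩ : Σ m, (markedSimplex.{u} (N + 1) M).cells m) = ⟨N, face k (topCell M)⟩ := by
  have h' : ∀ j, j ≠ k → j ∈ Set.range (toEmb s) := fun j hj => by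
    by_contra hjs
    exact h ⟨j, hj, hjs⟩
  obtain ⟨θ, rfl⟩ : ∃ θ, s = mkSimplex M θ := ⟨toEmb s, rfl⟩
  rw [toEmb_mkSimplex] at h'
  rw [face, res_topCell]
  obtain h | h := eq_refl_or_eq_coface h' <;> cases h
  · exact Or.inl rfl
  · exact Or.inr rfl

theorem not_inHorn_topCell : ¬ InHorn.{u} k (topCell M) := by
  rintro ⟨j, -, hj⟩
  exact hj ⟨j, rfl⟩

theorem inHorn_face_iff {i : Fin (N + 1 + 1)} : InHorn.{u} k (face i (topCell M)) ↔ i ≠ k := by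
  rw [face, res_topCell, InHorn, toEmb_mkSimplex]
  exact coface_mem_horn_iff

/-- The fillers of the prism over the simplex relative to the prism over the horn `k`. -/
inductive HornPrismFiller (N : ℕ) : Type
  | mid : HornPrismFiller N
  | sig (j : Fin (N + 1)) : HornPrismFiller N
  | tau (j : Fin N) : HornPrismFiller N

namespace HornPrismFiller

/-- The dimension of the missing face. -/
def dim : HornPrismFiller N → ℕ
  | mid => N + 1
  | sig _ => N + 1
  | tau _ => N

/-- The filler. -/
noncomputable def cell (M : Fin (N + 1 + 1) → Fin (N + 1 + 1) → Prop) (k : Fin (N + 1 + 1))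
    (ε : Fin 2) :
    ∀ q : HornPrismFiller N, (cyl (markedSimplex.{u} (N + 1) M)).cells (q.dim + 1)
  | mid => sigma k (topCell M)
  | sig j => sigma (k.succAbove j) (topCell M)
  | tau j => MSSet.tau (if j.val + 1 < k.val + ε.val then j + 1 else j + 2) (topCell M)

/-- The vertex opposite to the missing face. -/
def idx (k : Fin (N + 1 + 1)) (ε : Fin 2) : ∀ q : HornPrismFiller N, Fin (q.dim + 1 + 1)
  | mid => (⟨k + ε, by omega⟩ : Fin (N + 1 + 1 + 1))
  | sig j => if j.castSucc < k then k.succ else k.castSucc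
  | tau _ => k

/-- The order of attachment. -/
def rank : HornPrismFiller N → ℕ ×ₗ ℕ
  | mid => toLex (1, 0)
  | sig _ => toLex (2, 0)
  | tau _ => toLex (0, 0)

/-- The missing face. -/
noncomputable def free (M : Fin (N + 1 + 1) → Fin (N + 1 + 1) → Prop) (k : Fin (N + 1 + 1))
    (ε : Fin 2) :
    ∀ q : HornPrismFiller N, (cyl (markedSimplex.{u} (N + 1) M)).cells q.dim
  | mid => MSSet.tau (k + ε) (topCell M)
  | sig j => sigma j (face k (topCell M))
  | tau j => MSSet.tau (j + 1) (face k (topCell M))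

theorem face_idx_cell {ε : Fin 2} (q : HornPrismFiller N) :
    face (q.idx k ε) (q.cell.{u} M k ε) = q.free M k ε := by
  cases q with
  | mid => exact face_sigma_idx ε k (topCell M)
  | sig j =>
    change face (if j.castSucc < k then k.succ else k.castSucc)
      (sigma (k.succAbove j) (topCell M)) = sigma j (face k (topCell M))
    split_ifs with h
    · rw [Fin.succAbove_of_castSucc_lt _ _ h]
      exact face_sigma_of_lt h _
    · rw [Fin.succAbove_of_le_castSucc _ _ (not_lt.1 h)]
      exact face_sigma_of_le (not_lt.1 h) _
  | tau j =>
    refine (face_tau k _ (topCell M)).trans ?_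
    change _ = MSSet.tau (j + 1) (face k (topCell M))
    congr 1
    split_ifs <;> omega

end HornPrismFiller

open HornPrismFiller

/-- The horn pairing of the prism over a simplex relative to the prism over a horn and both ends. -/
noncomputable def hornPrismPairing (k : Fin (N + 1 + 1)) (ε : Fin 2) (h1 : 1 ≤ k.val + ε.val)
    (h2 : k.val + ε.val ≤ N + 1)
    (D : ∀ {n : ℕ}, (cyl (markedSimplex.{u} (N + 1) (IsCriticalEdge (N + 1) k))).cells n → Prop)
    (hD : ∀ {n : ℕ} (z : (cyl (markedSimplex.{u} (N + 1) (IsCriticalEdge (N + 1) k))).cells n),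
      D z ↔ InHorn k (tsnd z).simplex ∨ ∃ δ : Fin 2, ∀ l, coord (tfst z) l = δ) :
    HornPairing (cyl (markedSimplex.{u} (N + 1) (IsCriticalEdge (N + 1) k))) (fun {_} z => D z) :=
  -- The simplices still to be added lie over the top simplex or over its face opposite to `k`. Over
  -- the face, every `sigma` and every `tau` is matched with one of the same kind over the top. This
  -- leaves `sigma k` and `tau (k + ε)` over the top, which are matched by `mid`. The condition on
  -- `k + ε` keeps that `tau` off both ends.
  let M := IsCriticalEdge (N + 1) k
  have hDtau : ∀ {n : ℕ} (j : ℕ) (x : (markedSimplex.{u} (N + 1) M).cells n),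
      D (MSSet.tau j x) ↔ InHorn k x ∨ j = 0 ∨ n + 1 ≤ j := fun {n} j x => by
    rw [hD, coord_tau, Fin.exists_fin_two, thr_eq_zero_iff, thr_eq_one_iff,
      or_comm (a := n + 1 ≤ j)]
    rfl
  have hDsigma : ∀ {n : ℕ} (j : Fin (n + 1)) (x : (markedSimplex.{u} (N + 1) M).cells n),
      D (sigma j x) ↔ InHorn k x := fun {n} j x => by
    rw [hD]
    exact or_iff_left fun ⟨δ, h⟩ => coord_sigma_not_const j x δ h
  -- Over the top simplex, `tau j` is the missing face of `mid`, or lies in an end, or is a filler.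
  -- Fillers `tau` have the lowest rank, then comes `mid`, then the fillers `sig`; so all `tau` are
  -- available to `sig`.
  have htau : ∀ j : ℕ, j = k + ε ∨ D (MSSet.tau j (topCell.{u} M)) ∨
      ∃ i : Fin N, (HornPrismFiller.tau i).cell M k ε = MSSet.tau j (topCell.{u} M) := fun j => by
    by_cases hj : j = k + ε
    · exact Or.inl hj
    by_cases hj' : j = 0 ∨ N + 1 + 1 ≤ j
    · exact Or.inr (Or.inl ((hDtau _ _).2 (Or.inr hj')))
    right; right
    refine ⟨⟨if j < k + ε then j - 1 else j - 2, by split_ifs <;> omega⟩, ?_⟩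
    change MSSet.tau _ (topCell M) = _
    congr 1
    dsimp only
    split_ifs <;> omega
  { ι := HornPrismFiller N
    dim := dim
    cell := cell M k ε
    idx := idx k ε
    rank := rank
    exists_restricts := fun {n} z hz => by
      obtain ⟨j, hj, s, rfl⟩ | ⟨m, j, s, h⟩ := cyl_cases z
      · have hz' := hz
        rw [hDtau, not_or] at hz
        obtain h | h := not_inHorn_cases hz.1 <;> cases h
        · obtain rfl | h | ⟨i, h⟩ := htau j
          · exact ⟨mid, _, face_idx_cell mid⟩
          · exact absurd h hz'
          · exact ⟨.tau i, RelEmbedding.refl _, (res_refl _).trans h⟩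
        · refine ⟨.tau ⟨j - 1, by omega⟩, _, (face_idx_cell (HornPrismFiller.tau _)).trans ?_⟩
          change MSSet.tau _ (face k (topCell M)) = _
          congr 1
          dsimp only
          omega
      · obtain rfl : n = m + 1 := congrArg Sigma.fst h
        obtain rfl : z = sigma j s := eq_of_heq (Sigma.mk.inj h).2
        rw [hDsigma] at hz
        obtain h | h := not_inHorn_cases hz <;> cases h
        · by_cases hj : j = k
          · subst hj
            exact ⟨mid, RelEmbedding.refl _, res_refl _⟩
          · obtain ⟨i, rfl⟩ := Fin.exists_succAbove_eq hj
            exact ⟨sig i, RelEmbedding.refl _, res_refl _⟩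
        · exact ⟨sig j, _, face_idx_cell (sig j)⟩
    face_idx := fun q => by
      rw [face_idx_cell]
      cases q with
      | mid =>
        refine (hDtau _ _).not.2 ?_
        rintro (h | h)
        · exact not_inHorn_topCell h
        · have h' : k.val + ε.val = 0 ∨ N + 1 + 1 ≤ k.val + ε.val := h
          omega
      | sig j => exact (hDsigma _ _).not.2 (inHorn_face_iff.not.2 (by simp))
      | tau j =>
        refine (hDtau _ _).not.2 ?_
        rintro (h | h)
        · exact inHorn_face_iff.1 h rfl
        · have h' : j.val + 1 = 0 ∨ N + 1 ≤ j.val + 1 := h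
          omega
    face_of_ne := fun q i hi => by
      cases q with
      | mid =>
        -- Apart from the two `tau` faces, the faces of `sigma k` lie over faces opposite to
        -- vertices other than `k`, hence over the horn.
        obtain hi' | hi' | ⟨m, hm, i', j', he, h⟩ := face_sigma_cases i k (topCell M)
        · obtain h | h | ⟨l, hl⟩ := htau k
          · exact absurd (hi'.trans (Fin.ext (a := k.castSucc) (b := ⟨k + ε, by omega⟩) h)) hi
          · left
            rw [hi']
            exact (face_sigma_castSucc k (topCell M)).symm ▸ h
          · right
            refine ⟨.tau l, by simp [rank, Prod.Lex.toLex_lt_toLex], RelEmbedding.refl _, ?_⟩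
            rw [hi']
            exact (res_refl _).trans (hl.trans (face_sigma_castSucc k (topCell M)).symm)
        · obtain h | h | ⟨l, hl⟩ := htau (k + 1)
          · exact absurd (hi'.trans (Fin.ext (a := k.succ) (b := ⟨k + ε, by omega⟩) h)) hi
          · left
            rw [hi']
            exact (face_sigma_succ k (topCell M)).symm ▸ h
          · right
            refine ⟨.tau l, by simp [rank, Prod.Lex.toLex_lt_toLex], RelEmbedding.refl _, ?_⟩
            rw [hi']
            exact (res_refl _).trans (hl.trans (face_sigma_succ k (topCell M)).symm)
        · obtain rfl : N = m := Nat.succ.inj hm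
          left
          refine he.symm ▸ (hDsigma _ _).2 (inHorn_face_iff.2 fun e => ?_)
          subst e
          omega
      | sig j =>
        have hj := Fin.succAbove_ne k j
        obtain hi' | hi' | ⟨m, hm, i', j', he, h⟩ :=
            face_sigma_cases i (k.succAbove j) (topCell M)
        · obtain h | h | ⟨l, hl⟩ := htau (k.succAbove j)
          · right
            refine ⟨mid, by simp [rank, Prod.Lex.toLex_lt_toLex], _, (face_idx_cell mid).trans ?_⟩
            rw [hi']
            refine Eq.trans ?_ (face_sigma_castSucc _ (topCell M)).symm
            rw [h]
            rfl
          · left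
            rw [hi']
            exact (face_sigma_castSucc _ (topCell M)).symm ▸ h
          · right
            refine ⟨.tau l, by simp [rank, Prod.Lex.toLex_lt_toLex], RelEmbedding.refl _, ?_⟩
            rw [hi']
            exact (res_refl _).trans (hl.trans (face_sigma_castSucc _ (topCell M)).symm)
        · obtain h | h | ⟨l, hl⟩ := htau (k.succAbove j + 1)
          · right
            refine ⟨mid, by simp [rank, Prod.Lex.toLex_lt_toLex], _, (face_idx_cell mid).trans ?_⟩
            rw [hi']
            refine Eq.trans ?_ (face_sigma_succ _ (topCell M)).symm
            rw [h]
            rfl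
          · left
            rw [hi']
            exact (face_sigma_succ _ (topCell M)).symm ▸ h
          · right
            refine ⟨.tau l, by simp [rank, Prod.Lex.toLex_lt_toLex], RelEmbedding.refl _, ?_⟩
            rw [hi']
            exact (res_refl _).trans (hl.trans (face_sigma_succ _ (topCell M)).symm)
        · obtain rfl : N = m := Nat.succ.inj hm
          left
          refine he.symm ▸ (hDsigma _ _).2 (inHorn_face_iff.2 fun e => hi ?_)
          subst e
          change i = if j.castSucc < i' then i'.succ else i'.castSucc
          rw [val_succAbove] at h
          apply Fin.ext
          split_ifs at h ⊢ with h3 h4 h4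
          all_goals simp only [Fin.lt_def, Fin.val_castSucc, Fin.val_succ] at *
          all_goals omega
      | tau j =>
        left
        change D (face i (MSSet.tau _ (topCell M)))
        refine (face_tau (n := N) i _ (topCell M)).symm ▸ ?_
        exact (hDtau _ _).2 (Or.inl (inHorn_face_iff.2 hi))
    inj := fun q q' h => by
      rw [face_idx_cell, face_idx_cell] at h
      cases q with
      | mid =>
        cases q' with
        | mid => rfl
        | sig j => exact absurd h.symm tau_ne_sigma
        | tau j => exact absurd (congrArg Sigma.fst h) (by simp [dim])
      | sig j =>
        cases q' with
        | mid => exact absurd h tau_ne_sigma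
        | sig j' =>
          have := sigma_injective h
          cases this
          rfl
        | tau j => exact absurd (congrArg Sigma.fst h) (by simp [dim])
      | tau j =>
        cases q' with
        | mid => exact absurd (congrArg Sigma.fst h) (by simp [dim])
        | sig j' => exact absurd (congrArg Sigma.fst h) (by simp [dim])
        | tau j' =>
          have := (tau_injective (n := N) (n' := N) (by omega) (by omega) h).2
          congr 1
          omega
    ne := fun q q' h => by
      rw [face_idx_cell] at h
      have hfst := congrArg Sigma.fst h
      cases q with
      | mid => cases q' <;> simp only [dim] at hfst <;> omega
      | sig j => cases q' <;> simp only [dim] at hfst <;> omega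
      | tau j =>
        cases q' with
        | mid =>
          have := (tau_injective (n := N + 1) (n' := N + 1) (by split_ifs <;> omega) (by omega) h).2
          split_ifs at this <;> omega
        | sig j' => exact tau_ne_sigma h.symm
        | tau j' => simp [dim] at hfst
    critical := fun q θ hθ => by
      cases q with
      | mid =>
        -- The horn of `mid` is inner, since `1 ≤ k + ε ≤ N + 1` in a simplex of dimension `N + 2`.
        exfalso
        change IsCriticalEdge (N + 1 + 1) ⟨k + ε, _⟩ _ _ at hθ
        unfold IsCriticalEdge at hθ
        dsimp only at hθ
        omega
      | sig j =>
        -- This horn is outer only if `k` is an outer vertex, and then its critical edge projects to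
        -- the critical edge at `k`.
        refine res_sigma_topCell_mem_marked.2 fun d h0 h1 => ?_
        have h0' := congrArg Fin.val h0
        have h1' := congrArg Fin.val h1
        change IsCriticalEdge (N + 1 + 1) (if j.castSucc < k then k.succ else k.castSucc) _ _ at hθ
        rw [val_predAbove, val_succAbove] at h0' h1'
        change IsCriticalEdge _ _ _ _
        unfold IsCriticalEdge at hθ ⊢
        simp only [Fin.lt_def, Fin.val_castSucc] at h0' h1' hθ
        by_cases hjk : j.val < k.val
        · simp only [if_pos hjk, Fin.val_succ] at h0' h1' hθ
          split_ifs at h0' h1' <;> omega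
        · simp only [if_neg hjk, Fin.val_castSucc] at h0' h1' hθ
          split_ifs at h0' h1' <;> omega
      | tau j => exact res_tau_topCell_mem_marked.2 hθ
    marked := fun q θ hq hθ hm θ' => by
      -- For `mid` and `sig` a two-dimensional filler means `N = 0`, where the only edge of the
      -- simplex is critical. For `tau` it means `N = 1`, and the missing edge avoids `k`, whereas
      -- marked edges contain `k`.
      have hcrit : ∀ (d : Fin (1 + 1) ↪o Fin (N + 1 + 1)), N = 0 → M (d 0) (d 1) := fun d hN => by
        have := d.strictMono (show (0 : Fin (1 + 1)) < 1 by decide)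
        change IsCriticalEdge _ _ _ _
        unfold IsCriticalEdge
        omega
      cases q with
      | mid => exact res_sigma_topCell_mem_marked.2 fun d _ _ => hcrit d (Nat.succ.inj hq)
      | sig j => exact res_sigma_topCell_mem_marked.2 fun d _ _ => hcrit d (Nat.succ.inj hq)
      | tau j =>
        exfalso
        have hq' : N = 1 := hq
        obtain ⟨h0, h', -⟩ | ⟨h0, -, h'⟩ := res_tau_topCell_mem_marked.1 hm
        · exact hθ ⟨0, Fin.ext (h'.trans h0.symm)⟩
        · exact hθ ⟨1, Fin.ext (h'.trans h0.symm)⟩ }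

/-- Maps to a fibrant object extend from the union of the prism over a horn and both ends of the
prism over the simplex. -/
theorem exists_prism_lift {Y : MSSet.{u}} (hY : IsFibrant Y) (k : Fin (N + 1 + 1))
    (f : cyl (markedHorn.{u} (N + 1) k (IsCriticalEdge (N + 1) k)) ⟶ Y)
    (g : Fin 2 → (markedSimplex.{u} (N + 1) (IsCriticalEdge (N + 1) k) ⟶ Y))
    (hfg : ∀ ε, cylEnd ε _ ≫ f = markedHornInclusion (N + 1) k (IsCriticalEdge (N + 1) k) ≫ g ε) :
    ∃ H : cyl (markedSimplex.{u} (N + 1) (IsCriticalEdge (N + 1) k)) ⟶ Y,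
      cylMap (markedHornInclusion (N + 1) k (IsCriticalEdge (N + 1) k)) ≫ H = f ∧
        ∀ ε, cylEnd ε _ ≫ H = g ε := by
  have hY' := markedTwoOutOfThree_of_isFibrant hY
  obtain ⟨G, hdom, h1, h2⟩ := exists_cylinder_partialLift (ι := Unit) (κ := Fin 2) (toPoint Y) hY'
    (toPoint _) (fun _ => markedHornInclusion (N + 1) k (IsCriticalEdge (N + 1) k))
    (fun _ _ n x y h => by
      obtain rfl : x = y := by
        refine hornEmb_injective ?_
        exact congrArg toEmb h
      rfl)
    id Function.injective_id (fun _ => f) g (fun _ => hfg) (fun _ => rfl) (fun _ => rfl)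
  have hdom' : ∀ {n : ℕ} (z : (cyl (markedSimplex.{u} (N + 1) (IsCriticalEdge (N + 1) k))).cells n),
      G.Dom z ↔ InHorn k (tsnd z).simplex ∨ ∃ δ : Fin 2, ∀ l, coord (tfst z) l = δ :=
      fun {n} z => by
    rw [hdom]
    refine or_congr_left ⟨?_, fun h => ⟨(), ⟨(tsnd z).simplex, h⟩, rfl⟩⟩
    rintro ⟨-, a, ha⟩
    rw [← ha]
    exact a.2
  -- Only `k = 0` needs `ε = 1`; for all other `k` the choice `ε = 0` works.
  obtain ⟨ε, hε1, hε2⟩ : ∃ ε : Fin 2, 1 ≤ k.val + ε.val ∧ k.val + ε.val ≤ N + 1 := by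
    by_cases h : k.val = 0
    · exact ⟨1, by simp, by simp [h]⟩
    · exact ⟨0, by simp; omega, by simp; omega⟩
  obtain ⟨H, -, hrel⟩ := G.exists_lift hY hY'
    (hornPrismPairing k ε hε1 hε2 (fun {_} z => G.Dom z) hdom')
  exact ⟨H, hom_ext_ap fun n x => hrel _ _ _ (h1 () n x),
    fun ε => hom_ext_ap fun n x => hrel _ _ _ (h2 ε n x)⟩

end HornPrism

end MSSet

namespace MSSet

open FreeSimplex

/-! ## Symmetry of the double cylinder -/

/-- A monotone map factors through a surjective monotone map with the same fibres. -/
theorem exists_surjective_eq_iff {m n : ℕ} (θ : Fin (m + 1) →o Fin (n + 1)) :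
    ∃ (l : ℕ) (d : Fin (m + 1) →o Fin (l + 1)), Function.Surjective d ∧
      ∀ i j, d i = d j ↔ θ i = θ j := by
  -- Restricting the simplex of the point along `θ` computes the surjective part of the
  -- factorization of `θ`.
  let s : FreeSimplex point.{0}.toSemiSSet n := ofSimplex PUnit.unit
  exact ⟨_, (s.restrict θ).deg, (s.restrict θ).surj, fun i j => restrict_deg_eq_iff s θ i j⟩

/-- A surjective monotone map has a strictly increasing section. -/
theorem exists_section {m l : ℕ} {d : Fin (m + 1) →o Fin (l + 1)} (hd : Function.Surjective d) :
    ∃ σ : Fin (l + 1) ↪o Fin (m + 1), ∀ i, d (σ i) = i := by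
  choose σ hσ using hd
  refine ⟨OrderEmbedding.ofStrictMono σ fun i j hij => ?_, hσ⟩
  by_contra h
  have := d.monotone (not_lt.1 h)
  rw [hσ, hσ] at this
  exact absurd hij (not_lt.2 this)

namespace FreeSimplex

variable {A B : MSSet.{u}}

/-- A simplex of the free simplicial set is determined by the fibres of its degeneracy operator
and by its nondegenerate restrictions. -/
theorem ext_of_fibres {m : ℕ} {s t : FreeSimplex A.toSemiSSet m}
    (h : ∀ i j, s.deg i = s.deg j ↔ t.deg i = t.deg j)
    (h' : ∀ (l : ℕ) (σ : Fin (l + 1) ↪o Fin (m + 1)), Function.Bijective (fun i => s.deg (σ i)) →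
      s.restrict σ.toOrderHom = t.restrict σ.toOrderHom) : s = t := by
  obtain ⟨σ, hσ⟩ := exists_section s.surj
  -- A simplex is recovered from its restriction along a section of its degeneracy operator by
  -- degenerating back.
  have key : ∀ r : FreeSimplex A.toSemiSSet m, (∀ i j, s.deg i = s.deg j ↔ r.deg i = r.deg j) →
      (r.restrict σ.toOrderHom).restrict s.deg = r := fun r hr => by
    rw [restrict_restrict]
    refine IsRestriction.restrict_eq
      (isRestriction_of_emb (RelEmbedding.refl _) (fun i => ?_) (res_refl _))
    exact (hr _ _).1 (hσ _).symm
  rw [← key s (fun _ _ => Iff.rfl), ← key t h, h' _ σ ?_]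
  have : (fun i => s.deg (σ i)) = id := funext hσ
  rw [this]
  exact Function.bijective_id

/-- The first component of a simplex of the free simplicial set on a geometric product. -/
noncomputable def proj₁ {m : ℕ} (t : FreeSimplex (tensor A B).toSemiSSet m) :
    FreeSimplex A.toSemiSSet m :=
  (tfst (A := A) (B := B) t.simplex).restrict t.deg

/-- The second component of a simplex of the free simplicial set on a geometric product. -/
noncomputable def proj₂ {m : ℕ} (t : FreeSimplex (tensor A B).toSemiSSet m) :
    FreeSimplex B.toSemiSSet m :=
  (tsnd (A := A) (B := B) t.simplex).restrict t.deg

theorem proj₁_restrict {m n : ℕ} (t : FreeSimplex (tensor A B).toSemiSSet n)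
    (θ : Fin (m + 1) →o Fin (n + 1)) : (t.restrict θ).proj₁ = t.proj₁.restrict θ := by
  obtain ⟨d, hd, h⟩ := exists_emb_restrict t θ
  have e : d.toOrderHom.comp (t.restrict θ).deg = t.deg.comp θ :=
    OrderHom.ext _ _ (funext hd)
  rw [proj₁, proj₁, ← h, tfst_res, restrict_restrict, restrict_restrict, e]

theorem proj₂_restrict {m n : ℕ} (t : FreeSimplex (tensor A B).toSemiSSet n)
    (θ : Fin (m + 1) →o Fin (n + 1)) : (t.restrict θ).proj₂ = t.proj₂.restrict θ := by
  obtain ⟨d, hd, h⟩ := exists_emb_restrict t θ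
  have e : d.toOrderHom.comp (t.restrict θ).deg = t.deg.comp θ :=
    OrderHom.ext _ _ (funext hd)
  rw [proj₂, proj₂, ← h, tsnd_res, restrict_restrict, restrict_restrict, e]

theorem proj_deg_eq_iff {m : ℕ} (t : FreeSimplex (tensor A B).toSemiSSet m) (i j : Fin (m + 1)) :
    (t.proj₁.deg i = t.proj₁.deg j ∧ t.proj₂.deg i = t.proj₂.deg j) ↔ t.deg i = t.deg j := by
  rw [proj₁, proj₂, restrict_deg_eq_iff, restrict_deg_eq_iff]
  exact ⟨fun h => tensor_inj (A := A) (B := B) t.simplex _ _ h.1 h.2, fun h => by rw [h]; simp⟩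

theorem proj₁_ofSimplex {m : ℕ} (z : (tensor A B).cells m) : (ofSimplex z).proj₁ = tfst z :=
  restrict_id _

theorem proj₂_ofSimplex {m : ℕ} (z : (tensor A B).cells m) : (ofSimplex z).proj₂ = tsnd z :=
  restrict_id _

/-- With `exists_pair` this says that the free simplicial set on a geometric product is the product
of the free simplicial sets. The components fix the fibres of the degeneracy, and nondegenerate
simplices of the product are pairs by definition. -/
theorem proj_ext {m : ℕ} {s t : FreeSimplex (tensor A B).toSemiSSet m} (h₁ : s.proj₁ = t.proj₁)
    (h₂ : s.proj₂ = t.proj₂) : s = t := by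
  refine ext_of_fibres (fun i j => ?_) fun l σ hσ => ?_
  · rw [← proj_deg_eq_iff, ← proj_deg_eq_iff, h₁, h₂]
  · have hst : ∀ i j, s.deg i = s.deg j ↔ t.deg i = t.deg j := fun i j => by
      rw [← proj_deg_eq_iff, ← proj_deg_eq_iff, h₁, h₂]
    obtain ⟨x, hx⟩ := exists_eq_ofSimplex (s.restrict σ.toOrderHom) fun i j h =>
      hσ.1 ((restrict_deg_eq_iff _ _ _ _).1 h)
    obtain ⟨y, hy⟩ := exists_eq_ofSimplex (t.restrict σ.toOrderHom) fun i j h =>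
      hσ.1 ((hst _ _).2 ((restrict_deg_eq_iff _ _ _ _).1 h))
    rw [hx, hy]
    congr 1
    refine tensor_ext ?_ ?_
    · rw [← proj₁_ofSimplex, ← proj₁_ofSimplex, ← hx, ← hy, proj₁_restrict, proj₁_restrict, h₁]
    · rw [← proj₂_ofSimplex, ← proj₂_ofSimplex, ← hx, ← hy, proj₂_restrict, proj₂_restrict, h₂]

theorem exists_pair {m : ℕ} (a : FreeSimplex A.toSemiSSet m) (b : FreeSimplex B.toSemiSSet m) :
    ∃ t : FreeSimplex (tensor A B).toSemiSSet m, t.proj₁ = a ∧ t.proj₂ = b := by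
  -- The sum of two monotone maps takes equal values at two points exactly if both maps do, so its
  -- surjective part is the common degeneracy of the pair.
  obtain ⟨l, d, hd, hd'⟩ := exists_surjective_eq_iff (n := a.len + b.len)
    ⟨fun i => ⟨(a.deg i).val + (b.deg i).val, by omega⟩, fun i j hij =>
      Fin.le_def.2 (Nat.add_le_add (a.deg.monotone hij) (b.deg.monotone hij))⟩
  have hd : ∀ i j, d i = d j ↔ a.deg i = a.deg j ∧ b.deg i = b.deg j := fun i j => by
    rw [hd']
    refine ⟨fun h => ?_, fun h => Fin.ext (congrArg₂ (· + ·) (congrArg Fin.val h.1)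
      (congrArg Fin.val h.2))⟩
    have h' : (a.deg i).val + (b.deg i).val = (a.deg j).val + (b.deg j).val := congrArg Fin.val h
    simp only [Fin.ext_iff]
    obtain hij | hij := le_total i j
    · have h1 : (a.deg i).val ≤ (a.deg j).val := a.deg.monotone hij
      have h2 : (b.deg i).val ≤ (b.deg j).val := b.deg.monotone hij
      omega
    · have h1 : (a.deg j).val ≤ (a.deg i).val := a.deg.monotone hij
      have h2 : (b.deg j).val ≤ (b.deg i).val := b.deg.monotone hij
      omega
  obtain ⟨σ, hσ⟩ := exists_section ‹Function.Surjective d›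
  refine ⟨⟨l, d, ‹_›, tmk (a.restrict σ.toOrderHom) (b.restrict σ.toOrderHom) fun i j h h' => ?_⟩,
    ?_, ?_⟩
  · rw [restrict_deg_eq_iff] at h h'
    rw [← hσ i, ← hσ j]
    exact (hd _ _).2 ⟨h, h'⟩
  · refine (restrict_restrict a σ.toOrderHom d).trans (IsRestriction.restrict_eq
      (isRestriction_of_emb (RelEmbedding.refl _) (fun i => ?_) (res_refl _)))
    exact ((hd _ _).1 (hσ (d i)).symm).1
  · refine (restrict_restrict b σ.toOrderHom d).trans (IsRestriction.restrict_eq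
      (isRestriction_of_emb (RelEmbedding.refl _) (fun i => ?_) (res_refl _)))
    exact ((hd _ _).1 (hσ (d i)).symm).2

/-- The simplex of the free simplicial set on a geometric product with given components. -/
noncomputable def pair {m : ℕ} (a : FreeSimplex A.toSemiSSet m) (b : FreeSimplex B.toSemiSSet m) :
    FreeSimplex (tensor A B).toSemiSSet m :=
  (exists_pair a b).choose

@[simp]
theorem proj₁_pair {m : ℕ} (a : FreeSimplex A.toSemiSSet m) (b : FreeSimplex B.toSemiSSet m) :
    (pair a b).proj₁ = a :=
  (exists_pair a b).choose_spec.1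

@[simp]
theorem proj₂_pair {m : ℕ} (a : FreeSimplex A.toSemiSSet m) (b : FreeSimplex B.toSemiSSet m) :
    (pair a b).proj₂ = b :=
  (exists_pair a b).choose_spec.2

theorem isMarked_proj₂ {t : FreeSimplex (tensor A B).toSemiSSet 1}
    (ht : t.IsMarked (tensor A B).marked) : t.proj₂.IsMarked B.marked := by
  intro y hy
  obtain ⟨x, rfl⟩ := exists_eq_ofSimplex t fun i j hij => by
    have := ((proj_deg_eq_iff t i j).2 hij).2
    rw [hy] at this
    exact this
  rw [proj₂_ofSimplex] at hy
  exact (ht x rfl).2 y hy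

theorem proj₁_map_vertexTensor (a : A.toSemiSSet.obj (op (ord 0))) {m : ℕ}
    (t : FreeSimplex B.toSemiSSet m) : (t.map (vertexTensor a B)).proj₁ = ofVertex a m :=
  restrict_ofVertex a t.deg

theorem proj₂_map_vertexTensor (a : A.toSemiSSet.obj (op (ord 0))) {m : ℕ}
    (t : FreeSimplex B.toSemiSSet m) : (t.map (vertexTensor a B)).proj₂ = t :=
  IsRestriction.restrict_eq
    (isRestriction_of_emb (RelEmbedding.refl _) (fun _ => rfl) (res_refl _))

end FreeSimplex

variable {X Y : MSSet.{u}}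

/-- The exchange of the two directions of the double cylinder. -/
noncomputable def cylSwap (X : MSSet.{u}) : cyl (cyl X) ⟶ cyl (cyl X) :=
  -- In coordinates, `(s, (t, x))` goes to `(t, (s, x))`.
  homMk (fun _ z => tmk (tsnd z).proj₁ (pair (tfst z) (tsnd z).proj₂) fun i j h h' => by
      have h'' := (proj_deg_eq_iff _ i j).2 h'
      rw [proj₁_pair, proj₂_pair] at h''
      exact tensor_inj z i j h''.1 ((proj_deg_eq_iff _ i j).1 ⟨h, h''.2⟩))
    (fun θ z => tensor_ext (proj₁_restrict _ _) <| proj_ext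
      (by
        refine (proj₁_pair _ _).trans ((tfst_res θ z).trans ?_)
        refine Eq.trans ?_ (proj₁_restrict _ θ.toOrderHom).symm
        exact congrArg (fun s : FreeSimplex interval.toSemiSSet _ => s.restrict θ.toOrderHom)
          (proj₁_pair (tfst z) (tsnd z).proj₂).symm)
      (by
        refine (proj₂_pair _ _).trans ((proj₂_restrict _ _).trans ?_)
        refine Eq.trans ?_ (proj₂_restrict _ θ.toOrderHom).symm
        exact congrArg (fun s : FreeSimplex X.toSemiSSet _ => s.restrict θ.toOrderHom)
          (proj₂_pair (tfst z) (tsnd z).proj₂).symm))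
    (fun e he => ⟨isMarked_interval _, fun x hx => ⟨isMarked_interval _, by
      have h : tsnd x = (tsnd e).proj₂ := by
        rw [← proj₂_ofSimplex, ← proj₂_pair (tfst e) (tsnd e).proj₂]
        exact congrArg proj₂ hx.symm
      have h' : (tsnd x).IsMarked X.marked := h.symm ▸ isMarked_proj₂ he.2
      exact h'⟩⟩)

theorem cylEnd_comp_cylSwap (ε : Fin 2) (X : MSSet.{u}) :
    cylEnd ε (cyl X) ≫ cylSwap X = cylMap (cylEnd ε X) :=
  hom_ext_ap fun _ z => tensor_ext (proj₁_ofSimplex z) <| proj_ext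
    ((proj₁_pair _ _).trans (proj₁_map_vertexTensor _ (tsnd z)).symm)
    ((proj₂_pair _ _).trans ((proj₂_ofSimplex z).trans (proj₂_map_vertexTensor _ (tsnd z)).symm))

theorem cylMap_cylEnd_comp_cylSwap (ε : Fin 2) (X : MSSet.{u}) :
    cylMap (cylEnd ε X) ≫ cylSwap X = cylEnd ε (cyl X) :=
  hom_ext_ap fun _ z => tensor_ext (proj₁_map_vertexTensor _ (tsnd z)) <| proj_ext
    ((proj₁_pair _ _).trans (proj₁_ofSimplex z).symm)
    ((proj₂_pair _ _).trans ((proj₂_map_vertexTensor _ (tsnd z)).trans (proj₂_ofSimplex z).symm))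

/-- The diagonal of the double cylinder. -/
noncomputable def cylDiag (X : MSSet.{u}) : cyl X ⟶ cyl (cyl X) :=
  homMk (fun _ z => tmk (tfst z) (ofSimplex z) fun _ _ _ h => h)
    (fun θ z => tensor_ext rfl
      (restrict_ofSimplex z ((homEquiv (n := ord _) (m := ord _)).symm θ)).symm)
    (fun _ he => ⟨isMarked_interval _, isMarked_ofSimplex.2 he⟩)

theorem cylEnd_comp_cylDiag (ε : Fin 2) (X : MSSet.{u}) :
    cylEnd ε X ≫ cylDiag X = cylEnd ε X ≫ cylEnd ε (cyl X) :=
  hom_ext_ap fun _ _ => rfl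

end MSSet

namespace MSSet

open FreeSimplex

/-! ## The homotopy relation -/

variable {X Y Z E B : MSSet.{u}}

theorem cylEnd_naturality (ε : Fin 2) (f : X ⟶ Y) :
    cylEnd ε X ≫ cylMap f = f ≫ cylEnd ε Y :=
  vertexTensor_naturality _ f

theorem cylEnd_naturality_assoc (ε : Fin 2) (f : X ⟶ Y) (g : cyl Y ⟶ Z) :
    cylEnd ε X ≫ cylMap f ≫ g = f ≫ cylEnd ε Y ≫ g := by
  rw [← Category.assoc, cylEnd_naturality, Category.assoc]

/-- Homotopic maps. -/
def Homotopic (f g : X ⟶ Y) : Prop := Nonempty (Homotopy f g)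

theorem homotopic_iff {f g : X ⟶ Y} :
    Homotopic f g ↔ ∃ h : cyl X ⟶ Y, cylEnd 0 X ≫ h = f ∧ cylEnd 1 X ≫ h = g :=
  ⟨fun ⟨h⟩ => ⟨h.map, h.map_zero, h.map_one⟩, fun ⟨h, h0, h1⟩ => ⟨⟨h, h0, h1⟩⟩⟩

theorem Homotopic.comp_right {f g : X ⟶ Y} (h : Homotopic f g) (k : Y ⟶ Z) :
    Homotopic (f ≫ k) (g ≫ k) := by
  obtain ⟨H, rfl, rfl⟩ := homotopic_iff.1 h
  exact homotopic_iff.2 ⟨H ≫ k, (Category.assoc _ _ _).symm, (Category.assoc _ _ _).symm⟩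

theorem Homotopic.comp_left {f g : Y ⟶ Z} (h : Homotopic f g) (k : X ⟶ Y) :
    Homotopic (k ≫ f) (k ≫ g) := by
  obtain ⟨H, rfl, rfl⟩ := homotopic_iff.1 h
  exact homotopic_iff.2 ⟨cylMap k ≫ H, cylEnd_naturality_assoc _ _ _,
    cylEnd_naturality_assoc _ _ _⟩

/-- A map is one end of a homotopy, which may be chosen over a given homotopy. -/
theorem exists_homotopy_lift {p : E ⟶ B} (hp : fibrations p) (hE : IsFibrant E) (b : cyl X ⟶ B)
    (ε : Fin 2) (g : X ⟶ E) (hg : g ≫ p = cylEnd ε X ≫ b) :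
    ∃ H : cyl X ⟶ E, H ≫ p = b ∧ cylEnd ε X ≫ H = g := by
  obtain ⟨H, h1, -, h2⟩ := exists_cylinder_lift hp hE b (ι := Empty) (A := fun _ => X)
    (fun α => α.elim) (fun α => α.elim) ε (fun α => α.elim) g (fun α => α.elim)
    (fun α => α.elim) hg
  exact ⟨H, h1, h2⟩

theorem cylEnd_injective {α β : Fin 2} {n : ℕ} {x y : X.cells n}
    (h : ap (cylEnd α X) x = ap (cylEnd β X) y) : α = β ∧ x = y :=
  ⟨congrArg (fun z : (cyl X).cells n => coord (tfst z) 0) h, ofSimplex_injective (congrArg tsnd h)⟩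

/-- Lifting a square, given lifts of three of its sides. -/
theorem exists_square_lift {p : E ⟶ B} (hp : fibrations p) (hE : IsFibrant E)
    (b : cyl (cyl X) ⟶ B) (ε : Fin 2) (f : Fin 2 → (cyl X ⟶ E)) (g : cyl X ⟶ E)
    (hfg : ∀ α, cylEnd ε X ≫ f α = cylEnd α X ≫ g)
    (hf : ∀ α, f α ≫ p = cylMap (cylEnd α X) ≫ b) (hg : g ≫ p = cylEnd ε (cyl X) ≫ b) :
    ∃ H : cyl (cyl X) ⟶ E, H ≫ p = b ∧ (∀ α, cylMap (cylEnd α X) ≫ H = f α) ∧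
      cylEnd ε (cyl X) ≫ H = g :=
  exists_cylinder_lift hp hE b (fun α => cylEnd α X)
    (fun α β n x y h => by
      obtain ⟨rfl, rfl⟩ := cylEnd_injective h
      rfl) ε f g hfg hf hg

/-- Two consecutive sides of a square extend over the square, and the composite homotopy is its
diagonal. -/
theorem Homotopic.trans (hY : IsFibrant Y) {f g h : X ⟶ Y} (h₁ : Homotopic f g)
    (h₂ : Homotopic g h) : Homotopic f h := by
  obtain ⟨a, rfl, rfl⟩ := homotopic_iff.1 h₁
  obtain ⟨c, hc, rfl⟩ := homotopic_iff.1 h₂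
  obtain ⟨H, -, h1, h2⟩ := exists_cylinder_lift hY hY (toPoint _) (ι := Unit)
    (fun _ => cylEnd 1 X) (fun α β n x y h => by
      obtain ⟨-, rfl⟩ := cylEnd_injective h
      rfl) 0 (fun _ => c) a (fun _ => hc) (fun _ => rfl) rfl
  refine homotopic_iff.2 ⟨cylDiag X ≫ H, ?_, ?_⟩
  · rw [← Category.assoc, cylEnd_comp_cylDiag, Category.assoc, h2]
  · rw [← Category.assoc, cylEnd_comp_cylDiag, Category.assoc, ← cylEnd_naturality_assoc, h1 ()]

/-- Three sides of a square are extended to the whole square; the fourth side is the new homotopy.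
In `square_one` the absent side is the opposite one. -/
theorem Homotopic.square_zero (hY : IsFibrant Y) {a b c d : X ⟶ Y} (hab : Homotopic a b)
    (hac : Homotopic a c) (hbd : Homotopic b d) : Homotopic c d := by
  obtain ⟨h, h0, h1⟩ := homotopic_iff.1 hab
  obtain ⟨k, k0, rfl⟩ := homotopic_iff.1 hac
  obtain ⟨l, l0, rfl⟩ := homotopic_iff.1 hbd
  obtain ⟨H, -, h3, h4⟩ := exists_square_lift hY hY (toPoint _) 0 ![k, l] h
    (Fin.forall_fin_two.2 ⟨k0.trans h0.symm, l0.trans h1.symm⟩) (fun _ => rfl) rfl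
  refine homotopic_iff.2 ⟨cylEnd 1 _ ≫ H, ?_, ?_⟩
  · rw [← cylEnd_naturality_assoc, h3]; rfl
  · rw [← cylEnd_naturality_assoc, h3]; rfl

theorem Homotopic.square_one (hY : IsFibrant Y) {a b c d : X ⟶ Y} (hcd : Homotopic c d)
    (hac : Homotopic a c) (hbd : Homotopic b d) : Homotopic a b := by
  obtain ⟨h, h0, h1⟩ := homotopic_iff.1 hcd
  obtain ⟨k, rfl, k1⟩ := homotopic_iff.1 hac
  obtain ⟨l, rfl, l1⟩ := homotopic_iff.1 hbd
  obtain ⟨H, -, h3, h4⟩ := exists_square_lift hY hY (toPoint _) 1 ![k, l] h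
    (Fin.forall_fin_two.2 ⟨k1.trans h0.symm, l1.trans h1.symm⟩) (fun _ => rfl) rfl
  refine homotopic_iff.2 ⟨cylEnd 0 _ ≫ H, ?_, ?_⟩
  · rw [← cylEnd_naturality_assoc, h3]; rfl
  · rw [← cylEnd_naturality_assoc, h3]; rfl

/-- No constant homotopy is available. Instead `f` is joined to some `f'` and `f'` to some `f''`;
the homotopies `f ∼ f'` and `f ∼ f''` over `f' ∼ f''` form three sides of a square whose fourth side
joins `f` to itself. -/
theorem Homotopic.refl (hY : IsFibrant Y) (f : X ⟶ Y) : Homotopic f f := by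
  obtain ⟨h, -, rfl⟩ := exists_homotopy_lift hY hY (toPoint (cyl X)) 0 f rfl
  obtain ⟨k, -, hk⟩ := exists_homotopy_lift hY hY (toPoint (cyl X)) 0 (cylEnd 1 X ≫ h) rfl
  have h₁ : Homotopic (cylEnd 0 X ≫ h) (cylEnd 1 X ≫ h) := homotopic_iff.2 ⟨h, rfl, rfl⟩
  have h₂ : Homotopic (cylEnd 1 X ≫ h) (cylEnd 1 X ≫ k) := homotopic_iff.2 ⟨k, hk, rfl⟩
  exact h₂.square_one hY h₁ (h₁.trans hY h₂)

theorem Homotopic.symm (hY : IsFibrant Y) {f g : X ⟶ Y} (h : Homotopic f g) : Homotopic g f :=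
  (Homotopic.refl hY f).square_zero hY h (Homotopic.refl hY f)

/-! ## Homotopy equivalences -/

theorem homotopyEquivalences_iff {f : X ⟶ Y} : homotopyEquivalences f ↔
    ∃ g : Y ⟶ X, Homotopic (f ≫ g) (𝟙 X) ∧ Homotopic (g ≫ f) (𝟙 Y) := Iff.rfl

theorem homotopyEquivalences_of_isIso (hX : IsFibrant X) (hY : IsFibrant Y) (f : X ⟶ Y)
    [IsIso f] : homotopyEquivalences f :=
  homotopyEquivalences_iff.2 ⟨inv f, by simpa using Homotopic.refl hX (𝟙 X),
    by simpa using Homotopic.refl hY (𝟙 Y)⟩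

theorem homotopyEquivalences_comp (hX : IsFibrant X) (hZ : IsFibrant Z) {f : X ⟶ Y} {g : Y ⟶ Z}
    (hf : homotopyEquivalences f) (hg : homotopyEquivalences g) :
    homotopyEquivalences (f ≫ g) := by
  obtain ⟨f', h1, h2⟩ := homotopyEquivalences_iff.1 hf
  obtain ⟨g', h3, h4⟩ := homotopyEquivalences_iff.1 hg
  refine homotopyEquivalences_iff.2 ⟨g' ≫ f', ?_, ?_⟩
  · refine Homotopic.trans hX ?_ h1
    simpa using (h3.comp_right f').comp_left f
  · refine Homotopic.trans hZ ?_ h4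
    simpa using (h2.comp_right g).comp_left g'

/-- Homotopy equivalences satisfy the 2-out-of-6 property. -/
theorem homotopyEquivalences_two_out_of_six {T : MSSet.{u}} (hX : IsFibrant X) (hY : IsFibrant Y)
    (hZ : IsFibrant Z) (hT : IsFibrant T) (f : X ⟶ Y) (g : Y ⟶ Z) (h : Z ⟶ T)
    (hfg : homotopyEquivalences (f ≫ g)) (hgh : homotopyEquivalences (g ≫ h)) :
    homotopyEquivalences f ∧ homotopyEquivalences g ∧ homotopyEquivalences h ∧
      homotopyEquivalences (f ≫ g ≫ h) := by
  obtain ⟨a, a1, a2⟩ := homotopyEquivalences_iff.1 hfg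
  obtain ⟨b, b1, b2⟩ := homotopyEquivalences_iff.1 hgh
  rw [Category.assoc] at a1 b1
  -- These are a left and a right homotopy inverse of `g`, compared through `a ≫ f ≫ g ≫ h ≫ b`.
  have hab : Homotopic (a ≫ f) (h ≫ b) := by
    have e1 := (b1.comp_left (a ≫ f)).symm hY
    have e2 := a2.comp_right (h ≫ b)
    simp only [Category.assoc, Category.comp_id, Category.id_comp] at e1 e2
    exact e1.trans hY e2
  have hf : homotopyEquivalences f := ⟨g ≫ a, a1, by
    rw [Category.assoc]
    exact (hab.comp_left g).trans hY b1⟩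
  have hh : homotopyEquivalences h := homotopyEquivalences_iff.2 ⟨b ≫ g, by
    have e := (hab.symm hY).comp_right g
    simp only [Category.assoc] at e a2
    exact e.trans hZ a2, by simpa using b2⟩
  have hg : homotopyEquivalences g :=
    homotopyEquivalences_iff.2 ⟨a ≫ f, (hab.comp_left g).trans hY b1, by simpa using a2⟩
  exact ⟨hf, hg, hh, homotopyEquivalences_comp hX hT hf (homotopyEquivalences_comp hY hT hg hh)⟩

/-! ## Trivial fibrations -/

/-- The maps that are injective on simplices. -/
def injections : MorphismProperty MSSet.{u} := fun A B i =>
  ∀ n, Function.Injective (ap i : A.cells n → B.cells n)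

/-- The maps with the right lifting property against all maps that are injective on simplices. -/
def trivialFibrations : MorphismProperty MSSet.{u} := injections.{u}.rlp

theorem anodyneGenerators_le_injections : anodyneGenerators.{u} ≤ injections := by
  intro A B i hi
  cases hi with
  | horn n hn k => exact fun m s t h => hornEmb_injective (congrArg toEmb h)
  | saturation => exact fun m s t h => h

theorem trivialFibrations_le_fibrations : trivialFibrations.{u} ≤ fibrations :=
  MorphismProperty.antitone_rlp anodyneGenerators_le_injections

/-- The empty marked semisimplicial set. -/
def empty : MSSet.{u} :=
  ofCells (fun _ => PEmpty) (fun _ x => x) (fun _ => rfl) (fun _ _ _ => rfl) ∅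

/-- The map out of the empty marked semisimplicial set. -/
def emptyHom (X : MSSet.{u}) : empty ⟶ X :=
  homMk (fun _ x => PEmpty.elim x) (fun _ x => PEmpty.elim x) (fun x => PEmpty.elim x)

theorem injections_emptyHom (X : MSSet.{u}) : injections (emptyHom X) :=
  fun _ => PEmpty.rec

/-- The disjoint union of two copies of a marked semisimplicial set. -/
def double (X : MSSet.{u}) : MSSet.{u} :=
  ofCells (fun n => Fin 2 × X.cells n) (fun θ x => (x.1, res θ x.2))
    (fun _ => Prod.ext rfl (res_refl _)) (fun _ _ _ => Prod.ext rfl (res_res _ _ _))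
    {e | e.2 ∈ X.marked}

/-- The map out of `double X` given by two maps. -/
def doubleHom (f : Fin 2 → (X ⟶ Y)) : double X ⟶ Y :=
  homMk (fun _ x => ap (f x.1) x.2) (fun _ x => ap_res (f x.1) _ _)
    (fun e he => ap_mem (f e.1) he)

/-- The inclusion of a copy. -/
def doubleIncl (ε : Fin 2) (X : MSSet.{u}) : X ⟶ double X :=
  homMk (fun _ x => (ε, x)) (fun _ _ => rfl) (fun _ he => he)

theorem doubleIncl_comp (f : Fin 2 → (X ⟶ Y)) (ε : Fin 2) : doubleIncl ε X ≫ doubleHom f = f ε :=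
  hom_ext_ap fun _ _ => rfl

theorem double_hom_ext {f g : double X ⟶ Y} (h : ∀ ε, doubleIncl ε X ≫ f = doubleIncl ε X ≫ g) :
    f = g :=
  hom_ext_ap fun _ x => hom_congr (h x.1) x.2

theorem injections_double (X : MSSet.{u}) : injections (doubleHom fun ε => cylEnd ε X) :=
  fun _ x y h => by
    obtain ⟨h1, h2⟩ := cylEnd_injective (α := x.1) (β := y.1) (x := x.2) (y := y.2) h
    exact Prod.ext h1 h2

theorem exists_lift_of_trivialFibrations {p : E ⟶ B} (hp : trivialFibrations p) {A : MSSet.{u}}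
    {i : A ⟶ Z} (hi : injections i) (f : A ⟶ E) (g : Z ⟶ B) (h : f ≫ p = i ≫ g) :
    ∃ l : Z ⟶ E, i ≫ l = f ∧ l ≫ p = g := by
  have := hp i hi
  have sq : CommSq f i p g := ⟨h⟩
  exact ⟨sq.lift, sq.fac_left, sq.fac_right⟩

theorem exists_section_of_trivialFibrations {p : E ⟶ B} (hp : trivialFibrations p) :
    ∃ s : B ⟶ E, s ≫ p = 𝟙 B := by
  obtain ⟨s, -, hs⟩ := exists_lift_of_trivialFibrations hp (injections_emptyHom B) (emptyHom E)
    (𝟙 B) (hom_ext_ap fun _ x => PEmpty.elim x)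
  exact ⟨s, hs⟩

/-- A homotopy from the common composite to itself lifts along `p` relative to both ends of the
cylinder, which form an injective map out of `double X`. -/
theorem homotopic_of_comp_eq {p : E ⟶ B} (hp : trivialFibrations p) (hB : IsFibrant B)
    {f g : X ⟶ E} (h : f ≫ p = g ≫ p) : Homotopic f g := by
  obtain ⟨r, r0, r1⟩ := homotopic_iff.1 (Homotopic.refl hB (f ≫ p))
  obtain ⟨H, hH, -⟩ := exists_lift_of_trivialFibrations hp (injections_double X)
    (doubleHom ![f, g]) r (double_hom_ext (Fin.forall_fin_two.2 ⟨by
      rw [← Category.assoc, ← Category.assoc, doubleIncl_comp, doubleIncl_comp, r0]; rfl, by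
      rw [← Category.assoc, ← Category.assoc, doubleIncl_comp, doubleIncl_comp, r1]
      exact h.symm⟩))
  refine homotopic_iff.2 ⟨H, ?_, ?_⟩
  · rw [← doubleIncl_comp (fun ε => cylEnd ε X) 0, Category.assoc, hH, doubleIncl_comp]; rfl
  · rw [← doubleIncl_comp (fun ε => cylEnd ε X) 1, Category.assoc, hH, doubleIncl_comp]; rfl

theorem homotopyEquivalences_of_trivialFibrations {p : E ⟶ B} (hp : trivialFibrations p)
    (hB : IsFibrant B) : homotopyEquivalences p := by
  obtain ⟨s, hs⟩ := exists_section_of_trivialFibrations hp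
  refine homotopyEquivalences_iff.2 ⟨s, homotopic_of_comp_eq hp hB ?_, ?_⟩
  · rw [Category.assoc, hs, Category.comp_id, Category.id_comp]
  · rw [hs]
    exact Homotopic.refl hB _

/-- A section of a fibration that is a homotopy equivalence and a homotopy inverse. -/
theorem exists_section_of_homotopyEquivalences {p : E ⟶ B} (hp : fibrations p) (hE : IsFibrant E)
    (hw : homotopyEquivalences p) :
    ∃ s : B ⟶ E, s ≫ p = 𝟙 B ∧ Homotopic (𝟙 E) (p ≫ s) := by
  obtain ⟨q, h1, h2⟩ := homotopyEquivalences_iff.1 hw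
  obtain ⟨β, hβ0, hβ1⟩ := homotopic_iff.1 h2
  -- Lifting the homotopy `q ≫ p ∼ 𝟙` from `q` replaces the homotopy inverse `q` by a homotopic map
  -- that is a strict section.
  obtain ⟨H, hH, hH0⟩ := exists_homotopy_lift hp hE β 0 q hβ0.symm
  refine ⟨cylEnd 1 B ≫ H, by rw [Category.assoc, hH, hβ1], ?_⟩
  have h3 : Homotopic q (cylEnd 1 B ≫ H) := homotopic_iff.2 ⟨H, hH0, rfl⟩
  exact (h1.symm hE).trans hE (h3.comp_left p)

/-- The homotopy from the identity to a section may be chosen over a homotopy of the base. -/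
theorem exists_homotopy_over {p : E ⟶ B} (hp : fibrations p) (hE : IsFibrant E) {s : B ⟶ E}
    (hs : s ≫ p = 𝟙 B) (hk : Homotopic (𝟙 E) (p ≫ s)) {r : cyl B ⟶ B}
    (hr : ∀ ε, cylEnd ε B ≫ r = 𝟙 B) :
    ∃ k : cyl E ⟶ E, cylEnd 0 E ≫ k = 𝟙 E ∧ cylEnd 1 E ≫ k = p ≫ s ∧ k ≫ p = cylMap p ≫ r := by
  obtain ⟨k, k0, k1⟩ := homotopic_iff.1 hk
  have hb : ∀ ε, cylEnd ε (cyl E) ≫ cylSwap E ≫ cylMap (k ≫ p) ≫ r =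
      cylMap (cylEnd ε E ≫ k ≫ p) ≫ r := fun ε => by
    rw [← Category.assoc, cylEnd_comp_cylSwap, ← Category.assoc, ← tensorMap_comp]
  have hb' : ∀ ε, cylMap (cylEnd ε E) ≫ cylSwap E ≫ cylMap (k ≫ p) ≫ r = k ≫ p := fun ε => by
    rw [← Category.assoc, cylMap_cylEnd_comp_cylSwap, cylEnd_naturality_assoc, hr,
      Category.comp_id]
  have hkps : cylEnd 1 E ≫ k ≫ p = p := by
    rw [← Category.assoc, k1, Category.assoc, hs, Category.comp_id]
  -- Over the square given by `r` applied to `k ≫ p`, the known sides are `k`, its push `k ≫ p ≫ s`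
  -- into the section, and `r` pushed into the section. The fourth side runs from `𝟙 E` to `p ≫ s`
  -- over `r`. The swap makes `r` run in the direction of that side.
  obtain ⟨H, hH, hHα, hH1⟩ := exists_square_lift hp hE (cylSwap E ≫ cylMap (k ≫ p) ≫ r) 1
    ![k, k ≫ p ≫ s] (cylMap p ≫ r ≫ s)
    (fun α => by
      have h : cylEnd α E ≫ cylMap p ≫ r ≫ s = p ≫ s := by
        rw [cylEnd_naturality_assoc, ← Category.assoc (cylEnd α B), hr, Category.id_comp]
      rw [h]
      revert α
      refine Fin.forall_fin_two.2 ⟨fun _ => k1, fun _ => ?_⟩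
      change cylEnd 1 E ≫ k ≫ p ≫ s = p ≫ s
      rw [← Category.assoc k, ← Category.assoc (cylEnd 1 E), hkps])
    (fun α => by
      rw [hb']
      revert α
      refine Fin.forall_fin_two.2 ⟨rfl, ?_⟩
      change (k ≫ p ≫ s) ≫ p = k ≫ p
      rw [Category.assoc, Category.assoc, hs, Category.comp_id])
    (by rw [hb, hkps, Category.assoc, Category.assoc, hs, Category.comp_id])
  refine ⟨cylEnd 0 (cyl E) ≫ H, ?_, ?_, ?_⟩
  · rw [← cylEnd_naturality_assoc, hHα]
    exact k0
  · rw [← cylEnd_naturality_assoc, hHα]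
    change cylEnd 0 E ≫ k ≫ p ≫ s = p ≫ s
    rw [← Category.assoc, k0, Category.id_comp]
  · rw [Category.assoc, hH, hb, ← Category.assoc (cylEnd 0 E), k0, Category.id_comp]

/-- A fibration between fibrant objects that is a homotopy equivalence is a trivial fibration. -/
theorem trivialFibrations_of_homotopyEquivalences {p : E ⟶ B} (hp : fibrations p)
    (hE : IsFibrant E) (hB : IsFibrant B) (hw : homotopyEquivalences p) : trivialFibrations p := by
  obtain ⟨s, hs, hk⟩ := exists_section_of_homotopyEquivalences hp hE hw
  obtain ⟨r, r0, r1⟩ := homotopic_iff.1 (Homotopic.refl hB (𝟙 B))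
  have hr : ∀ ε, cylEnd ε B ≫ r = 𝟙 B := Fin.forall_fin_two.2 ⟨r0, r1⟩
  obtain ⟨k, k0, k1, hkp⟩ := exists_homotopy_over hp hE hs hk hr
  intro A Z i hi
  refine ⟨fun {u v} sq => ?_⟩
  -- At the end `1` the map `v ≫ s` is a lift of `v` that is correct only up to `k` on `A`.
  -- Extending the correction `cylMap u ≫ k` over `Z` gives the true lift at the end `0`.
  obtain ⟨H, hH, hHi, hH1⟩ := exists_cylinder_lift hp hE (cylMap v ≫ r) (ι := Unit) (fun _ => i)
    (fun α β n x y h => by rw [hi n h]) 1 (fun _ => cylMap u ≫ k) (v ≫ s)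
    (fun _ => by
      rw [cylEnd_naturality_assoc, k1, ← Category.assoc, sq.w, Category.assoc])
    (fun _ => by
      rw [Category.assoc, hkp, ← Category.assoc, ← Category.assoc, ← tensorMap_comp,
        ← tensorMap_comp, sq.w])
    (by rw [Category.assoc, hs, cylEnd_naturality_assoc, hr])
  refine ⟨⟨⟨cylEnd 0 Z ≫ H, ?_, ?_⟩⟩⟩
  · rw [← cylEnd_naturality_assoc, hHi (), cylEnd_naturality_assoc, k0, Category.comp_id]
  · rw [Category.assoc, hH, cylEnd_naturality_assoc, hr, Category.comp_id]

end MSSet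

namespace MSSet

open FreeSimplex

/-! ## Path objects -/

variable {X Y Z : MSSet.{u}}

theorem cylMap_id (X : MSSet.{u}) : cylMap (𝟙 X) = 𝟙 (cyl X) := tensorMap_id X

theorem cylMap_comp (f : X ⟶ Y) (g : Y ⟶ Z) : cylMap (f ≫ g) = cylMap f ≫ cylMap g :=
  tensorMap_comp f g

/-- The standard simplex without marked edges. -/
abbrev bareSimplex (n : ℕ) : MSSet.{u} := markedSimplex n fun _ _ => False

/-- The map out of an unmarked standard simplex that corresponds to a simplex. -/
def bareHom {n : ℕ} (x : X.cells n) : bareSimplex n ⟶ X := ofCell _ x fun _ h => h.elim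

theorem ap_bareHom {m n : ℕ} (x : X.cells n) (θ : Fin (m + 1) ↪o Fin (n + 1)) :
    ap (bareHom x) (mkSimplex _ θ) = res θ x := rfl

theorem ap_bareHom_topCell {n : ℕ} (x : X.cells n) : ap (bareHom x) (topCell _) = x :=
  res_refl x

theorem bareHom_ap {n : ℕ} (f : X ⟶ Y) (x : X.cells n) : bareHom (ap f x) = bareHom x ≫ f :=
  markedSimplex_hom_ext (by rw [ap_comp, ap_bareHom_topCell, ap_bareHom_topCell])

theorem bareHom_res {m n : ℕ} (θ : Fin (m + 1) ↪o Fin (n + 1)) (x : X.cells n) :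
    bareHom (res θ x) = bareHom (mkSimplex _ θ) ≫ bareHom x :=
  markedSimplex_hom_ext (by rw [ap_comp, ap_bareHom_topCell, ap_bareHom_topCell, ap_bareHom])

theorem bareHom_refl (n : ℕ) :
    bareHom (mkSimplex _ (RelEmbedding.refl _)) = 𝟙 (bareSimplex.{u} n) :=
  markedSimplex_hom_ext (ap_bareHom_topCell _)

/-- The path object of `Y`: its `n`-simplices are the maps from the cylinder on the `n`-simplex
to `Y`, and an edge is marked if both its ends are. -/
noncomputable def pathObject (Y : MSSet.{u}) : MSSet.{u} :=
  ofCells (fun n => cyl (bareSimplex n) ⟶ Y) (fun θ h => cylMap (bareHom (mkSimplex _ θ)) ≫ h)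
    (fun h => by rw [bareHom_refl, cylMap_id, Category.id_comp])
    (fun θ ψ h => by
      rw [← Category.assoc, ← cylMap_comp, ← bareHom_res, res_mkSimplex])
    {h | ∀ ε, ap (X := cyl (bareSimplex 1)) (Y := Y) h (ap (cylEnd ε _) (topCell _)) ∈ Y.marked}

/-- The simplex of the path object given by a map out of a cylinder. -/
def pathCell {n : ℕ} (h : cyl (bareSimplex n) ⟶ Y) : (pathObject Y).cells n := h

/-- The map out of a cylinder that is a simplex of the path object. -/
def pathHom {n : ℕ} (x : (pathObject Y).cells n) : cyl (bareSimplex n) ⟶ Y := x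

theorem pathHom_pathCell {n : ℕ} (h : cyl (bareSimplex n) ⟶ Y) : pathHom (pathCell h) = h := rfl

theorem pathCell_pathHom {n : ℕ} (x : (pathObject Y).cells n) : pathCell (pathHom x) = x := rfl

theorem pathHom_res {m n : ℕ} (θ : Fin (m + 1) ↪o Fin (n + 1)) (x : (pathObject Y).cells n) :
    pathHom (res θ x) = cylMap (bareHom (mkSimplex _ θ)) ≫ pathHom x := rfl

/-- The evaluation of a simplex of the path object at an end. -/
noncomputable def pathEnd (ε : Fin 2) {n : ℕ} (x : (pathObject Y).cells n) : Y.cells n :=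
  ap (pathHom x) (ap (cylEnd ε _) (topCell _))

theorem pathEnd_res (ε : Fin 2) {m n : ℕ} (θ : Fin (m + 1) ↪o Fin (n + 1))
    (x : (pathObject Y).cells n) : pathEnd ε (res θ x) = res θ (pathEnd ε x) := by
  rw [pathEnd, pathEnd, pathHom_res, ← ap_res, ← ap_res, ap_comp]
  congr 1
  refine (hom_congr (cylEnd_naturality ε (bareHom (mkSimplex _ θ))) (topCell _)).trans ?_
  rw [ap_comp, ap_bareHom_topCell, res_topCell]

theorem mem_marked_pathObject {x : (pathObject Y).cells 1} :
    x ∈ (pathObject Y).marked ↔ ∀ ε, pathEnd ε x ∈ Y.marked := Iff.rfl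

/-- The evaluation of the path object at an end. -/
noncomputable def pathEval (ε : Fin 2) (Y : MSSet.{u}) : pathObject Y ⟶ Y :=
  homMk (fun _ x => pathEnd ε x) (fun θ x => pathEnd_res ε θ x)
    (fun _ he => mem_marked_pathObject.1 he ε)

theorem pathEnd_pathCell_cylMap (ε : Fin 2) {n : ℕ} (F : cyl X ⟶ Y) (x : X.cells n) :
    pathEnd ε (pathCell (cylMap (bareHom x) ≫ F)) = ap F (ap (cylEnd ε X) x) := by
  rw [pathEnd, pathHom_pathCell, ap_comp]
  congr 1
  refine (hom_congr (cylEnd_naturality ε (bareHom x)) (topCell _)).trans ?_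
  rw [ap_comp, ap_bareHom_topCell]

/-- The map to the path object that corresponds to a map out of the cylinder. -/
noncomputable def curry (F : cyl X ⟶ Y) : X ⟶ pathObject Y :=
  homMk (fun _ x => pathCell (cylMap (bareHom x) ≫ F))
    (fun θ x => by
      rw [bareHom_res, cylMap_comp, Category.assoc]
      rfl)
    (fun e he => mem_marked_pathObject.2 fun ε => by
      rw [pathEnd_pathCell_cylMap]
      exact ap_mem F (ap_mem _ he))

theorem ap_curry (F : cyl X ⟶ Y) {n : ℕ} (x : X.cells n) :
    ap (curry F) x = pathCell (cylMap (bareHom x) ≫ F) := rfl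

theorem curry_pathEval (F : cyl X ⟶ Y) (ε : Fin 2) : curry F ≫ pathEval ε Y = cylEnd ε X ≫ F :=
  hom_ext_ap fun _ x => pathEnd_pathCell_cylMap ε F x

theorem comp_curry (f : X ⟶ Y) (F : cyl Y ⟶ Z) : f ≫ curry F = curry (cylMap f ≫ F) :=
  hom_ext_ap fun _ x => by
    rw [ap_comp, ap_curry, ap_curry, bareHom_ap, cylMap_comp, Category.assoc]

/-- The universal simplex of the free simplicial set with the given degeneracy. -/
def bareFree {n : ℕ} (t : FreeSimplex X.toSemiSSet n) :
    FreeSimplex (bareSimplex.{u} t.len).toSemiSSet n where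
  len := t.len
  deg := t.deg
  surj := t.surj
  simplex := topCell _

/-- The universal simplex of the cylinder over the simplices of a given dimension. -/
noncomputable def bareCyl {n : ℕ} (z : (cyl X).cells n) :
    (cyl (bareSimplex (tsnd z).len)).cells n :=
  tmk (tfst z) (bareFree (tsnd z)) fun i j h h' => tensor_inj z i j h h'

theorem map_bareFree {n : ℕ} (t : FreeSimplex X.toSemiSSet n) :
    (bareFree t).map (bareHom (X := X) t.simplex) = t := by
  obtain ⟨l, deg, surj, x⟩ := t
  exact congrArg (FreeSimplex.mk l deg surj) (ap_bareHom_topCell (X := X) x)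

theorem cylMap_bareCyl {n : ℕ} (z : (cyl X).cells n) :
    ap (cylMap (bareHom (X := X) (tsnd z).simplex)) (bareCyl z) = z :=
  tensor_ext rfl (map_bareFree (tsnd z))

/-- The simplex of `Y` given by a simplex of the cylinder on `X` and a map from `X` to the path
object of `Y`. -/
noncomputable def uncurryCell (G : X ⟶ pathObject Y) {n : ℕ} (z : (cyl X).cells n) : Y.cells n :=
  ap (pathHom (ap G (tsnd z).simplex)) (bareCyl z)

/-- The definition of `uncurryCell` uses the simplex of `X` that carries `z` nondegenerately. By
naturality of `G`, any simplex of `X` whose cylinder contains `z` gives the same value. -/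
theorem uncurryCell_cylMap (G : X ⟶ pathObject Y) {m n : ℕ} (x : X.cells n)
    (w : (cyl (bareSimplex n)).cells m) :
    uncurryCell G (ap (cylMap (bareHom x)) w) = ap (pathHom (ap G x)) w := by
  have h : ap G (ap (bareHom x) (tsnd w).simplex) = res (toEmb (tsnd w).simplex) (ap G x) :=
    ap_res G _ x
  change ap (pathHom (ap G (ap (bareHom x) (tsnd w).simplex))) (bareCyl w) = _
  rw [h, pathHom_res, ap_comp]
  exact congrArg _ (cylMap_bareCyl w)

theorem uncurryCell_res (G : X ⟶ pathObject Y) {m n : ℕ} (θ : Fin (m + 1) ↪o Fin (n + 1))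
    (z : (cyl X).cells n) : uncurryCell G (res θ z) = res θ (uncurryCell G z) := by
  have h : res θ z = ap (cylMap (bareHom (X := X) (tsnd z).simplex)) (res θ (bareCyl z)) := by
    rw [ap_res, cylMap_bareCyl]
  rw [h, uncurryCell_cylMap, ap_res]
  rfl

theorem uncurryCell_cylEnd (G : X ⟶ pathObject Y) (ε : Fin 2) {n : ℕ} (x : X.cells n) :
    uncurryCell G (ap (cylEnd ε X) x) = pathEnd ε (ap G x) := by
  have h : ap (cylEnd ε X) x = ap (cylMap (bareHom x)) (ap (cylEnd ε _) (topCell _)) := by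
    refine Eq.trans ?_ (hom_congr (cylEnd_naturality ε (bareHom x)) (topCell _)).symm
    rw [ap_comp, ap_bareHom_topCell]
  rw [h, uncurryCell_cylMap, pathEnd]

/-- A marked edge of the path object has marked ends by definition; 2-out-of-3 supplies the
diagonal. This is why the path object may be built from unmarked simplices. -/
theorem uncurryCell_mem_marked (hY : MarkedTwoOutOfThree Y) (G : X ⟶ pathObject Y)
    {e : (cyl X).cells 1} (he : e ∈ (cyl X).marked) : uncurryCell G e ∈ Y.marked := by
  obtain ⟨j, hj, x, rfl⟩ | ⟨j, x, rfl⟩ := cyl_edge_cases e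
  · have hx : x ∈ X.marked := tau_mem_marked.1 he
    have h : tau j x = ap (cylMap (bareHom x)) (tau j (topCell _)) := by
      rw [cylMap_tau, ap_bareHom_topCell]
    rw [h, uncurryCell_cylMap]
    exact ap_tau_mem_marked hY _ _ (ε := 0) (mem_marked_pathObject.1 (ap_mem G hx) 0) hj
  · have h : sigma j x = ap (cylMap (bareHom x)) (sigma j (topCell _)) := by
      rw [cylMap_sigma, ap_bareHom_topCell]
    rw [h, uncurryCell_cylMap]
    exact ap_mem _ (sigma_mem_marked _ _)

/-- The map out of the cylinder that corresponds to a map to the path object. -/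
noncomputable def uncurry (hY : MarkedTwoOutOfThree Y) (G : X ⟶ pathObject Y) : cyl X ⟶ Y :=
  homMk (fun _ z => uncurryCell G z) (fun θ z => uncurryCell_res G θ z)
    (fun _ he => uncurryCell_mem_marked hY G he)

theorem curry_uncurry (hY : MarkedTwoOutOfThree Y) (G : X ⟶ pathObject Y) :
    curry (uncurry hY G) = G :=
  hom_ext_ap fun _ x => by
    rw [ap_curry, ← pathCell_pathHom (ap G x)]
    congr 1
    exact hom_ext_ap fun _ w => uncurryCell_cylMap G x w

theorem cylEnd_uncurry (hY : MarkedTwoOutOfThree Y) (G : X ⟶ pathObject Y) (ε : Fin 2) :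
    cylEnd ε X ≫ uncurry hY G = G ≫ pathEval ε Y :=
  hom_ext_ap fun _ x => uncurryCell_cylEnd G ε x

/-- By currying, a lift is an extension from the cylinder on `A` and one end of the cylinder on `Z`.
-/
theorem trivialFibrations_pathEval (hY : IsFibrant Y) (ε : Fin 2) :
    trivialFibrations (pathEval ε Y) := by
  have hY' := markedTwoOutOfThree_of_isFibrant hY
  intro A Z i hi
  refine ⟨fun {u v} sq => ?_⟩
  obtain ⟨H, -, hHi, hH⟩ := exists_cylinder_lift hY hY (toPoint _) (ι := Unit) (fun _ => i)
    (fun α β n x y h => by rw [hi n h]) ε (fun _ => uncurry hY' u) v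
    (fun _ => by rw [cylEnd_uncurry, sq.w]) (fun _ => rfl) rfl
  exact ⟨⟨⟨curry H, by rw [comp_curry, hHi (), curry_uncurry], by rw [curry_pathEval, hH]⟩⟩⟩

/-- The map from the path object of a fibrant object to its square lifts against the
generators. -/
theorem exists_path_lift (hY : IsFibrant Y) {A Z : MSSet.{u}} {j : A ⟶ Z}
    (hj : anodyneGenerators j) (f : A ⟶ pathObject Y) (g : Fin 2 → (Z ⟶ Y))
    (h : ∀ ε, f ≫ pathEval ε Y = j ≫ g ε) :
    ∃ l : Z ⟶ pathObject Y, j ≫ l = f ∧ ∀ ε, l ≫ pathEval ε Y = g ε := by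
  have hY' := markedTwoOutOfThree_of_isFibrant hY
  cases hj with
  | horn n hn k =>
    obtain ⟨N, rfl⟩ : ∃ N, n = N + 1 := ⟨n - 1, by omega⟩
    obtain ⟨H, h1, h2⟩ := exists_prism_lift hY k (uncurry hY' f) g
      (fun ε => by rw [cylEnd_uncurry, h])
    exact ⟨curry H, by rw [comp_curry, h1, curry_uncurry], fun ε => by rw [curry_pathEval, h2]⟩
  | saturation =>
    -- The underlying map does not change. Marking in the path object is tested at the two ends, and
    -- the maps `g ε` already preserve all marked edges of the target.
    refine ⟨⟨f.map, fun e _ => mem_marked_pathObject.2 fun ε => ?_⟩, hom_ext (Category.id_comp _),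
      fun ε => hom_ext ?_⟩
    · have he : pathEnd ε (ap f e) = ap (g ε) e := hom_congr (h ε) e
      exact he.symm ▸ ap_mem (g ε) trivial
    · exact (congrArg Hom.map (h ε)).trans (Category.id_comp _)

/-! ## Pullbacks -/

section Pullback

variable (f : X ⟶ Z) (g : Y ⟶ Z)

/-- The pullback of marked semisimplicial sets. -/
def pb : MSSet.{u} :=
  ofCells (fun n => {x : X.cells n × Y.cells n // ap f x.1 = ap g x.2})
    (fun θ x => ⟨(res θ x.1.1, res θ x.1.2), by rw [ap_res, ap_res, x.2]⟩)
    (fun _ => Subtype.ext (Prod.ext (res_refl _) (res_refl _)))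
    (fun _ _ _ => Subtype.ext (Prod.ext (res_res _ _ _) (res_res _ _ _)))
    {e | e.1.1 ∈ X.marked ∧ e.1.2 ∈ Y.marked}

variable {f g} in
/-- The simplex of the pullback given by its components. -/
def pbMk {n : ℕ} (x : X.cells n) (y : Y.cells n) (h : ap f x = ap g y) : (pb f g).cells n :=
  (⟨(x, y), h⟩ : {x : X.cells n × Y.cells n // ap f x.1 = ap g x.2})

/-- The first projection of the pullback. -/
def pbFst : pb f g ⟶ X :=
  homMk (fun n (x : {x : X.cells n × Y.cells n // ap f x.1 = ap g x.2}) => x.1.1) (fun _ _ => rfl)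
    (fun _ he => he.1)

/-- The second projection of the pullback. -/
def pbSnd : pb f g ⟶ Y :=
  homMk (fun n (x : {x : X.cells n × Y.cells n // ap f x.1 = ap g x.2}) => x.1.2) (fun _ _ => rfl)
    (fun _ he => he.2)

theorem pb_w : pbFst f g ≫ f = pbSnd f g ≫ g :=
  hom_ext_ap fun n (x : {x : X.cells n × Y.cells n // ap f x.1 = ap g x.2}) => x.2

variable {f g}

/-- The map to the pullback given by its components. -/
def pbLift {W : MSSet.{u}} (a : W ⟶ X) (b : W ⟶ Y) (h : a ≫ f = b ≫ g) : W ⟶ pb f g :=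
  homMk (fun _ w => pbMk (ap a w) (ap b w) (hom_congr h w))
    (fun θ w => Subtype.ext (Prod.ext (ap_res a θ w) (ap_res b θ w)))
    (fun _ he => ⟨ap_mem a he, ap_mem b he⟩)

theorem pbLift_fst {W : MSSet.{u}} (a : W ⟶ X) (b : W ⟶ Y) (h : a ≫ f = b ≫ g) :
    pbLift a b h ≫ pbFst f g = a :=
  hom_ext_ap fun _ _ => rfl

theorem pbLift_snd {W : MSSet.{u}} (a : W ⟶ X) (b : W ⟶ Y) (h : a ≫ f = b ≫ g) :
    pbLift a b h ≫ pbSnd f g = b :=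
  hom_ext_ap fun _ _ => rfl

theorem pb_hom_ext {W : MSSet.{u}} {a b : W ⟶ pb f g} (h₁ : a ≫ pbFst f g = b ≫ pbFst f g)
    (h₂ : a ≫ pbSnd f g = b ≫ pbSnd f g) : a = b :=
  hom_ext_ap fun _ w => Subtype.ext (Prod.ext (hom_congr h₁ w) (hom_congr h₂ w))

variable (f g)

theorem isPullback_pb : IsPullback (pbFst f g) (pbSnd f g) f g :=
  .of_isLimit' ⟨pb_w f g⟩ <| PullbackCone.IsLimit.mk _
    (fun s => pbLift s.fst s.snd s.condition) (fun _ => pbLift_fst _ _ _)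
    (fun _ => pbLift_snd _ _ _) fun s _ h₁ h₂ => pb_hom_ext
      (h₁.trans (pbLift_fst s.fst s.snd s.condition).symm)
      (h₂.trans (pbLift_snd s.fst s.snd s.condition).symm)

theorem fibrations_pbFst (hg : fibrations g) : fibrations (pbFst f g) :=
  (MorphismProperty.rlp_isStableUnderBaseChange anodyneGenerators).of_isPullback
    (isPullback_pb f g).flip hg

theorem trivialFibrations_pbFst (hg : trivialFibrations g) : trivialFibrations (pbFst f g) :=
  (MorphismProperty.rlp_isStableUnderBaseChange injections).of_isPullback
    (isPullback_pb f g).flip hg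

end Pullback

theorem isFibrant_of_fibrations {f : X ⟶ Y} (hf : fibrations f) (hY : IsFibrant Y) : IsFibrant X :=
  (MorphismProperty.rlp_isMultiplicative anodyneGenerators).comp_mem f (toPoint Y) hf hY

/-! ## Factorization -/

/-- Every map between fibrant objects factors as a homotopy equivalence followed by a fibration. -/
theorem exists_factorization (hX : IsFibrant X) (hY : IsFibrant Y) (f : X ⟶ Y) :
    ∃ (P : MSSet.{u}) (_ : IsFibrant P) (i : X ⟶ P) (p : P ⟶ Y),
      homotopyEquivalences i ∧ fibrations p ∧ i ≫ p = f := by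
  have ht := trivialFibrations_pbFst f (pathEval 0 Y) (trivialFibrations_pathEval hY 0)
  obtain ⟨r, r0, r1⟩ := homotopic_iff.1 (Homotopic.refl hY f)
  -- The pullback consists of points of `X` with a path starting at their image. The section uses a
  -- homotopy `r` from `f` to itself in place of constant paths.
  let i : X ⟶ pb f (pathEval 0 Y) := pbLift (𝟙 X) (curry r) (by
    rw [curry_pathEval, r0, Category.id_comp])
  have hi : i ≫ pbFst f (pathEval 0 Y) = 𝟙 X := pbLift_fst _ _ _
  refine ⟨pb f (pathEval 0 Y), isFibrant_of_fibrations (trivialFibrations_le_fibrations _ ht) hX,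
    i, pbSnd f (pathEval 0 Y) ≫ pathEval 1 Y, ?_, ?_, ?_⟩
  · refine homotopyEquivalences_iff.2 ⟨pbFst f (pathEval 0 Y), ?_, homotopic_of_comp_eq ht hX ?_⟩
    · rw [hi]
      exact Homotopic.refl hX _
    · rw [Category.assoc, hi, Category.comp_id, Category.id_comp]
  · intro A Z j hj
    refine ⟨fun {u v} sq => ?_⟩
    have := hX j hj
    have sq' : CommSq (u ≫ pbFst f (pathEval 0 Y)) j (toPoint X) (toPoint Z) := ⟨rfl⟩
    -- The component in `X` is lifted first, as `X` is fibrant; this prescribes the starting point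
    -- of the path, and `v` its end point.
    obtain ⟨l, hl, hl'⟩ := exists_path_lift hY hj (u ≫ pbSnd f (pathEval 0 Y)) ![sq'.lift ≫ f, v]
      (Fin.forall_fin_two.2 ⟨by
        change _ = j ≫ sq'.lift ≫ f
        rw [← Category.assoc j, sq'.fac_left, Category.assoc, Category.assoc, pb_w], by
        rw [Category.assoc]
        exact sq.w⟩)
    have hl0 : l ≫ pathEval 0 Y = sq'.lift ≫ f := hl' 0
    refine ⟨⟨⟨pbLift sq'.lift l hl0.symm, pb_hom_ext ?_ ?_, ?_⟩⟩⟩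
    · rw [Category.assoc, pbLift_fst, sq'.fac_left]
    · rw [Category.assoc, pbLift_snd, hl]
    · rw [← Category.assoc, pbLift_snd]
      exact hl' 1
  · rw [← Category.assoc, pbLift_snd, curry_pathEval, r1]

end MSSet

namespace MSSet

/-! ## The fibration category -/

theorem isFibrant_point : IsFibrant point.{u} := by
  change fibrations (toPoint point)
  rw [← isTerminalPoint.hom_ext (𝟙 point) (toPoint point)]
  exact (MorphismProperty.rlp_isMultiplicative anodyneGenerators).id_mem point

/-- The point is terminal among fibrant marked semisimplicial sets. -/
def isTerminalFibrantPoint :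
    IsTerminal (⟨point, isFibrant_point⟩ : IsFibrant.{u}.FullSubcategory) :=
  IsTerminal.ofUniqueHom (fun X => ObjectProperty.homMk (toPoint X.obj)) fun _ _ =>
    ObjectProperty.hom_ext _ (isTerminalPoint.hom_ext _ _)

instance : fibrations.{u}.RespectsIso :=
  inferInstanceAs anodyneGenerators.{u}.rlp.RespectsIso

instance : trivialFibrations.{u}.RespectsIso :=
  inferInstanceAs injections.{u}.rlp.RespectsIso

theorem isPullback_fibrant {X Y Z : IsFibrant.{u}.FullSubcategory} (f : X ⟶ Z) (g : Y ⟶ Z)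
    (h : IsFibrant (pb f.hom g.hom)) :
    IsPullback (ObjectProperty.homMk (pbFst f.hom g.hom) : ⟨pb f.hom g.hom, h⟩ ⟶ X)
      (ObjectProperty.homMk (pbSnd f.hom g.hom)) f g :=
  .of_map IsFibrant.ι (ObjectProperty.hom_ext _ (pb_w _ _)) (isPullback_pb f.hom g.hom)

/-- One explicit pullback per cospan suffices. It stays among fibrant objects because its projection
to the fibrant `X` is again a fibration. -/
theorem isStableUnderBaseChange_inverseImage {P : MorphismProperty MSSet.{u}} [P.RespectsIso]
    (hP : P ≤ fibrations)
    (h : ∀ {X Y Z : MSSet.{u}} (f : X ⟶ Z) (g : Y ⟶ Z), P g → P (pbFst f g)) :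
    (P.inverseImage IsFibrant.{u}.ι).IsStableUnderBaseChange :=
  .of_forall_exists_isPullback fun {X _ _} f g _ hg =>
    ⟨_, _, _, isPullback_fibrant f g (isFibrant_of_fibrations (hP _ (h f.hom g.hom hg)) X.property),
      h f.hom g.hom hg⟩

/-- This turns the trivial fibrations into a class given by a lifting property, for which stability
under pullback is automatic. -/
theorem inverseImage_fibrations_inf_homotopyEquivalences :
    fibrations.{u}.inverseImage IsFibrant.{u}.ι ⊓
      homotopyEquivalences.{u}.inverseImage IsFibrant.{u}.ι =
    trivialFibrations.{u}.inverseImage IsFibrant.{u}.ι := by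
  ext X Y f
  exact ⟨fun h => trivialFibrations_of_homotopyEquivalences h.1 X.property Y.property h.2,
    fun h => ⟨trivialFibrations_le_fibrations _ h,
      homotopyEquivalences_of_trivialFibrations h Y.property⟩⟩

/-- Fibrant marked semisimplicial sets form a fibration category. -/
theorem isFibrationCategory_fibrant :
    IsFibrationCategory (C := MSSet.IsFibrant.{u}.FullSubcategory)
      (MSSet.homotopyEquivalences.{u}.inverseImage MSSet.IsFibrant.{u}.ι)
      (MSSet.fibrations.{u}.inverseImage MSSet.IsFibrant.{u}.ι) where
  weq_multiplicative :=
    { id_mem := fun X => homotopyEquivalences_of_isIso X.property X.property (𝟙 X.obj)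
      comp_mem := fun {X _ Z} _ _ hf hg => homotopyEquivalences_comp X.property Z.property hf hg }
  weq_of_isIso {X Y} f _ := homotopyEquivalences_of_isIso X.property Y.property f.hom
  fib_multiplicative :=
    { id_mem := fun X => (MorphismProperty.rlp_isMultiplicative anodyneGenerators).id_mem X.obj
      comp_mem := fun f g hf hg =>
        (MorphismProperty.rlp_isMultiplicative anodyneGenerators).comp_mem f.hom g.hom hf hg }
  fib_of_isIso f _ := MorphismProperty.rlp_of_isIso _ f.hom
  hasTerminal := isTerminalFibrantPoint.hasTerminal
  fibrant {X T} hT f := by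
    have e : f = ObjectProperty.homMk (toPoint X.obj) ≫
        (isTerminalFibrantPoint.uniqueUpToIso hT).hom := hT.hom_ext _ _
    rw [e]
    exact (MorphismProperty.rlp_isMultiplicative anodyneGenerators).comp_mem _ _ X.property
      (MorphismProperty.rlp_of_isIso _ (isTerminalFibrantPoint.uniqueUpToIso hT).hom.hom)
  hasPullbacks := ⟨fun {X Y _ f} g hf => by
    have h := isFibrant_of_fibrations (fibrations_pbFst g.hom f.hom hf) Y.property
    exact (isPullback_fibrant g f h).flip.hasPullback⟩
  fib_baseChange := isStableUnderBaseChange_inverseImage le_rfl fibrations_pbFst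
  trivFib_baseChange := by
    rw [inverseImage_fibrations_inf_homotopyEquivalences]
    exact isStableUnderBaseChange_inverseImage trivialFibrations_le_fibrations
      trivialFibrations_pbFst
  factorization {X Y} f := by
    obtain ⟨P, hP, i, p, hi, hp, h⟩ := exists_factorization X.property Y.property f.hom
    exact ⟨⟨P, hP⟩, ObjectProperty.homMk i, ObjectProperty.homMk p, hi, hp,
      ObjectProperty.hom_ext _ h⟩
  two_out_of_six {X Y Z T} f g h hfg hgh := homotopyEquivalences_two_out_of_six X.property
    Y.property Z.property T.property f.hom g.hom h.hom hfg hgh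

end MSSet

theorem mainTheorem9 :
    IsFibrationCategory (C := MSSet.IsFibrant.{u}.FullSubcategory)
      (MSSet.homotopyEquivalences.{u}.inverseImage MSSet.IsFibrant.{u}.ι)
      (MSSet.fibrations.{u}.inverseImage MSSet.IsFibrant.{u}.ι) := MSSet.isFibrationCategory_fibrant
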